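/- Let $\chi:\mathbb R\to\mathbb R$ be a smooth cut-off function which vanishes on $]-\infty,\varepsilon[$ for some $\varepsilon>0$ and equals $1$ on $[1,\infty[$, and for $s\in\mathbb C$, $v\ge 0$ let $\sigma_{s,v}(\xi)=\chi(\xi)(\xi+v)^{-s}$. For functions $f_1,\dots,f_k$ on $\mathbb R$ define the cut-off nested sums, in the strict and in the weak inequality version, as the finite parts $$\mathrm{Z}_{<}(f_1\otimes\cdots\otimes f_k)=\mathop{\mathrm{fp}}_{N\to\infty}\sum_{0<n_k<\cdots<n_1\le N}f_1(n_1)\cdots f_k(n_k),\qquad \mathrm{Z}_{\le}(f_1\otimes\cdots\otimes f_k)=\mathop{\mathrm{fp}}_{N\to\infty}\sum_{0<n_k\le\cdots\le n_1\le N}f_1(n_1)\cdots f_k(n_k),$$ where the finite part of a sequence $u_N$ is the constant $a$ such that, up to $o(1)$, $u_N$ is $a$ plus a finite linear combination of terms $N^{\alpha}\log^l N$ with $\alpha\in\mathbb C$, $l\in\mathbb N$, $(\alpha,l)\ne(0,0)$. Let $\preceq$ be one of $<$, $\le$. For $v_1,\dots,v_k\ge 0$ put $$\zeta_{\preceq}(s_1,\dots,s_k;v_1,\dots,v_k)=\mathrm{Z}_{\preceq}(\sigma_{s_1,v_1}\otimes\cdots\otimes\sigma_{s_k,v_k}),$$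 and let $H_k\subset\mathbb C^k$ be the union of the hyperplanes $s_1+\cdots+s_j\in\mathbb Z\cap\,]-\infty,j]$, $j=1,\dots,k$. 1. (Extension and poles.) For all $(s_1,\dots,s_k)\in\mathbb C^k$ the finite part defining $\zeta_{\preceq}(s_1,\dots,s_k;v_1,\dots,v_k)$ exists and is unique. If $\mathrm{Re}(s_1+\cdots+s_m)>m$ for all $m\in\{1,\dots,k\}$, then the series $$\sum_{1\le n_k\preceq n_{k-1}\preceq\cdots\preceq n_1}(n_1+v_1)^{-s_1}\cdots(n_k+v_k)^{-s_k}$$ converges absolutely, with sum $\zeta_{\preceq}(s_1,\dots,s_k;v_1,\dots,v_k)$. The function $s\mapsto\zeta_{\preceq}(s;v)$ is holomorphic on $\mathbb C^k\setminus H_k$ and is a meromorphic function on $\mathbb C^k$: near every point there are holomorphic $g,h$, $h\not\equiv 0$, such that it equals $g/h$ wherever $h\neq 0$. (On $H_k$ itself the finite part need not be the value of this meromorphic function.) In particular the case $v_1=\cdots=v_k=0$ gives the multiple zeta functions. 2. (Stuffle relations.) Let $k,l\ge 0$ and $v_1,\dots,v_{k+l}\ge 0$. For $0\le r\le\min(k,l)$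 let $\mathrm{mixsh}(k,l;r)$ be the set of surjections $\pi:\{1,\dots,k+l\}\to\{1,\dots,k+l-r\}$ with $\pi(1)<\cdots<\pi(k)$ and $\pi(k+1)<\cdots<\pi(k+l)$; for such $\pi$ put $\sigma^\pi_j=\prod_{\pi(i)=j}\sigma_{s_i,v_i}$ and $s^\pi_j=\sum_{\pi(i)=j}s_i$. Then the finite part defining $\mathrm{Z}_{\preceq}(\sigma^\pi_1\otimes\cdots\otimes\sigma^\pi_{k+l-r})$ exists and is unique for all $s\in\mathbb C^{k+l}$; it is the sum of the corresponding absolutely convergent nested series when $\mathrm{Re}(s_1^\pi+\cdots+s_m^\pi)>m$ for all $m\le k+l-r$; and as a function of $s$ it is meromorphic on $\mathbb C^{k+l}$ (in the sense of 1) and holomorphic where $s^\pi\notin H_{k+l-r}$. With $\epsilon=1$ for the strict version and $\epsilon=-1$ for the weak version, $$\zeta_{\preceq}(s_1,\dots,s_k;v_1,\dots,v_k)\,\zeta_{\preceq}(s_{k+1},\dots,s_{k+l};v_{k+1},\dots,v_{k+l})=\sum_{r=0}^{\min(k,l)}\epsilon^r\sum_{\pi\in\mathrm{mixsh}(k,l;r)}\mathrm{Z}_{\preceq}(\sigma^\pi_1\otimes\cdots\otimes\sigma^\pi_{k+l-r})$$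 as an identity of meromorphic functions, valid at every $s\in\mathbb C^{k+l}$ for which $(s_1,\dots,s_k)\notin H_k$, $(s_{k+1},\dots,s_{k+l})\notin H_l$ and $s^\pi\notin H_{k+l-r}$ for all $\pi$ and $r$. When $v_1=\cdots=v_{k+l}=v$ it reads, at the same points, $$\zeta_{\preceq}(s_1,\dots,s_k;v,\dots,v)\,\zeta_{\preceq}(s_{k+1},\dots,s_{k+l};v,\dots,v)=\sum_{r=0}^{\min(k,l)}\epsilon^r\sum_{\pi\in\mathrm{mixsh}(k,l;r)}\zeta_{\preceq}(s^\pi_1,\dots,s^\pi_{k+l-r};v,\dots,v).$$ -/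

import Mathlib

open Filter Topology

namespace NestedZeta

/-- The two versions of nested sums: `n₁ > ⋯ > n_k` (strict) and `n₁ ≥ ⋯ ≥ n_k` (weak). -/
inductive Version
  | strict
  | weak

/-- The index tuples `(n₁, …, n_k)` of positive integers that a nested sum runs over.
Entry `0` of the tuple is the outermost (largest) index `n₁`. -/
def IsChain (c : Version) {k : ℕ} (n : Fin k → ℕ) : Prop :=
  (∀ i, 1 ≤ n i) ∧
    match c with
    | .strict => StrictAnti n
    | .weak => Antitone n

/-- The sign of the product `•` on functions used in the stuffle product: the ordinary product in
the strict case, its opposite in the weak case. -/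
def stuffleSign : Version → ℂ
  | .strict => 1
  | .weak => -1

/-- Smooth cut-off functions at the origin, on the positive half line. -/
structure IsCutoff (χ : ℝ → ℝ) : Prop where
  smooth : ContDiff ℝ (⊤ : ℕ∞) χ
  vanishes : ∃ ε > 0, ∀ ξ < ε, χ ξ = 0
  eq_one : ∀ ξ, 1 ≤ ξ → χ ξ = 1

noncomputable section

/-- The symbol `σ_{s,v}(ξ) = χ(ξ) (ξ + v)^{-s}`. -/
def symb (χ : ℝ → ℝ) (s : ℂ) (v : ℝ) (ξ : ℝ) : ℂ :=
  (χ ξ : ℂ) * ((ξ + v : ℝ) : ℂ) ^ (-s)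

/-- The factors of `σ_{s₁,v₁} ⊗ ⋯ ⊗ σ_{s_k,v_k}`. -/
def symbTensor (χ : ℝ → ℝ) {k : ℕ} (v : Fin k → ℝ) (s : Fin k → ℂ) : Fin k → ℝ → ℂ :=
  fun i => symb χ (s i) (v i)

open Classical in
/-- The truncated nested sum of `f₁ ⊗ ⋯ ⊗ f_k`:
`∑ f₁(n₁) ⋯ f_k(n_k)` over the chains `(n₁, …, n_k)` with entries in `{1, …, N}`. -/
def truncSum (c : Version) {k : ℕ} (f : Fin k → ℝ → ℂ) (N : ℕ) : ℂ :=
  ∑ n ∈ (Fintype.piFinset fun _ : Fin k => Finset.Icc 1 N) with IsChain c n,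
    ∏ i, f i (n i : ℝ)

/-- `a` is a constant term in the asymptotic expansion of `u N` in powers of `N` and `log N` as
`N → ∞`: up to `o(1)`, `u N` equals `a` plus a finite linear combination of terms
`N ^ α * (log N) ^ l` with `(α, l) ≠ (0, 0)`. -/
def HasFinitePart (u : ℕ → ℂ) (a : ℂ) : Prop :=
  ∃ (T : Finset (ℂ × ℕ)) (b : ℂ × ℕ → ℂ), (0, 0) ∉ T ∧
    Tendsto (fun N : ℕ => u N - ∑ p ∈ T, b p * (N : ℂ) ^ p.1 * (Real.log N : ℂ) ^ p.2)
      atTop (𝓝 a)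

open Classical in
/-- The finite part `fp_{N → ∞} u N` (and `0` if there is none). -/
def finitePart (u : ℕ → ℂ) : ℂ :=
  if h : ∃ a, HasFinitePart u a then h.choose else 0

/-- The cut-off nested sum of `f₁ ⊗ ⋯ ⊗ f_k`. -/
def cutoffSum (c : Version) {k : ℕ} (f : Fin k → ℝ → ℂ) : ℂ :=
  finitePart (truncSum c f)

/-- The cut-off nested sum of `σ_{s₁,v₁} ⊗ ⋯ ⊗ σ_{s_k,v_k}`, as a function of `(s₁, …, s_k)`. -/
def multiZeta (c : Version) (χ : ℝ → ℝ) {k : ℕ} (v : Fin k → ℝ) (s : Fin k → ℂ) : ℂ :=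
  cutoffSum c (symbTensor χ v s)

/-- The domain `Re (s₁ + ⋯ + s_m) > m` for `m = 1, …, k`. -/
def convergenceDomain (k : ℕ) : Set (Fin k → ℂ) :=
  {s | ∀ j : Fin k, ((j : ℕ) + 1 : ℝ) < (∑ i ∈ Finset.Iic j, s i).re}

/-- The union of the hyperplanes `s₁ + ⋯ + s_j ∈ ℤ ∩ (-∞, j]` for `j = 1, …, k`. -/
def polarSet (k : ℕ) : Set (Fin k → ℂ) :=
  {s | ∃ (j : Fin k) (m : ℤ), m ≤ (j : ℕ) + 1 ∧ ∑ i ∈ Finset.Iic j, s i = (m : ℂ)}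

/-- Meromorphic functions on `ℂ^k`: near every point a quotient `g / h` of holomorphic functions
with `h` not identically zero. Values at the zeros of `h` play no role, as for Mathlib's
one-variable `Meromorphic`. -/
def IsMeromorphic {k : ℕ} (F : (Fin k → ℂ) → ℂ) : Prop :=
  ∀ s₀ : Fin k → ℂ, ∃ g h : (Fin k → ℂ) → ℂ, AnalyticAt ℂ g s₀ ∧ AnalyticAt ℂ h s₀ ∧
    (¬ ∀ᶠ s in 𝓝 s₀, h s = 0) ∧ ∀ᶠ s in 𝓝 s₀, h s ≠ 0 → F s = g s / h s

open Classical in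
/-- The `(k, l)`-quasi-shuffles of type `r`: the surjections from `k + l` onto `k + l - r` letters
that increase strictly on the first `k` and on the last `l` letters. -/
def mixSh (k l r : ℕ) : Finset (Fin (k + l) → Fin (k + l - r)) :=
  {π | Function.Surjective π ∧ StrictMono (fun i : Fin k => π (Fin.castAdd l i)) ∧
    StrictMono (fun i : Fin l => π (Fin.natAdd k i))}

/-- `(∏_{π(i) = j} f_i)_j`, the letters of a word merged along `π`. -/
def mergeTensor {m p : ℕ} (π : Fin m → Fin p) (f : Fin m → ℝ → ℂ) : Fin p → ℝ → ℂ :=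
  fun j ξ => ∏ i with π i = j, f i ξ

/-- `(∑_{π(i) = j} s_i)_j`, the arguments merged along `π`. -/
def mergeArgs {m p : ℕ} (π : Fin m → Fin p) (s : Fin m → ℂ) : Fin p → ℂ :=
  fun j => ∑ i with π i = j, s i

/-- The points of `ℂ^(k+l)` at which one of the functions in the stuffle relation for words of
lengths `k` and `l` may have a pole. -/
def stufflePolarSet (k l : ℕ) : Set (Fin (k + l) → ℂ) :=
  {s | (fun i => s (Fin.castAdd l i)) ∈ polarSet k ∨ (fun i => s (Fin.natAdd k i)) ∈ polarSet l ∨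
    ∃ r ≤ min k l, ∃ π ∈ mixSh k l r, mergeArgs π s ∈ polarSet (k + l - r)}

end

end NestedZeta

/-! Only the values at integers `n ≥ 1` enter, where the cut-off equals 1, so every letter expands
in powers `n ^ (-z - m)`. An inner nested sum is a constant plus powers of `n` and `log n`.
Multiplying it by the next letter and summing raises exponents by one, possibly raises the power of
the logarithm at exponent `-1`, and creates a new constant. By induction the truncated sum is a
constant plus an expansion with exponents `j - (s₁ + ⋯ + s_j) - m`, the set `expo`
(`exists_nest_sub_const_mem_asymp`). This holds for every `s`, so finite parts always exist; the
polar set is exactly where `0` is one of these exponents, and off it the finite part is the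
constant. If all exponents have negative real part, the truncated sums converge; applied to the real
parts of `s` this bounds the sums of absolute values.

Finite parts are unique because the operators `g(N) ↦ g(mN) - m ^ α g(N)` with `m ^ α ≠ 1`
annihilate the terms with exponent `α ≠ 0` while acting invertibly on constants. What remains is a
polynomial in `log N`, which converges only if it is constant (`eq_zero_of_tendsto_sum_logPow`).

For the dependence on `s`, write the outermost letter as a difference `t n - t (n + 1)`. Abel
summation (`nest_cons_cons_of_telescoping`) then absorbs `t` into the second letter: the depth drops
by one and the first two exponents `z, w` become `z + w - 1`. The family `t` is holomorphic after
multiplication by a factor vanishing exactly where `1 - z ∈ ℕ`. The product `D` of these factors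
vanishes locally exactly on the polar set, and `D` times the truncated sum is a holomorphic `Z` plus
terms with exponents in `expo`. So the finite part is `Z / D` off the polar set
(`exists_local_nest`, `finitePart_nest_eq_div`).

The stuffle relation holds exactly for truncated sums at each `N` (`nest_mul_nest`). Taking finite
parts is multiplicative unless an exponent of one factor cancels one of the other; such a
cancellation would put a merged word on its polar set, via the shuffle that moves two prefixes to
the front. The identity therefore holds pointwise, without analytic continuation. -/

namespace NestedZeta

/-! ### Normally convergent series of analytic functions on complex normed spaces. -/

section AnalyticSeries

variable {E : Type*} [NormedAddCommGroup E] [NormedSpace ℂ E]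

/-- Cauchy's one-variable estimate on the complex line `t ↦ x + t • y`, on the disc of radius `ρ /
‖y‖`. -/
theorem norm_fderiv_le_of_forall_mem_ball {F : Type*} [NormedAddCommGroup F] [NormedSpace ℂ F]
    {f : E → F} {x : E} {ρ C : ℝ} (hρ : 0 < ρ) (hC : 0 ≤ C)
    (hf : ∀ y ∈ Metric.closedBall x ρ, DifferentiableAt ℂ f y)
    (hb : ∀ y ∈ Metric.closedBall x ρ, ‖f y‖ ≤ C) : ‖fderiv ℂ f x‖ ≤ C / ρ := by
  refine ContinuousLinearMap.opNorm_le_bound _ (by positivity) fun y => ?_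
  rcases eq_or_ne y 0 with rfl | hy
  · simp
  have hy' : 0 < ‖y‖ := norm_pos_iff.2 hy
  have hmem : ∀ t ∈ Metric.closedBall (0 : ℂ) (ρ / ‖y‖), x + t • y ∈ Metric.closedBall x ρ := by
    intro t ht
    rw [mem_closedBall_zero_iff] at ht
    rw [mem_closedBall_iff_norm, add_sub_cancel_left, norm_smul]
    exact (le_div_iff₀ hy').1 ht
  have hline : ∀ t : ℂ, HasDerivAt (fun t : ℂ => x + t • y) y t := fun t => by
    simpa using ((hasDerivAt_id t).smul_const y).const_add x
  have hd : ∀ t ∈ Metric.closedBall (0 : ℂ) (ρ / ‖y‖),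
      HasDerivAt (fun t : ℂ => f (x + t • y)) (fderiv ℂ f (x + t • y) y) t := fun t ht =>
    (hf _ (hmem t ht)).hasFDerivAt.comp_hasDerivAt t (hline t)
  have hcl : DiffContOnCl ℂ (fun t : ℂ => f (x + t • y)) (Metric.ball 0 (ρ / ‖y‖)) := by
    refine DifferentiableOn.diffContOnCl fun t ht => ?_
    exact (hd t (Metric.closure_ball_subset_closedBall ht)).differentiableAt.differentiableWithinAt
  have := Complex.norm_deriv_le_of_forall_mem_sphere_norm_le (div_pos hρ hy') hcl
    (fun t ht => hb _ (hmem t (Metric.sphere_subset_closedBall ht)))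
  rw [(hd 0 (Metric.mem_closedBall_self (by positivity))).deriv] at this
  simp only [zero_smul, add_zero] at this
  calc _ ≤ _ := this
    _ = _ := by field_simp

/-- The Cauchy estimate is iterated; each derivative costs a width `ρ` of the ball and a factor `1 /
ρ`. -/
theorem norm_iteratedFDeriv_le_of_forall_mem_ball {F : Type*} [NormedAddCommGroup F]
    [NormedSpace ℂ F] [CompleteSpace F]
    {f : E → F} {x : E} {R ρ C : ℝ} (hρ : 0 < ρ) (hC : 0 ≤ C)
    (hf : AnalyticOnNhd ℂ f (Metric.ball x R)) (hb : ∀ y ∈ Metric.ball x R, ‖f y‖ ≤ C) (k : ℕ) :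
    ∀ y ∈ Metric.ball x (R - k * ρ), ‖iteratedFDeriv ℂ k f y‖ ≤ C / ρ ^ k := by
  induction k with
  | zero => intro y hy; simpa using hb y (by simpa using hy)
  | succ k ih =>
    intro y hy
    have hsub : Metric.closedBall y ρ ⊆ Metric.ball x (R - k * ρ) := by
      intro w hw
      rw [Metric.mem_ball] at hy ⊢
      rw [Metric.mem_closedBall] at hw
      push_cast at hy
      linarith [dist_triangle w y x]
    have hsub' : Metric.ball x (R - k * ρ) ⊆ Metric.ball x R :=
      Metric.ball_subset_ball (by nlinarith [(Nat.cast_nonneg k : (0 : ℝ) ≤ k)])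
    rw [← norm_fderiv_iteratedFDeriv]
    calc _ ≤ C / ρ ^ k / ρ := norm_fderiv_le_of_forall_mem_ball hρ (by positivity)
          (fun w hw => (hf.iteratedFDeriv k w (hsub' (hsub hw))).differentiableAt)
          (fun w hw => ih w (hsub hw))
      _ = _ := by rw [div_div, pow_succ]

/-- The Taylor series of a function between normed spaces. -/
noncomputable def taylorFSeries (f : E → ℂ) (x : E) : FormalMultilinearSeries ℂ E ℂ :=
  fun k => ((k.factorial : ℂ)⁻¹) • iteratedFDeriv ℂ k f x

theorem norm_taylorFSeries_le {f : E → ℂ} {x : E} {R C : ℝ} (hR : 0 < R) (hC : 0 ≤ C)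
    (hf : AnalyticOnNhd ℂ f (Metric.ball x R)) (hb : ∀ y ∈ Metric.ball x R, ‖f y‖ ≤ C) (k : ℕ) :
    ‖taylorFSeries f x k‖ ≤ C * Real.exp 1 * (Real.exp 1 / R) ^ k := by
  have hk : (0 : ℝ) < (k : ℝ) + 1 := by positivity
  -- With `ρ = R / (k + 1)`, `k` derivatives do not exhaust the ball, and `(k + 1) ^ k / k! ≤ exp (k
  -- + 1)` keeps the bound geometric, at the price of shrinking the radius by `e`.
  have h1 := norm_iteratedFDeriv_le_of_forall_mem_ball (ρ := R / (k + 1)) (by positivity) hC hf hb k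
    x (Metric.mem_ball_self (by
      rw [sub_pos, mul_div_assoc', div_lt_iff₀ hk]; nlinarith))
  have h2 := Real.pow_div_factorial_le_exp ((k : ℝ) + 1) hk.le k
  have hfac : (0 : ℝ) < k.factorial := by positivity
  rw [taylorFSeries, norm_smul, norm_inv, Complex.norm_natCast]
  calc _ ≤ (k.factorial : ℝ)⁻¹ * (C / (R / (k + 1)) ^ k) := by gcongr
    _ = C * (((k : ℝ) + 1) ^ k / k.factorial) / R ^ k := by rw [div_pow]; field_simp
    _ ≤ C * Real.exp (k + 1) / R ^ k := by gcongr
    _ = _ := by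
      rw [div_pow, Real.exp_add, ← Real.exp_nat_mul, mul_one]; ring

/-- The bound on the coefficients gives convergence on the ball of radius `R / (2 e)`. Near `x` the
sum is `f` by local analyticity, and the identity theorem spreads this over the ball. The point is a
radius that depends on `R` only, hence is common to all terms of a series of functions. -/
theorem hasSum_taylorFSeries {f : E → ℂ} {x y : E} {R C : ℝ} (hR : 0 < R) (hC : 0 ≤ C)
    (hf : AnalyticOnNhd ℂ f (Metric.ball x R)) (hb : ∀ y ∈ Metric.ball x R, ‖f y‖ ≤ C)
    (hy : ‖y‖ < R / (2 * Real.exp 1)) :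
    HasSum (fun k => taylorFSeries f x k fun _ => y) (f (x + y)) := by
  have he : 0 < Real.exp 1 := Real.exp_pos 1
  have he1 : 1 ≤ Real.exp 1 := Real.one_le_exp (by norm_num)
  set r : NNReal := ⟨R / (2 * Real.exp 1), by positivity⟩ with hr
  have hr0 : 0 < r := by
    rw [← NNReal.coe_pos]; exact div_pos hR (by positivity)
  have hrR : (r : ℝ) ≤ R := by
    change R / (2 * Real.exp 1) ≤ R
    rw [div_le_iff₀ (by positivity)]; nlinarith
  have hrad : (r : ENNReal) ≤ (taylorFSeries f x).radius := by
    refine FormalMultilinearSeries.le_radius_of_bound _ (C * Real.exp 1) fun k => ?_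
    calc _ ≤ C * Real.exp 1 * (Real.exp 1 / R) ^ k * (r : ℝ) ^ k := by
          gcongr; exact norm_taylorFSeries_le hR hC hf hb k
      _ = C * Real.exp 1 * ((1 / 2) ^ k) := by
          rw [mul_assoc, ← mul_pow]
          congr 2
          change Real.exp 1 / R * (R / (2 * Real.exp 1)) = _
          field_simp
      _ ≤ _ := mul_le_of_le_one_right (by positivity) (pow_le_one₀ (by norm_num) (by norm_num))
  have hps := ((taylorFSeries f x).hasFPowerSeriesOnBall
    (lt_of_lt_of_le (by exact_mod_cast hr0) hrad)).mono (by exact_mod_cast hr0) hrad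
  have hps' := hps.comp_sub x
  rw [zero_add] at hps'
  have han := hps'.analyticOnNhd
  have hball : Metric.eball x (r : ENNReal) = Metric.ball x r := Metric.eball_coe
  rw [hball] at han
  have hev : (fun z => (taylorFSeries f x).sum (z - x)) =ᶠ[𝓝 x] f := by
    obtain ⟨p, ρ, hp⟩ := hf x (Metric.mem_ball_self hR)
    have hmem : ∀ᶠ z in 𝓝 x, z ∈ Metric.eball x (min ρ r) :=
      Metric.eball_mem_nhds _ (lt_min hp.r_pos (by exact_mod_cast hr0))
    filter_upwards [hmem] with z hz
    have hz1 : z - x ∈ Metric.eball (0 : E) ρ := by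
      have := Metric.eball_subset_eball (min_le_left _ _) hz
      simpa [edist_eq_enorm_sub] using this
    have hz2 : z - x ∈ Metric.eball (0 : E) r := by
      have := Metric.eball_subset_eball (min_le_right _ _) hz
      rwa [Metric.mem_eball, edist_eq_enorm_sub, ← sub_zero (z - x), ← edist_eq_enorm_sub] at this
    have h1 := hp.hasSum_iteratedFDeriv hz1
    have h2 := hps.hasSum hz2
    rw [add_sub_cancel] at h1
    rw [zero_add] at h2
    exact h2.unique h1
  have heq := han.eqOn_of_preconnected_of_eventuallyEq
    (hf.mono (Metric.ball_subset_ball hrR))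
    ((convex_ball x (r : ℝ)).isPreconnected) (Metric.mem_ball_self (by exact_mod_cast hr0)) hev
  have hyr : y ∈ Metric.eball (0 : E) r := by
    rw [Metric.eball_coe, mem_ball_zero_iff]; exact hy
  have h3 := hps.hasSum hyr
  have h4 := heq (x := x + y) (by rw [mem_ball_iff_norm, add_sub_cancel_left]; exact hy)
  rw [zero_add] at h3
  simp only [add_sub_cancel_left] at h4
  rwa [h4] at h3

/-- A normally convergent series of analytic functions on an open subset of a complex normed
space is analytic. -/
theorem analyticOnNhd_tsum {ι : Type*} {U : Set E} (hU : IsOpen U) {f : ι → E → ℂ} {u : ι → ℝ}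
    (hu : Summable u) (hf : ∀ i, AnalyticOnNhd ℂ (f i) U) (hb : ∀ i, ∀ x ∈ U, ‖f i x‖ ≤ u i) :
    AnalyticOnNhd ℂ (fun x => ∑' i, f i x) U := by
  intro x hx
  obtain ⟨R, hR, hRU⟩ := Metric.isOpen_iff.1 hU x hx
  have he : 0 < Real.exp 1 := Real.exp_pos 1
  have hu0 : ∀ i, 0 ≤ u i := fun i => (norm_nonneg _).trans (hb i x hx)
  have hbd : ∀ i k, ‖taylorFSeries (f i) x k‖ ≤ u i * Real.exp 1 * (Real.exp 1 / R) ^ k :=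
    fun i k => norm_taylorFSeries_le hR (hu0 i) ((hf i).mono hRU) (fun y hy => hb i y (hRU hy)) k
  have hsumk : ∀ k, Summable fun i => taylorFSeries (f i) x k := fun k =>
    Summable.of_norm_bounded ((hu.mul_right _).mul_right _) (fun i => hbd i k)
  set p : FormalMultilinearSeries ℂ E ℂ := fun k => ∑' i, taylorFSeries (f i) x k with hp
  have hpb : ∀ k, ‖p k‖ ≤ (∑' i, u i) * Real.exp 1 * (Real.exp 1 / R) ^ k := by
    intro k
    refine (tsum_of_norm_bounded ?_ (fun i => hbd i k))
    exact (hu.hasSum.mul_right _).mul_right _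
  set r : NNReal := ⟨R / (2 * Real.exp 1), by positivity⟩ with hr
  have hr0 : 0 < r := by
    rw [← NNReal.coe_pos]; exact div_pos hR (by positivity)
  have hrr : ∀ k : ℕ, (Real.exp 1 / R) ^ k * (r : ℝ) ^ k = (1 / 2) ^ k := by
    intro k
    rw [← mul_pow]
    congr 1
    change Real.exp 1 / R * (R / (2 * Real.exp 1)) = _
    field_simp
  refine ⟨p, r, ?_, by exact_mod_cast hr0, ?_⟩
  · refine FormalMultilinearSeries.le_radius_of_bound _ ((∑' i, u i) * Real.exp 1) fun k => ?_
    calc _ ≤ (∑' i, u i) * Real.exp 1 * (Real.exp 1 / R) ^ k * (r : ℝ) ^ k := by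
          gcongr; exact hpb k
      _ = (∑' i, u i) * Real.exp 1 * ((1 / 2) ^ k) := by rw [mul_assoc, hrr]
      _ ≤ _ := mul_le_of_le_one_right (mul_nonneg (tsum_nonneg hu0) he.le)
          (pow_le_one₀ (by norm_num) (by norm_num))
  · intro y hy
    have hy' : ‖y‖ < R / (2 * Real.exp 1) := by
      rw [Metric.eball_coe, mem_ball_zero_iff] at hy; exact hy
    have h1 : ∀ i, HasSum (fun k => taylorFSeries (f i) x k fun _ => y) (f i (x + y)) := fun i =>
      hasSum_taylorFSeries hR (hu0 i) ((hf i).mono hRU) (fun y hy => hb i y (hRU hy)) hy'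
    have hbound : ∀ i k, ‖taylorFSeries (f i) x k fun _ => y‖
        ≤ u i * Real.exp 1 * (1 / 2) ^ k := by
      intro i k
      calc _ ≤ ‖taylorFSeries (f i) x k‖ * ∏ _j : Fin k, ‖y‖ :=
            ContinuousMultilinearMap.le_opNorm _ _
        _ ≤ (u i * Real.exp 1 * (Real.exp 1 / R) ^ k) * (r : ℝ) ^ k := by
            rw [Finset.prod_const, Finset.card_univ, Fintype.card_fin]
            refine mul_le_mul (hbd i k) (pow_le_pow_left₀ (norm_nonneg _) hy'.le _)
              (by positivity) (by have := hu0 i; positivity)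
        _ = _ := by rw [mul_assoc, hrr]
    -- The double family is dominated by `u i * e * 2⁻ᵏ`, so summation over `i` and over the Taylor
    -- degree may be interchanged.
    have hS : Summable fun q : ℕ × ι => taylorFSeries (f q.2) x q.1 fun _ => y := by
      have hgeo : Summable fun k : ℕ => ((1 : ℝ) / 2) ^ k :=
        summable_geometric_of_lt_one (by norm_num) (by norm_num)
      have := hgeo.mul_of_nonneg (hu.mul_right (Real.exp 1)) (fun k => by positivity)
        (fun i => by have := hu0 i; positivity)
      refine Summable.of_norm_bounded this fun q => ?_
      rw [mul_comm]
      exact hbound q.2 q.1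
    have h2 : ∀ k, HasSum (fun i => taylorFSeries (f i) x k fun _ => y) (p k fun _ => y) := by
      intro k
      exact (hsumk k).hasSum.mapL (ContinuousMultilinearMap.apply ℂ (fun _ : Fin k => E) ℂ fun _ => y)
    have h3 := hS.hasSum.prod_fiberwise h2
    have hS' := hS.hasSum
    rw [← (Equiv.prodComm ι ℕ).hasSum_iff] at hS'
    have h4 := hS'.prod_fiberwise h1
    rwa [← h4.tsum_eq] at h3

end AnalyticSeries

end NestedZeta

namespace NestedZeta

/-! ### Uniqueness of the finite part. -/

section FinitePart

/-- The sequence `N ^ α (log N) ^ l`. -/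
noncomputable def logPow (α : ℂ) (l : ℕ) : ℕ → ℂ :=
  fun N => (N : ℂ) ^ α * (Real.log N : ℂ) ^ l

/-- The operator `g(N) ↦ g(m N) - m ^ α g(N)`. -/
noncomputable def dilation (α : ℂ) (m : ℕ) : Module.End ℂ (ℕ → ℂ) where
  toFun g := fun N => g (m * N) - (m : ℂ) ^ α * g N
  map_add' g h := by funext N; simp only [Pi.add_apply]; ring
  map_smul' a g := by
    funext N; simp only [Pi.smul_apply, smul_eq_mul, RingHom.id_apply]; ring

theorem dilation_apply (α : ℂ) (m : ℕ) (g : ℕ → ℂ) (N : ℕ) :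
    dilation α m g N = g (m * N) - (m : ℂ) ^ α * g N := rfl

/-- Commutation is what allows annihilators of different exponents to be multiplied together without
interfering. -/
theorem dilation_commute (α β : ℂ) (m n : ℕ) : Commute (dilation α m) (dilation β n) := by
  refine LinearMap.ext fun g => funext fun N => ?_
  simp only [Module.End.mul_apply, dilation_apply, mul_left_comm m n N]
  ring

/-- Since `log (mN) = log N + log m`, the binomial expansion of the logarithmic power loses its top
term. The hypothesis `α ≠ 0` makes the identity hold at `N = 0` too, where `0 ^ α = 0`. -/
theorem dilation_logPow {α : ℂ} (hα : α ≠ 0) {m : ℕ} (hm : 1 ≤ m) (l : ℕ) :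
    dilation α m (logPow α l) = ∑ j ∈ Finset.range l,
      ((m : ℂ) ^ α * (Real.log m : ℂ) ^ (l - j) * (l.choose j : ℂ)) • logPow α j := by
  funext N
  rw [Finset.sum_apply]
  simp only [dilation_apply, logPow, Pi.smul_apply, smul_eq_mul]
  rcases Nat.eq_zero_or_pos N with rfl | hN
  · simp [Complex.zero_cpow hα]
  have hlog : Real.log ((m * N : ℕ) : ℝ) = Real.log N + Real.log m := by
    push_cast
    rw [Real.log_mul (by positivity) (by positivity), add_comm]
  rw [hlog]
  push_cast
  rw [Complex.natCast_mul_natCast_cpow, add_pow, Finset.sum_range_succ]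
  simp only [Nat.choose_self, Nat.sub_self, pow_zero, mul_one, Nat.cast_one]
  rw [mul_add, add_sub_assoc, mul_assoc ((m : ℂ) ^ α), mul_assoc ((m : ℂ) ^ α), sub_self, add_zero, Finset.mul_sum, Finset.mul_sum]
  refine Finset.sum_congr rfl fun j _ => ?_
  ring

theorem dilation_pow_logPow {α : ℂ} (hα : α ≠ 0) {m : ℕ} (hm : 1 ≤ m) (l : ℕ) :
    (dilation α m ^ (l + 1)) (logPow α l) = 0 := by
  induction l using Nat.strong_induction_on with
  | _ l ih =>
    rw [pow_succ, Module.End.mul_apply, dilation_logPow hα hm, map_sum]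
    refine Finset.sum_eq_zero fun j hj => ?_
    have hj' := Finset.mem_range.1 hj
    rw [map_smul, show l = (l - (j + 1)) + (j + 1) by omega, pow_add, Module.End.mul_apply,
      ih j hj', map_zero, smul_zero]

/-- Otherwise every `log n * α` lies in `2πiℤ`. For `m > ‖α‖` the difference `(log (m + 1) - log m)
* α` is nonzero of modulus below 1, too small for that lattice. Purely imaginary `α` are thus
covered. -/
theorem exists_natCast_cpow_ne_one {α : ℂ} (hα : α ≠ 0) :
    ∃ m : ℕ, 1 ≤ m ∧ (m : ℂ) ^ α ≠ 1 := by
  by_contra! h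
  obtain ⟨m, hm⟩ := exists_nat_gt ‖α‖
  have hm0 : (0 : ℝ) < m := (norm_nonneg _).trans_lt hm
  have hm1 : 1 ≤ m := by exact_mod_cast Nat.one_le_iff_ne_zero.2 (by rintro rfl; simp at hm0)
  have key : ∀ n : ℕ, 1 ≤ n → ∃ k : ℤ, (Real.log n : ℂ) * α = k * (2 * Real.pi * Complex.I) := by
    intro n hn
    have h1 := h n hn
    rw [Complex.cpow_def_of_ne_zero (by exact_mod_cast (by omega : n ≠ 0)),
      ← Complex.natCast_log] at h1
    exact Complex.exp_eq_one_iff.1 h1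
  obtain ⟨a, ha⟩ := key m hm1
  obtain ⟨b, hb⟩ := key (m + 1) (by omega)
  have hab : ((Real.log ((m + 1 : ℕ) : ℝ) - Real.log m : ℝ) : ℂ) * α
      = ((b - a : ℤ) : ℂ) * (2 * Real.pi * Complex.I) := by
    push_cast at ha hb ⊢
    rw [sub_mul, sub_mul, ha, hb]
  have hlog0 : 0 < Real.log ((m + 1 : ℕ) : ℝ) - Real.log m := by
    rw [sub_pos]; exact Real.log_lt_log hm0 (by push_cast; linarith)
  have hlog1 : Real.log ((m + 1 : ℕ) : ℝ) - Real.log m ≤ 1 / m := by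
    rw [← Real.log_div (by positivity) hm0.ne']
    refine (Real.log_le_sub_one_of_pos (by positivity)).trans (le_of_eq ?_)
    push_cast; field_simp; ring
  have hn := congrArg norm hab
  rw [norm_mul, norm_mul, Complex.norm_real, Real.norm_of_nonneg hlog0.le] at hn
  have hpi : ‖(2 * Real.pi * Complex.I : ℂ)‖ = 2 * Real.pi := by
    simp [abs_of_pos Real.pi_pos]
  rw [hpi, Complex.norm_intCast] at hn
  have hlt : (Real.log ((m + 1 : ℕ) : ℝ) - Real.log m) * ‖α‖ < 1 := by
    calc _ ≤ 1 / m * ‖α‖ := by gcongr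
      _ < 1 := by rw [one_div, inv_mul_lt_iff₀ hm0, mul_one]; exact hm
  rcases eq_or_ne (b - a) 0 with h0 | h0
  · rw [h0] at hn
    have : (Real.log ((m + 1 : ℕ) : ℝ) - Real.log m) * ‖α‖ = 0 := by rw [hn]; simp
    rcases mul_eq_zero.1 this with h | h
    · exact hlog0.ne' h
    · exact hα (norm_eq_zero.1 h)
  · have h1 : (1 : ℝ) ≤ |((b - a : ℤ) : ℝ)| := by exact_mod_cast Int.one_le_abs h0
    have := Real.pi_gt_three
    nlinarith

/-- Evaluation of a polynomial at `log N`. -/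
noncomputable def polyLog (Q : Polynomial ℂ) : ℕ → ℂ := fun N => Q.eval (Real.log N : ℂ)

/-- Operators on sequences that commute with all dilations, rescale limits by a nonzero factor and
preserve the degree of polynomials in `log N`. -/
structure IsLogStable (A : Module.End ℂ (ℕ → ℂ)) : Prop where
  comm : ∀ α m, Commute A (dilation α m)
  tendsto : ∃ μ : ℂ, μ ≠ 0 ∧ ∀ (g : ℕ → ℂ) (c : ℂ), Tendsto g atTop (𝓝 c) →
    Tendsto (A g) atTop (𝓝 (μ * c))
  polyLog : ∀ Q : Polynomial ℂ, ∃ Q' : Polynomial ℂ, Q'.natDegree = Q.natDegree ∧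
    A (polyLog Q) =ᶠ[atTop] polyLog Q'

theorem isLogStable_one : IsLogStable 1 where
  comm _ _ := Commute.one_left _
  tendsto := ⟨1, one_ne_zero, fun g c h => by simpa using h⟩
  polyLog Q := ⟨Q, rfl, by simp⟩

/-- On limits, and on the leading coefficient of a polynomial in `log N` (which is Taylor shifted by
`log m`), the dilation acts as multiplication by `1 - m ^ α`, nonzero by assumption. -/
theorem IsLogStable.dilation_mul {A : Module.End ℂ (ℕ → ℂ)} (hA : IsLogStable A) {α : ℂ} {m : ℕ}
    (hm : 1 ≤ m) (hα : (m : ℂ) ^ α ≠ 1) : IsLogStable (dilation α m * A) where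
  comm β n := (dilation_commute α β m n).mul_left (hA.comm β n)
  tendsto := by
    obtain ⟨μ, hμ, h⟩ := hA.tendsto
    refine ⟨(1 - (m : ℂ) ^ α) * μ, mul_ne_zero (sub_ne_zero.2 hα.symm) hμ, fun g c hg => ?_⟩
    have h1 := h g c hg
    have hmt : Tendsto (fun N : ℕ => m * N) atTop atTop :=
      tendsto_id.const_mul_atTop' (by omega)
    have := (h1.comp hmt).sub (h1.const_mul ((m : ℂ) ^ α))
    refine (this.congr fun N => ?_).trans (le_of_eq (by ring_nf))
    rfl
  polyLog Q := by
    obtain ⟨Q', hdeg, hQ'⟩ := hA.polyLog Q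
    refine ⟨Polynomial.taylor (Real.log m : ℂ) Q' - Polynomial.C ((m : ℂ) ^ α) * Q', ?_, ?_⟩
    · rw [← hdeg]
      rcases eq_or_ne Q' 0 with rfl | h0
      · simp
      refine Polynomial.natDegree_eq_of_le_of_coeff_ne_zero ?_ ?_
      · refine (Polynomial.natDegree_sub_le _ _).trans (max_le ?_ ?_)
        · rw [Polynomial.natDegree_taylor]
        · exact Polynomial.natDegree_C_mul_le _ _
      · rw [Polynomial.coeff_sub, Polynomial.coeff_taylor_natDegree, Polynomial.coeff_C_mul,
          Polynomial.coeff_natDegree, ← one_sub_mul]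
        exact mul_ne_zero (sub_ne_zero.2 hα.symm) (Polynomial.leadingCoeff_ne_zero.2 h0)
    · have hmt : Tendsto (fun N : ℕ => m * N) atTop atTop :=
        tendsto_id.const_mul_atTop' (by omega)
      filter_upwards [hQ', hmt.eventually hQ', eventually_ge_atTop 1] with N h1 h2 hN
      have hlog : Real.log ((m * N : ℕ) : ℝ) = Real.log N + Real.log m := by
        push_cast
        rw [Real.log_mul (by positivity) (by positivity), add_comm]
      rw [Module.End.mul_apply, dilation_apply, h1, h2]
      simp only [NestedZeta.polyLog, Polynomial.eval_sub, Polynomial.eval_mul, Polynomial.eval_C,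
        Polynomial.taylor_eval, hlog]
      push_cast
      rfl

theorem IsLogStable.dilation_pow_mul {A : Module.End ℂ (ℕ → ℂ)} (hA : IsLogStable A) {α : ℂ}
    {m : ℕ} (hm : 1 ≤ m) (hα : (m : ℂ) ^ α ≠ 1) (n : ℕ) :
    IsLogStable (dilation α m ^ n * A) := by
  induction n with
  | zero => simpa using hA
  | succ n ih => rw [pow_succ', mul_assoc]; exact ih.dilation_mul hm hα

theorem exists_isLogStable_annihilator (T : Finset (ℂ × ℕ)) :
    ∃ A, IsLogStable A ∧ ∀ p ∈ T, p.1 ≠ 0 → A (logPow p.1 p.2) = 0 := by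
  classical
  induction T using Finset.induction_on with
  | empty => exact ⟨1, isLogStable_one, by simp⟩
  | insert p T _ ih =>
    obtain ⟨A, hA, h⟩ := ih
    rcases eq_or_ne p.1 0 with hp | hp
    · refine ⟨A, hA, fun q hq hq0 => ?_⟩
      rcases Finset.mem_insert.1 hq with rfl | hq
      · exact absurd hp hq0
      · exact h q hq hq0
    · obtain ⟨m, hm, hmα⟩ := exists_natCast_cpow_ne_one hp
      refine ⟨dilation p.1 m ^ (p.2 + 1) * A, hA.dilation_pow_mul hm hmα _, fun q hq hq0 => ?_⟩
      rcases Finset.mem_insert.1 hq with rfl | hq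
      · rw [← ((hA.comm q.1 m).pow_right _).eq, Module.End.mul_apply,
          dilation_pow_logPow hp hm, map_zero]
      · rw [Module.End.mul_apply, h q hq hq0, map_zero]

/-- The annihilator `A` leaves only the image of a polynomial `Q` in `log N` with zero constant
term. A polynomial in `log N` with a finite limit is constant, and `A` preserves degrees, so `Q` is
constant, hence zero; then `μ * c = 0` with `μ ≠ 0`. -/
theorem eq_zero_of_tendsto_sum_logPow {T : Finset (ℂ × ℕ)} {b : ℂ × ℕ → ℂ} (hT : (0, 0) ∉ T)
    {c : ℂ} (h : Tendsto (∑ p ∈ T, b p • logPow p.1 p.2) atTop (𝓝 c)) : c = 0 := by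
  classical
  obtain ⟨A, hA, hkill⟩ := exists_isLogStable_annihilator T
  set Q : Polynomial ℂ := ∑ p ∈ T with p.1 = 0, Polynomial.C (b p) * Polynomial.X ^ p.2 with hQ
  have hQ0 : Q.coeff 0 = 0 := by
    rw [hQ, Polynomial.finsetSum_coeff]
    refine Finset.sum_eq_zero fun p hp => ?_
    have hp' := Finset.mem_filter.1 hp
    have : p.2 ≠ 0 := fun h2 => hT (by
      have : p = (0, 0) := Prod.ext hp'.2 h2
      exact this ▸ hp'.1)
    rw [Polynomial.coeff_C_mul, Polynomial.coeff_X_pow, if_neg this.symm, mul_zero]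
  have hsum : A (∑ p ∈ T, b p • logPow p.1 p.2) = A (polyLog Q) := by
    rw [← Finset.sum_filter_add_sum_filter_not T (fun p => p.1 = 0), map_add]
    have h2 : A (∑ p ∈ T with ¬ p.1 = 0, b p • logPow p.1 p.2) = 0 := by
      rw [map_sum]
      refine Finset.sum_eq_zero fun p hp => ?_
      have hp' := Finset.mem_filter.1 hp
      rw [map_smul, hkill p hp'.1 hp'.2, smul_zero]
    rw [h2, add_zero]
    congr 1
    funext N
    rw [Finset.sum_apply, polyLog, hQ, Polynomial.eval_finsetSum]
    refine Finset.sum_congr rfl fun p hp => ?_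
    simp [logPow, (Finset.mem_filter.1 hp).2]
  obtain ⟨μ, hμ, hlim⟩ := hA.tendsto
  have h1 := hlim _ _ h
  rw [hsum] at h1
  obtain ⟨Q', hdeg, hQ'⟩ := hA.polyLog Q
  have hlogt : Tendsto (fun N : ℕ => ‖(Real.log N : ℂ)‖) atTop atTop := by
    simp only [Complex.norm_real]
    exact tendsto_norm_atTop_atTop.comp (Real.tendsto_log_atTop.comp tendsto_natCast_atTop_atTop)
  have hdeg0 : Q'.natDegree = 0 := by
    by_contra hne
    have h2 := Polynomial.tendsto_norm_atTop Q'
      (Polynomial.natDegree_pos_iff_degree_pos.1 (Nat.pos_of_ne_zero hne)) hlogt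
    exact not_tendsto_atTop_of_tendsto_nhds ((h1.congr' hQ').norm) h2
  have hQz : Q = 0 := by
    rw [Polynomial.eq_C_of_natDegree_eq_zero (p := Q) (hdeg ▸ hdeg0), hQ0, Polynomial.C_0]
  have h3 : polyLog Q = 0 := by funext N; simp [polyLog, hQz]
  rw [h3, map_zero] at h1
  have := tendsto_nhds_unique h1 (tendsto_const_nhds (x := (0 : ℂ)))
  exact (mul_eq_zero.1 this).resolve_left hμ

theorem HasFinitePart.unique {u : ℕ → ℂ} {a a' : ℂ} (h : HasFinitePart u a)
    (h' : HasFinitePart u a') : a = a' := by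
  classical
  obtain ⟨T, b, hT, h⟩ := h
  obtain ⟨T', b', hT', h'⟩ := h'
  have key : Tendsto (∑ p ∈ T ∪ T', ((if p ∈ T' then b' p else 0) - (if p ∈ T then b p else 0)) •
      logPow p.1 p.2) atTop (𝓝 (a - a')) := by
    refine (h.sub h').congr fun N => ?_
    simp only [Finset.sum_apply, Pi.smul_apply, smul_eq_mul, sub_mul, Finset.sum_sub_distrib,
      ite_mul, zero_mul]
    rw [← Finset.sum_filter, ← Finset.sum_filter]
    have e1 : (T ∪ T').filter (· ∈ T) = T := by ext; simp
    have e2 : (T ∪ T').filter (· ∈ T') = T' := by ext; simp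
    rw [e1, e2]
    simp only [logPow, ← mul_assoc]
    ring
  have := eq_zero_of_tendsto_sum_logPow (by simp [hT, hT']) key
  exact sub_eq_zero.1 this

theorem HasFinitePart.finitePart_eq {u : ℕ → ℂ} {a : ℂ} (h : HasFinitePart u a) :
    finitePart u = a := by
  have hex : ∃ a, HasFinitePart u a := ⟨a, h⟩
  rw [finitePart, dif_pos hex]
  exact hex.choose_spec.unique h

end FinitePart

end NestedZeta

namespace NestedZeta

/-! ### Binomial expansion of shifted powers with uniform remainder. -/

section Binomial

/-- The coefficients of the binomial series `(1 + x) ^ w = ∑ p_i(w) x ^ i`. -/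
noncomputable def binomCoeff : ℕ → ℂ → ℂ
  | 0, _ => 1
  | i + 1, w => w * binomCoeff i (w - 1) / (i + 1)

theorem binomCoeff_one (w : ℂ) : binomCoeff 1 w = w := by simp [binomCoeff]

theorem differentiable_binomCoeff (i : ℕ) : Differentiable ℂ (binomCoeff i) := by
  induction i with
  | zero => exact differentiable_const _
  | succ i ih =>
    have : binomCoeff (i + 1) = fun w => w * binomCoeff i (w - 1) / (i + 1) := rfl
    rw [this]
    have h : Differentiable ℂ fun w => binomCoeff i (w - 1) :=
      ih.comp (differentiable_id.sub_const 1)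
    exact (differentiable_id.mul h).div_const _

/-- The remainder of order `M + 1` at `w` vanishes at `x = 0` and has derivative `w` times the
remainder of order `M` at `w - 1`, so the mean value inequality gains one power of `x`. The shift `w
- 1` is why `R` varies in the induction. -/
theorem norm_one_add_cpow_sub_sum_le (M : ℕ) : ∀ R V : ℝ, 0 ≤ R → 0 ≤ V → ∃ C, 0 ≤ C ∧
    ∀ w : ℂ, ‖w‖ ≤ R → ∀ x : ℝ, 0 ≤ x → x ≤ V →
      ‖((1 + x : ℝ) : ℂ) ^ w - ∑ i ∈ Finset.range M, binomCoeff i w * (x : ℂ) ^ i‖ ≤ C * x ^ M := by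
  induction M with
  | zero =>
    intro R V hR hV
    refine ⟨(1 + V) ^ R, by positivity, fun w hw x hx hxV => ?_⟩
    rw [Finset.sum_range_zero, sub_zero, pow_zero, mul_one,
      Complex.norm_cpow_eq_rpow_re_of_pos (by linarith)]
    calc (1 + x) ^ w.re ≤ (1 + x) ^ R :=
          Real.rpow_le_rpow_of_exponent_le (by linarith) ((Complex.re_le_norm w).trans hw)
      _ ≤ _ := Real.rpow_le_rpow (by linarith) (by linarith) hR
  | succ M ih =>
    intro R V hR hV
    obtain ⟨C, hC, h⟩ := ih (R + 1) V (by linarith) hV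
    refine ⟨R * C, by positivity, fun w hw x hx hxV => ?_⟩
    set g : ℝ → ℂ := fun y => ((1 + y : ℝ) : ℂ) ^ w
      - ∑ i ∈ Finset.range (M + 1), binomCoeff i w * (y : ℂ) ^ i with hg
    have hw1 : ‖w - 1‖ ≤ R + 1 := (norm_sub_le _ _).trans (by simpa using hw)
    have hder : ∀ y ∈ Set.Icc (0 : ℝ) x, HasDerivWithinAt g
        (w * (((1 + y : ℝ) : ℂ) ^ (w - 1)
          - ∑ i ∈ Finset.range M, binomCoeff i (w - 1) * (y : ℂ) ^ i)) (Set.Icc 0 x) y := by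
      intro y hy
      refine HasDerivAt.hasDerivWithinAt ?_
      have h0 : HasDerivAt (fun z : ℂ => 1 + z) 1 (y : ℂ) := (hasDerivAt_id _).const_add 1
      have h1 : HasDerivAt (fun y : ℝ => ((1 + y : ℝ) : ℂ) ^ w)
          (w * ((1 + y : ℝ) : ℂ) ^ (w - 1)) y := by
        have := (h0.cpow_const (c := w) (Or.inl (by
          rw [Complex.add_re, Complex.one_re, Complex.ofReal_re]; linarith [hy.1]))).comp_ofReal
        simpa using this
      have h2 : HasDerivAt (fun y : ℝ => ∑ i ∈ Finset.range (M + 1), binomCoeff i w * (y : ℂ) ^ i)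
          (∑ i ∈ Finset.range M, w * (binomCoeff i (w - 1) * (y : ℂ) ^ i)) y := by
        have h3 : ∀ i ∈ Finset.range (M + 1), HasDerivAt (fun y : ℝ => binomCoeff i w * (y : ℂ) ^ i)
            (binomCoeff i w * (i * (y : ℂ) ^ (i - 1))) y := by
          intro i _
          have h4 : HasDerivAt (fun z : ℂ => z ^ i) (i * (y : ℂ) ^ (i - 1)) (y : ℂ) :=
            hasDerivAt_pow i _
          exact h4.comp_ofReal.const_mul _
        have h5 := HasDerivAt.fun_sum h3
        refine h5.congr_deriv ?_
        rw [Finset.sum_range_succ', Nat.cast_zero, zero_mul, mul_zero, add_zero]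
        refine Finset.sum_congr rfl fun i _ => ?_
        have : (i : ℂ) + 1 ≠ 0 := by exact_mod_cast Nat.succ_ne_zero i
        simp only [binomCoeff, Nat.add_sub_cancel]
        push_cast
        field_simp
      rw [mul_sub, Finset.mul_sum]
      exact h1.sub h2
    have hbound : ∀ y ∈ Set.Ico (0 : ℝ) x, ‖w * (((1 + y : ℝ) : ℂ) ^ (w - 1)
          - ∑ i ∈ Finset.range M, binomCoeff i (w - 1) * (y : ℂ) ^ i)‖ ≤ R * (C * x ^ M) := by
      intro y hy
      rw [norm_mul]
      gcongr
      refine (h (w - 1) hw1 y hy.1 (hy.2.le.trans hxV)).trans ?_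
      have := hy.1
      have := hy.2.le
      gcongr
    have := norm_image_sub_le_of_norm_deriv_le_segment' hder hbound x ⟨hx, le_rfl⟩
    have hg0 : g 0 = 0 := by
      simp [hg, Finset.sum_range_succ', binomCoeff]
    rw [hg0, sub_zero, sub_zero] at this
    calc _ ≤ R * (C * x ^ M) * x := this
      _ = _ := by ring

theorem norm_natCast_add_cpow_sub_sum_le (M : ℕ) {R V : ℝ} (hR : 0 ≤ R) (hV : 0 ≤ V) :
    ∃ C, 0 ≤ C ∧ ∀ w : ℂ, ‖w‖ ≤ R → ∀ n : ℕ, 1 ≤ n →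
      ‖(((n : ℝ) + V : ℝ) : ℂ) ^ w
        - ∑ i ∈ Finset.range M, (binomCoeff i w * (V : ℂ) ^ i) * (n : ℂ) ^ (w - i)‖
        ≤ C * (n : ℝ) ^ (w.re - M) := by
  obtain ⟨C, hC, h⟩ := norm_one_add_cpow_sub_sum_le M R V hR hV
  refine ⟨C * V ^ M, by positivity, fun w hw n hn => ?_⟩
  have hn0 : (0 : ℝ) < n := by exact_mod_cast hn
  have hn0' : (n : ℂ) ≠ 0 := by exact_mod_cast hn0.ne'
  have hx := h w hw (V / n) (by positivity) (div_le_self hV (by exact_mod_cast hn))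
  have e1 : (((n : ℝ) + V : ℝ) : ℂ) ^ w = (n : ℂ) ^ w * ((1 + V / n : ℝ) : ℂ) ^ w := by
    rw [show ((n : ℝ) + V) = n * (1 + V / n) by field_simp, Complex.ofReal_mul,
      Complex.mul_cpow_ofReal_nonneg hn0.le (by positivity)]
    simp
  have e2 : ∑ i ∈ Finset.range M, (binomCoeff i w * (V : ℂ) ^ i) * (n : ℂ) ^ (w - i)
      = (n : ℂ) ^ w * ∑ i ∈ Finset.range M, binomCoeff i w * ((V / n : ℝ) : ℂ) ^ i := by
    rw [Finset.mul_sum]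
    refine Finset.sum_congr rfl fun i _ => ?_
    rw [Complex.cpow_sub _ _ hn0', Complex.cpow_natCast]
    push_cast
    rw [div_pow]
    ring
  rw [e1, e2, ← mul_sub, norm_mul, Complex.norm_natCast_cpow_of_pos hn]
  calc _ ≤ (n : ℝ) ^ w.re * (C * (V / n) ^ M) := by gcongr
    _ = _ := by rw [Real.rpow_sub hn0, Real.rpow_natCast, div_pow]; ring

end Binomial

/-! ### Tails of convergent series. -/

section Tail

theorem sum_range_inv_sq_le {n : ℕ} (hn : 1 ≤ n) (K : ℕ) :
    ∑ i ∈ Finset.range K, (1 : ℝ) / ((n + i : ℕ) : ℝ) ^ 2 ≤ 2 / n := by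
  have hn0 : (0 : ℝ) < n := by exact_mod_cast hn
  suffices h : ∑ i ∈ Finset.range K, (1 : ℝ) / ((n + i : ℕ) : ℝ) ^ 2 ≤ 2 / n - 2 / ((n + K : ℕ) : ℝ) from
    h.trans (sub_le_self _ (by positivity))
  induction K with
  | zero => simp
  | succ K ih =>
    rw [Finset.sum_range_succ]
    have h1 : (1 : ℝ) ≤ ((n + K : ℕ) : ℝ) := by exact_mod_cast (by omega : 1 ≤ n + K)
    have h2 : (1 : ℝ) / ((n + K : ℕ) : ℝ) ^ 2 ≤ 2 / ((n + K : ℕ) : ℝ) - 2 / ((n + (K + 1) : ℕ) : ℝ) := by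
      have e : ((n + (K + 1) : ℕ) : ℝ) = ((n + K : ℕ) : ℝ) + 1 := by push_cast; ring
      rw [e]
      generalize ((n + K : ℕ) : ℝ) = x at h1
      rw [div_sub_div _ _ (by positivity) (by positivity), div_le_div_iff₀ (by positivity) (by positivity)]
      nlinarith
    linarith

/-- For `m ≥ n` and `a ≥ 2` one has `m ^ (-a) ≤ n ^ (2 - a) * m ^ (-2)`, which reduces the tail to
that of `∑ 1 / m²`. All constants are explicit so that they stay uniform in parameters. -/
theorem summable_and_norm_tsum_le_of_norm_le_rpow {r : ℕ → ℂ} {n : ℕ} (hn : 1 ≤ n) {a C : ℝ}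
    (hC : 0 ≤ C) (ha : 2 ≤ a) (h : ∀ m, n ≤ m → ‖r m‖ ≤ C * (m : ℝ) ^ (-a)) :
    Summable (fun i => r (n + i)) ∧ ‖∑' i, r (n + i)‖ ≤ 2 * C * (n : ℝ) ^ (1 - a) := by
  have hn0 : (0 : ℝ) < n := by exact_mod_cast hn
  have hb : ∀ i, ‖r (n + i)‖ ≤ C * (n : ℝ) ^ (2 - a) * (1 / ((n + i : ℕ) : ℝ) ^ 2) := by
    intro i
    have hni : (0 : ℝ) < ((n + i : ℕ) : ℝ) := by positivity
    refine (h (n + i) (by omega)).trans ?_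
    rw [mul_assoc]
    refine mul_le_mul_of_nonneg_left ?_ hC
    calc ((n + i : ℕ) : ℝ) ^ (-a) = ((n + i : ℕ) : ℝ) ^ (2 - a) * ((n + i : ℕ) : ℝ) ^ (-2 : ℝ) := by
          rw [← Real.rpow_add hni]; ring_nf
      _ ≤ (n : ℝ) ^ (2 - a) * ((n + i : ℕ) : ℝ) ^ (-2 : ℝ) := by
          refine mul_le_mul_of_nonneg_right ?_ (by positivity)
          exact Real.rpow_le_rpow_of_nonpos hn0 (by push_cast; linarith [(Nat.cast_nonneg i : (0:ℝ) ≤ i)])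
            (by linarith)
      _ = _ := by rw [Real.rpow_neg hni.le, one_div, Real.rpow_ofNat]
  have hbs : ∀ K, ∑ i ∈ Finset.range K, ‖r (n + i)‖ ≤ 2 * C * (n : ℝ) ^ (1 - a) := by
    intro K
    calc _ ≤ ∑ i ∈ Finset.range K, C * (n : ℝ) ^ (2 - a) * (1 / ((n + i : ℕ) : ℝ) ^ 2) :=
          Finset.sum_le_sum fun i _ => hb i
      _ ≤ C * (n : ℝ) ^ (2 - a) * (2 / n) := by
          rw [← Finset.mul_sum]
          exact mul_le_mul_of_nonneg_left (sum_range_inv_sq_le hn K) (by positivity)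
      _ = _ := by
          rw [show (2 - a) = (1 - a) + 1 by ring, Real.rpow_add hn0, Real.rpow_one]
          field_simp
  have hs : Summable fun i => ‖r (n + i)‖ :=
    summable_of_sum_range_le (fun _ => norm_nonneg _) hbs
  exact ⟨hs.of_norm, (norm_tsum_le_tsum_norm hs).trans (hs.tsum_le_of_sum_range_le hbs)⟩

theorem tsum_sub_tsum_succ {r : ℕ → ℂ} {n : ℕ} (h : Summable fun i => r (n + i)) :
    ∑' i, r (n + i) - ∑' i, r (n + 1 + i) = r n := by
  rw [h.tsum_eq_zero_add]
  simp only [Nat.add_zero, add_assoc, add_comm 1]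
  ring_nf

end Tail

end NestedZeta

namespace NestedZeta

/-! ### Sequences with asymptotic expansions in powers and logarithms. -/

section Asymp

open Asymptotics

/-- Finite linear combinations of the sequences `N ^ α (log N) ^ l` with `α ∈ X`. -/
def logPowSpan (X : Set ℂ) : Submodule ℂ (ℕ → ℂ) :=
  Submodule.span ℂ {f | ∃ α ∈ X, ∃ l, f = logPow α l}

theorem logPow_mem_logPowSpan {X : Set ℂ} {α : ℂ} (h : α ∈ X) (l : ℕ) :
    logPow α l ∈ logPowSpan X := Submodule.subset_span ⟨α, h, l, rfl⟩

theorem logPowSpan_mono {X Y : Set ℂ} (h : X ⊆ Y) : logPowSpan X ≤ logPowSpan Y :=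
  Submodule.span_mono fun _ ⟨α, hα, l, e⟩ => ⟨α, h hα, l, e⟩

/-- Sequences with an asymptotic expansion, to all orders, in the sequences `N ^ α (log N) ^ l`
with `α ∈ X`. -/
def Asymp (X : Set ℂ) : Submodule ℂ (ℕ → ℂ) where
  carrier := {f | ∀ M : ℕ, ∃ g ∈ logPowSpan X, (f - g) =O[atTop] fun N : ℕ => (N : ℝ) ^ (-(M : ℝ))}
  zero_mem' M := ⟨0, Submodule.zero_mem _, by simpa using! isBigO_zero _ _⟩
  add_mem' {f f'} hf hf' M := by
    obtain ⟨g, hg, h⟩ := hf M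
    obtain ⟨g', hg', h'⟩ := hf' M
    exact ⟨g + g', Submodule.add_mem _ hg hg', by rw [add_sub_add_comm]; exact h.add h'⟩
  smul_mem' c f hf M := by
    obtain ⟨g, hg, h⟩ := hf M
    exact ⟨c • g, Submodule.smul_mem _ _ hg, by
      rw [← smul_sub]; exact h.const_smul_left c⟩

theorem asymp_mono {X Y : Set ℂ} (h : X ⊆ Y) : Asymp X ≤ Asymp Y := fun _ hf M =>
  let ⟨g, hg, h'⟩ := hf M
  ⟨g, logPowSpan_mono h hg, h'⟩

theorem logPowSpan_le_asymp (X : Set ℂ) : logPowSpan X ≤ Asymp X := fun f hf M =>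
  ⟨f, hf, by simpa using! isBigO_zero _ _⟩

theorem logPow_mem_asymp {X : Set ℂ} {α : ℂ} (h : α ∈ X) (l : ℕ) : logPow α l ∈ Asymp X :=
  logPowSpan_le_asymp X (logPow_mem_logPowSpan h l)

theorem Asymp.congr {X : Set ℂ} {f g : ℕ → ℂ} (hf : f ∈ Asymp X) (h : f =ᶠ[atTop] g) :
    g ∈ Asymp X := fun M =>
  let ⟨p, hp, h'⟩ := hf M
  ⟨p, hp, h'.congr' (h.sub .rfl) .rfl⟩

theorem logPow_zero_zero : logPow 0 0 = 1 := by funext N; simp [logPow]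

theorem isBigO_logPow {α : ℂ} {r : ℝ} (h : α.re < r) (l : ℕ) :
    logPow α l =O[atTop] fun N : ℕ => (N : ℝ) ^ r := by
  have h1 := (isLittleO_log_rpow_rpow_atTop (l : ℝ) (sub_pos.2 h)).isBigO.comp_tendsto
    tendsto_natCast_atTop_atTop
  have h2 : (fun N : ℕ => (N : ℂ) ^ α) =O[atTop] fun N : ℕ => (N : ℝ) ^ α.re := by
    refine IsBigO.of_bound 1 ?_
    filter_upwards [eventually_ge_atTop 1] with N hN
    rw [Complex.norm_natCast_cpow_of_pos hN, one_mul]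
    exact Real.le_norm_self _
  have h3 : (fun N : ℕ => (Real.log N : ℂ) ^ l) =O[atTop]
      ((fun x : ℝ => Real.log x ^ (l : ℝ)) ∘ (Nat.cast : ℕ → ℝ)) := by
    refine IsBigO.of_bound 1 (Eventually.of_forall fun N => ?_)
    rw [one_mul, norm_pow, Complex.norm_real, Function.comp_apply, Real.rpow_natCast, norm_pow]
  refine (h2.mul (h3.trans h1)).congr' .rfl ?_
  filter_upwards [eventually_ge_atTop 1] with N hN
  rw [Function.comp_apply, ← Real.rpow_add (by exact_mod_cast hN)]
  ring_nf

theorem exists_isBigO_of_mem_logPowSpan {X : Set ℂ} {f : ℕ → ℂ} (hf : f ∈ logPowSpan X) :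
    ∃ A : ℕ, f =O[atTop] fun N : ℕ => (N : ℝ) ^ (A : ℝ) := by
  have hmono : ∀ {A B : ℕ}, A ≤ B →
      (fun N : ℕ => (N : ℝ) ^ (A : ℝ)) =O[atTop] fun N : ℕ => (N : ℝ) ^ (B : ℝ) := by
    intro A B hAB
    refine IsBigO.of_bound 1 ?_
    filter_upwards [eventually_ge_atTop 1] with N hN
    rw [one_mul, Real.norm_of_nonneg (by positivity), Real.norm_of_nonneg (by positivity)]
    exact Real.rpow_le_rpow_of_exponent_le (by exact_mod_cast hN) (by exact_mod_cast hAB)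
  induction hf using Submodule.span_induction with
  | mem f hf =>
    obtain ⟨α, -, l, rfl⟩ := hf
    obtain ⟨A, hA⟩ := exists_nat_gt α.re
    exact ⟨A, isBigO_logPow hA l⟩
  | zero => exact ⟨0, isBigO_zero _ _⟩
  | add f g _ _ hf hg =>
    obtain ⟨A, hA⟩ := hf
    obtain ⟨B, hB⟩ := hg
    exact ⟨max A B, (hA.trans (hmono (le_max_left _ _))).add (hB.trans (hmono (le_max_right _ _)))⟩
  | smul c f _ hf =>
    obtain ⟨A, hA⟩ := hf
    exact ⟨A, hA.const_smul_left c⟩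

theorem exists_isBigO_of_mem_asymp {X : Set ℂ} {f : ℕ → ℂ} (hf : f ∈ Asymp X) :
    ∃ A : ℕ, f =O[atTop] fun N : ℕ => (N : ℝ) ^ (A : ℝ) := by
  obtain ⟨g, hg, h⟩ := hf 0
  obtain ⟨A, hA⟩ := exists_isBigO_of_mem_logPowSpan hg
  refine ⟨A, ?_⟩
  have h1 : (fun N : ℕ => (N : ℝ) ^ (-((0 : ℕ) : ℝ))) =O[atTop] fun N : ℕ => (N : ℝ) ^ (A : ℝ) := by
    refine IsBigO.of_bound 1 ?_
    filter_upwards [eventually_ge_atTop 1] with N hN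
    rw [one_mul, Real.norm_of_nonneg (by positivity), Real.norm_of_nonneg (by positivity)]
    exact Real.rpow_le_rpow_of_exponent_le (by exact_mod_cast hN) (by simp)
  simpa using (h.trans h1).add hA

theorem logPow_mul_logPow (α β : ℂ) (l m : ℕ) :
    logPow (α + β) (l + m) =ᶠ[atTop] logPow α l * logPow β m := by
  filter_upwards [eventually_ge_atTop 1] with N hN
  have : (N : ℂ) ≠ 0 := by exact_mod_cast (by omega : N ≠ 0)
  simp only [Pi.mul_apply, logPow, Complex.cpow_add _ _ this, pow_add]
  ring

theorem logPowSpan_mul_mem_asymp {X Y Z : Set ℂ} (hZ : ∀ x ∈ X, ∀ y ∈ Y, x + y ∈ Z)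
    {f g : ℕ → ℂ} (hf : f ∈ logPowSpan X) (hg : g ∈ logPowSpan Y) : f * g ∈ Asymp Z := by
  induction hf using Submodule.span_induction with
  | zero => rw [zero_mul]; exact Submodule.zero_mem _
  | add f f' _ _ hf hf' => rw [add_mul]; exact Submodule.add_mem _ hf hf'
  | smul c f _ hf => rw [smul_mul_assoc]; exact Submodule.smul_mem _ _ hf
  | mem f hf =>
    obtain ⟨α, hα, l, rfl⟩ := hf
    induction hg using Submodule.span_induction with
    | zero => rw [mul_zero]; exact Submodule.zero_mem _
    | add f f' _ _ hf hf' => rw [mul_add]; exact Submodule.add_mem _ hf hf'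
    | smul c f _ hf => rw [mul_smul_comm]; exact Submodule.smul_mem _ _ hf
    | mem g hg =>
      obtain ⟨β, hβ, m, rfl⟩ := hg
      exact Asymp.congr (logPow_mem_asymp (hZ α hα β hβ) _) (logPow_mul_logPow α β l m)

theorem Asymp.mul {X Y Z : Set ℂ} (hZ : ∀ x ∈ X, ∀ y ∈ Y, x + y ∈ Z)
    {f g : ℕ → ℂ} (hf : f ∈ Asymp X) (hg : g ∈ Asymp Y) : f * g ∈ Asymp Z := by
  intro M
  obtain ⟨A, hA⟩ := exists_isBigO_of_mem_asymp hf
  obtain ⟨B, hB⟩ := exists_isBigO_of_mem_asymp hg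
  -- Each remainder is multiplied by a factor growing like `N ^ A` or `N ^ B`; expanding to order `M
  -- + A + B` compensates for this.
  obtain ⟨p, hp, hp'⟩ := hf (M + A + B)
  obtain ⟨q, hq, hq'⟩ := hg (M + A + B)
  obtain ⟨r, hr, hr'⟩ := logPowSpan_mul_mem_asymp hZ hp hq M
  refine ⟨r, hr, ?_⟩
  have hpow : ∀ a b : ℝ, a + b ≤ -(M : ℝ) →
      (fun N : ℕ => (N : ℝ) ^ a * (N : ℝ) ^ b) =O[atTop] fun N : ℕ => (N : ℝ) ^ (-(M : ℝ)) := by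
    intro a b hab
    refine IsBigO.of_bound 1 ?_
    filter_upwards [eventually_ge_atTop 1] with N hN
    rw [← Real.rpow_add (by exact_mod_cast hN), one_mul, Real.norm_of_nonneg (by positivity),
      Real.norm_of_nonneg (by positivity)]
    exact Real.rpow_le_rpow_of_exponent_le (by exact_mod_cast hN) hab
  have hA0 : (0 : ℝ) ≤ A := Nat.cast_nonneg A
  have hB0 : (0 : ℝ) ≤ B := Nat.cast_nonneg B
  have hM0 : (0 : ℝ) ≤ M := Nat.cast_nonneg M
  have h1 := (hA.mul hq').trans (hpow _ _ (by push_cast; linarith))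
  have h2 := (hp'.mul hB).trans (hpow _ _ (by push_cast; linarith))
  have h3 := (hp'.mul hq').trans (hpow _ _ (by push_cast; linarith))
  refine (((h1.add h2).sub h3).add hr').congr_left fun N => ?_
  simp only [Pi.sub_apply, Pi.mul_apply]
  ring

/-- The only term of the combination that is not allowed in a finite part is a multiple of `logPow 0
0 = 1`, and it is moved into the constant. If `0 ∉ X` no such term occurs and the constant is
unchanged; this is where the polar set matters. -/
theorem hasFinitePart_of_tendsto_sub_logPowSpan {X : Set ℂ} {u g : ℕ → ℂ} (hg : g ∈ logPowSpan X)
    {a : ℂ} (h : Tendsto (u - g) atTop (𝓝 a)) : ∃ a', HasFinitePart u a' ∧ (0 ∉ X → a' = a) := by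
  classical
  have himg : {f | ∃ α ∈ X, ∃ l, f = logPow α l}
      = (fun p : ℂ × ℕ => logPow p.1 p.2) '' (X ×ˢ (Set.univ : Set ℕ)) := by
    ext f
    constructor
    · rintro ⟨α, hα, l, rfl⟩; exact ⟨(α, l), ⟨hα, trivial⟩, rfl⟩
    · rintro ⟨p, hp, rfl⟩; exact ⟨p.1, hp.1, p.2, rfl⟩
  rw [logPowSpan, himg, Finsupp.mem_span_image_iff_linearCombination] at hg
  obtain ⟨b, hb, rfl⟩ := hg
  have hb' : ∀ p ∈ b.support, p.1 ∈ X := fun p hp => ((Finsupp.mem_supported _ _).1 hb hp).1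
  refine ⟨a + b (0, 0), ⟨b.support.erase (0, 0), b, Finset.notMem_erase _ _, ?_⟩, fun h0 => ?_⟩
  · refine (h.add_const (b (0, 0))).congr fun N => ?_
    rw [Pi.sub_apply, Finsupp.linearCombination_apply, Finsupp.sum, Finset.sum_apply]
    by_cases hmem : (0, 0) ∈ b.support
    · rw [← Finset.add_sum_erase _ _ hmem]
      simp [logPow, mul_assoc]
      ring
    · rw [Finset.erase_eq_of_notMem hmem, Finsupp.notMem_support_iff.1 hmem]
      simp [logPow, mul_assoc]
  · have : b (0, 0) = 0 := Finsupp.notMem_support_iff.1 fun h => h0 (hb' _ h)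
    rw [this, add_zero]

theorem eq_zero_of_tendsto_of_mem_logPowSpan {X : Set ℂ} (hX : 0 ∉ X) {g : ℕ → ℂ}
    (hg : g ∈ logPowSpan X) {c : ℂ} (h : Tendsto g atTop (𝓝 c)) : c = 0 := by
  obtain ⟨a, ha, ha'⟩ := hasFinitePart_of_tendsto_sub_logPowSpan hg (u := g) (a := 0)
    (by rw [sub_self]; exact tendsto_const_nhds)
  rw [ha' hX] at ha
  refine HasFinitePart.unique ⟨∅, 0, by simp, by simpa using h⟩ ha

theorem tendsto_zero_of_isBigO_rpow_neg {f : ℕ → ℂ} {M : ℕ} (hM : 1 ≤ M)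
    (h : f =O[atTop] fun N : ℕ => (N : ℝ) ^ (-(M : ℝ))) : Tendsto f atTop (𝓝 0) :=
  h.trans_tendsto ((tendsto_rpow_neg_atTop (by exact_mod_cast hM)).comp tendsto_natCast_atTop_atTop)

theorem hasFinitePart_of_sub_mem_asymp {X : Set ℂ} {u : ℕ → ℂ} {a : ℂ}
    (h : (u - fun _ => a) ∈ Asymp X) : ∃ a', HasFinitePart u a' ∧ (0 ∉ X → a' = a) := by
  obtain ⟨g, hg, h'⟩ := h 1
  refine hasFinitePart_of_tendsto_sub_logPowSpan hg (a := a) ?_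
  have := (tendsto_zero_of_isBigO_rpow_neg le_rfl h').add_const a
  refine (this.congr fun N => ?_).trans (by rw [zero_add])
  simp only [Pi.sub_apply]; ring

theorem tendsto_zero_of_mem_asymp {X : Set ℂ} (hX : ∀ x ∈ X, x.re < 0) {f : ℕ → ℂ}
    (h : f ∈ Asymp X) : Tendsto f atTop (𝓝 0) := by
  obtain ⟨g, hg, h'⟩ := h 1
  have h1 := tendsto_zero_of_isBigO_rpow_neg le_rfl h'
  have h2 : Tendsto g atTop (𝓝 0) := by
    clear h' h1
    induction hg using Submodule.span_induction with
    | zero => exact tendsto_const_nhds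
    | add f f' _ _ hf hf' => simpa using! hf.add hf'
    | smul c f _ hf => simpa using! hf.const_smul c
    | mem g hg =>
      obtain ⟨α, hα, l, rfl⟩ := hg
      obtain ⟨r, hr, hr0⟩ := exists_between (hX α hα)
      refine (isBigO_logPow hr l).trans_tendsto ?_
      have := (tendsto_rpow_neg_atTop (neg_pos.2 hr0)).comp tendsto_natCast_atTop_atTop
      simpa using! this
  simpa using h1.add h2

end Asymp

end NestedZeta

namespace NestedZeta

/-! ### Solving the difference equation inside asymptotic expansions. -/

section RegularizedTail

open Asymptotics

/-- The exponents `x, x - 1, x - 2, …`. -/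
def down (x : ℂ) : Set ℂ := {y | ∃ m : ℕ, y = x - m}

theorem sub_natCast_mem_down (x : ℂ) (m : ℕ) : x - m ∈ down x := ⟨m, rfl⟩

theorem self_mem_down (x : ℂ) : x ∈ down x := ⟨0, by simp⟩

theorem down_subset_of_mem {x y : ℂ} (h : y ∈ down x) : down y ⊆ down x := by
  obtain ⟨m, rfl⟩ := h
  rintro _ ⟨n, rfl⟩
  exact ⟨m + n, by push_cast; ring⟩

theorem add_mem_down {x y z : ℂ} (hz : x + y = z) :
    ∀ a ∈ down x, ∀ b ∈ down y, a + b ∈ down z := by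
  rintro _ ⟨m, rfl⟩ _ ⟨n, rfl⟩
  exact ⟨m + n, by push_cast; rw [← hz]; ring⟩

theorem shift_cpow_mem_asymp (β : ℂ) :
    (fun n : ℕ => (((n : ℝ) + 1 : ℝ) : ℂ) ^ β - (n : ℂ) ^ β - β * (n : ℂ) ^ (β - 1))
      ∈ Asymp (down (β - 2)) := by
  intro M
  obtain ⟨K, hK⟩ := exists_nat_gt (β.re + M)
  obtain ⟨C, hC, h⟩ := norm_natCast_add_cpow_sub_sum_le (K + 2) (norm_nonneg β) zero_le_one
  refine ⟨∑ i ∈ Finset.range K, binomCoeff (i + 2) β • logPow (β - 2 - i) 0,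
    Submodule.sum_mem _ fun i _ => Submodule.smul_mem _ _
      (logPow_mem_logPowSpan (sub_natCast_mem_down _ _) 0), ?_⟩
  refine IsBigO.of_bound C ?_
  filter_upwards [eventually_ge_atTop 1] with n hn
  have h1 := h β le_rfl n hn
  rw [Finset.sum_range_succ', Finset.sum_range_succ'] at h1
  have hn0 : (1 : ℝ) ≤ n := by exact_mod_cast hn
  rw [Real.norm_of_nonneg (by positivity)]
  refine (le_of_eq ?_).trans (h1.trans ?_)
  · congr 1
    simp only [Pi.sub_apply, Finset.sum_apply, Pi.smul_apply, logPow, smul_eq_mul, pow_zero,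
      mul_one, zero_add, binomCoeff_one, Complex.ofReal_one, one_pow, Nat.cast_zero, sub_zero,
      Nat.cast_one]
    have : ∀ i : ℕ, β - ((i + 1 + 1 : ℕ) : ℂ) = β - 2 - i := fun i => by push_cast; ring
    simp only [this, binomCoeff]
    ring
  · refine mul_le_mul_of_nonneg_left (Real.rpow_le_rpow_of_exponent_le hn0 ?_) hC
    push_cast; linarith

theorem shift_log_mem_asymp :
    (fun n : ℕ => (Real.log ((n : ℝ) + 1) : ℂ) - (Real.log n : ℂ) - (n : ℂ) ^ (-1 : ℂ))
      ∈ Asymp (down (-2)) := by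
  intro M
  refine ⟨∑ i ∈ Finset.range M, (-((-1) ^ (i + 2) / ((i : ℂ) + 2))) • logPow (-2 - i) 0,
    Submodule.sum_mem _ fun i _ => Submodule.smul_mem _ _
      (logPow_mem_logPowSpan (sub_natCast_mem_down _ _) 0), ?_⟩
  refine IsBigO.of_bound 2 ?_
  -- For `n ≥ 2` the denominator `1 - 1 / n` in the logarithmic remainder is at least `1 / 2`,
  -- whence the constant 2.
  filter_upwards [eventually_ge_atTop 2] with n hn
  have hn2 : (2 : ℝ) ≤ n := by exact_mod_cast hn
  have hn0 : (0 : ℝ) < n := by linarith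
  have hn0' : (n : ℂ) ≠ 0 := by exact_mod_cast hn0.ne'
  have habs : |(-(1 / (n : ℝ)))| = 1 / n := by rw [abs_neg, abs_of_pos (by positivity)]
  have hle : 1 / (n : ℝ) ≤ 1 / 2 := by gcongr
  have h := Real.abs_log_sub_add_sum_range_le (x := -(1 / (n : ℝ))) (by rw [habs]; linarith) (M + 1)
  rw [habs, Finset.sum_range_succ', sub_neg_eq_add] at h
  have hlog : Real.log (1 + 1 / n) = Real.log ((n : ℝ) + 1) - Real.log n := by
    rw [← Real.log_div (by positivity) hn0.ne']; congr 1; field_simp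
  rw [hlog] at h
  rw [Real.norm_of_nonneg (by positivity)]
  have e : ((fun n : ℕ => (Real.log ((n : ℝ) + 1) : ℂ) - (Real.log n : ℂ) - (n : ℂ) ^ (-1 : ℂ))
      - ∑ i ∈ Finset.range M, (-((-1) ^ (i + 2) / ((i : ℂ) + 2))) • logPow (-2 - i) 0) n
      = ((∑ k ∈ Finset.range M, (-(1 / (n : ℝ))) ^ (k + 1 + 1) / ((k + 1 : ℕ) + 1)
        + (-(1 / (n : ℝ))) ^ (0 + 1) / ((0 : ℕ) + 1)
        + (Real.log ((n : ℝ) + 1) - Real.log n) : ℝ) : ℂ) := by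
    simp only [Pi.sub_apply, Finset.sum_apply, Pi.smul_apply, logPow, smul_eq_mul, pow_zero,
      mul_one, zero_add]
    have e1 : ∀ i : ℕ, (-((-1 : ℂ) ^ (i + 2) / ((i : ℂ) + 2))) * (n : ℂ) ^ (-2 - i : ℂ)
        = - ((-(1 / (n : ℂ))) ^ (i + 1 + 1) / (((i + 1 : ℕ) : ℂ) + 1)) := by
      intro i
      rw [show (-2 - i : ℂ) = -((i + 2 : ℕ) : ℂ) by push_cast; ring, Complex.cpow_neg,
        Complex.cpow_natCast, neg_pow (1 / (n : ℂ)), one_div, inv_pow]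
      push_cast
      rw [show (i : ℂ) + 1 + 1 = i + 2 by ring]
      ring
    simp only [e1, Finset.sum_neg_distrib]
    rw [Complex.cpow_neg_one]
    push_cast
    ring
  rw [e, Complex.norm_real]
  refine h.trans ?_
  rw [div_le_iff₀ (by linarith), Real.rpow_neg hn0.le, Real.rpow_natCast, one_div, inv_pow]
  have h3 : ((n : ℝ) ^ (M + 1 + 1))⁻¹ ≤ ((n : ℝ) ^ M)⁻¹ := by
    gcongr
    · linarith
    · omega
  have h4 : (0 : ℝ) ≤ ((n : ℝ) ^ M)⁻¹ := by positivity
  rw [one_div] at hle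
  nlinarith

theorem mul_mem_asymp_down {x y z : ℂ} (hz : x + y = z) {f g : ℕ → ℂ} (hf : f ∈ Asymp (down x))
    (hg : g ∈ Asymp (down y)) : f * g ∈ Asymp (down z) :=
  Asymp.mul (add_mem_down hz) hf hg

/-- The subtracted terms are the value and the derivative of `x ^ β (log x) ^ l`; the rest of the
Taylor expansion starts two powers lower. The induction multiplies by `log (n + 1) = log n + 1 / n +
κ n`. -/
theorem shift_logPow_mem_asymp (β : ℂ) (l : ℕ) :
    (fun n : ℕ => logPow β l (n + 1) - logPow β l n - β * logPow (β - 1) l n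
      - l * logPow (β - 1) (l - 1) n) ∈ Asymp (down (β - 2)) := by
  induction l with
  | zero =>
    refine Asymp.congr (shift_cpow_mem_asymp β) (Eventually.of_forall fun n => ?_)
    simp [logPow]
  | succ l ih =>
    have hL : logPow 0 1 ∈ Asymp (down 0) := logPow_mem_asymp (self_mem_down 0) 1
    have hI : logPow (-1) 0 ∈ Asymp (down (-1)) := logPow_mem_asymp (self_mem_down _) 0
    set κ : ℕ → ℂ := fun n => (Real.log ((n : ℝ) + 1) : ℂ) - (Real.log n : ℂ) - (n : ℂ) ^ (-1 : ℂ)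
    have hκ : κ ∈ Asymp (down (-2)) := shift_log_mem_asymp
    have hd1 : down (-2) ⊆ down (-1) := down_subset_of_mem ⟨1, by norm_num⟩
    have hd2 : down (-1) ⊆ down 0 := down_subset_of_mem ⟨1, by norm_num⟩
    have hIκ : logPow (-1) 0 + κ ∈ Asymp (down (-1)) :=
      Submodule.add_mem _ hI (asymp_mono hd1 hκ)
    have hL' : logPow 0 1 + (logPow (-1) 0 + κ) ∈ Asymp (down 0) :=
      Submodule.add_mem _ hL (asymp_mono hd2 hIκ)
    have t1 := mul_mem_asymp_down (z := β - 2) (by ring) ih hL'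
    have t2 := mul_mem_asymp_down (z := β - 2) (by ring)
      (logPow_mem_asymp (self_mem_down β) l) hκ
    have t3 := mul_mem_asymp_down (z := β - 2) (by ring)
      (Submodule.add_mem _ (Submodule.smul_mem _ β (logPow_mem_asymp (self_mem_down (β - 1)) l))
        (Submodule.smul_mem _ (l : ℂ) (logPow_mem_asymp (self_mem_down (β - 1)) (l - 1)))) hIκ
    refine Asymp.congr (Submodule.add_mem _ (Submodule.add_mem _ t1 t2) t3) ?_
    filter_upwards [eventually_ge_atTop 1] with n hn
    have hn0 : (n : ℂ) ≠ 0 := by exact_mod_cast (by omega : n ≠ 0)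
    have hb : (n : ℂ) ^ (β - 1) = (n : ℂ) ^ β * (n : ℂ) ^ (-1 : ℂ) := by
      rw [← Complex.cpow_add _ _ hn0]; rfl
    simp only [Pi.add_apply, Pi.mul_apply, Pi.smul_apply, smul_eq_mul, logPow, κ, hb,
      Complex.cpow_zero, pow_zero, pow_one, one_mul, mul_one, Nat.add_sub_cancel]
    have hc : ((n + 1 : ℕ) : ℝ) = (n : ℝ) + 1 := by push_cast; ring
    rw [hc]
    generalize (Real.log n : ℂ) = L
    generalize (Real.log ((n : ℝ) + 1) : ℂ) = L'
    generalize (n : ℂ) ^ β = P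
    generalize (((n + 1 : ℕ) : ℂ)) ^ β = P'
    generalize (n : ℂ) ^ (-1 : ℂ) = J
    rcases l with _ | l
    · push_cast; ring
    · simp only [Nat.add_sub_cancel]; push_cast; ring

/-- The backward difference `n ↦ f n - f (n + 1)`. -/
def bdiff : (ℕ → ℂ) →ₗ[ℂ] (ℕ → ℂ) where
  toFun f n := f n - f (n + 1)
  map_add' f g := by funext n; simp only [Pi.add_apply]; ring
  map_smul' c f := by funext n; simp only [Pi.smul_apply, smul_eq_mul, RingHom.id_apply]; ring

theorem bdiff_apply (f : ℕ → ℂ) (n : ℕ) : bdiff f n = f n - f (n + 1) := rfl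

/-- Sequences that are, up to `O(N ^ (-M))`, the difference of a combination of terms
`N ^ α (log N) ^ l` with `α - 1 ∈ X`. -/
def bdiffRange (X : Set ℂ) (M : ℕ) : Submodule ℂ (ℕ → ℂ) where
  carrier := {f | ∃ F ∈ logPowSpan {y | y - 1 ∈ X},
    (f - bdiff F) =O[atTop] fun N : ℕ => (N : ℝ) ^ (-(M : ℝ))}
  zero_mem' := ⟨0, Submodule.zero_mem _, by simpa using! isBigO_zero _ _⟩
  add_mem' {f f'} := by
    rintro ⟨F, hF, h⟩ ⟨F', hF', h'⟩
    refine ⟨F + F', Submodule.add_mem _ hF hF', ?_⟩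
    rw [map_add, add_sub_add_comm]; exact h.add h'
  smul_mem' c f := by
    rintro ⟨F, hF, h⟩
    refine ⟨c • F, Submodule.smul_mem _ _ hF, ?_⟩
    rw [map_smul, ← smul_sub]; exact h.const_smul_left c

theorem mem_bdiffRange_of_isBigO {X : Set ℂ} {M : ℕ} {f : ℕ → ℂ}
    (h : f =O[atTop] fun N : ℕ => (N : ℝ) ^ (-(M : ℝ))) : f ∈ bdiffRange X M :=
  ⟨0, Submodule.zero_mem _, by simpa using h⟩

theorem bdiff_mem_bdiffRange {X : Set ℂ} {M : ℕ} {F : ℕ → ℂ}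
    (h : F ∈ logPowSpan {y | y - 1 ∈ X}) : bdiff F ∈ bdiffRange X M :=
  ⟨F, h, by simpa using! isBigO_zero _ _⟩

theorem asymp_le_bdiffRange_of_logPow {X Y : Set ℂ} {M : ℕ}
    (h : ∀ α ∈ Y, ∀ l, logPow α l ∈ bdiffRange X M) : Asymp Y ≤ bdiffRange X M := by
  intro f hf
  obtain ⟨g, hg, h'⟩ := hf M
  have h1 : g ∈ bdiffRange X M := by
    refine Submodule.span_le.2 ?_ hg
    rintro _ ⟨α, hα, l, rfl⟩
    exact h α hα l
  have := Submodule.add_mem _ (mem_bdiffRange_of_isBigO (X := X) h') h1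
  simpa using this

theorem down_subset {X : Set ℂ} (hX : ∀ x ∈ X, x - 1 ∈ X) {x : ℂ} (hx : x ∈ X) : down x ⊆ X := by
  rintro _ ⟨m, rfl⟩
  induction m with
  | zero => simpa using hx
  | succ m ih =>
    have := hX _ ih
    rwa [sub_sub, ← Nat.cast_succ] at this

/-- A discrete antiderivative: up to lower exponents and lower powers of the logarithm, `N ^ α (log
N) ^ l` is the difference of `-N ^ (α + 1) (log N) ^ l / (α + 1)`. The number `K` counts how often
the exponent must drop before the term is an admissible error. -/
theorem logPow_mem_bdiffRange {X : Set ℂ} (hX : ∀ x ∈ X, x - 1 ∈ X) (M K : ℕ) :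
    ∀ α ∈ X, α.re + M < K → ∀ l, logPow α l ∈ bdiffRange X M := by
  induction K with
  | zero =>
    intro α _ h l
    exact mem_bdiffRange_of_isBigO (isBigO_logPow (by push_cast at h; linarith) l)
  | succ K ih =>
    intro α hα h l
    have hlow : Asymp (down (α - 1)) ≤ bdiffRange X M := by
      refine asymp_le_bdiffRange_of_logPow ?_
      rintro β ⟨m, rfl⟩ l
      refine ih _ (down_subset hX hα ⟨m + 1, by push_cast; ring⟩) ?_ l
      simp only [Complex.sub_re, Complex.one_re, Complex.natCast_re]
      push_cast at h
      have : (0 : ℝ) ≤ m := Nat.cast_nonneg m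
      linarith
    have hY : α + 1 ∈ {y | y - 1 ∈ X} := by simpa using hα
    have hdiff : ∀ l, (fun n => (α + 1) * logPow α l n + l * logPow α (l - 1) n)
        ∈ bdiffRange X M := by
      intro l
      have h1 := shift_logPow_mem_asymp (α + 1) l
      rw [show α + 1 - 2 = α - 1 by ring] at h1
      have h2 := bdiff_mem_bdiffRange (X := X) (M := M) (logPow_mem_logPowSpan hY l)
      have h3 := Submodule.add_mem _ (hlow h1) h2
      have h4 := Submodule.neg_mem _ h3
      convert h4 using 1
      funext n
      simp only [Pi.neg_apply, Pi.add_apply, bdiff_apply, add_sub_cancel_right]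
      ring
    -- At the resonance `α = -1` the antiderivative is a multiple of `(log N) ^ (l + 1)`: this is
    -- how logarithms arise. Otherwise `l` is lowered by induction.
    by_cases hα1 : α + 1 = 0
    · have := Submodule.smul_mem _ ((l : ℂ) + 1)⁻¹ (hdiff (l + 1))
      convert this using 1
      funext n
      have hl : (l : ℂ) + 1 ≠ 0 := by exact_mod_cast Nat.succ_ne_zero l
      simp only [Pi.smul_apply, smul_eq_mul, hα1, Nat.add_sub_cancel]
      push_cast
      field_simp
      ring
    · induction l with
      | zero =>
        have := Submodule.smul_mem _ (α + 1)⁻¹ (hdiff 0)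
        convert this using 1
        funext n
        simp only [Pi.smul_apply, smul_eq_mul]
        push_cast
        field_simp
        ring
      | succ l ihl =>
        have := Submodule.smul_mem _ (α + 1)⁻¹
          (Submodule.sub_mem _ (hdiff (l + 1)) (Submodule.smul_mem _ ((l : ℂ) + 1) ihl))
        convert this using 1
        funext n
        simp only [Pi.smul_apply, Pi.sub_apply, smul_eq_mul, Nat.add_sub_cancel]
        push_cast
        field_simp
        ring

theorem asymp_le_bdiffRange {X : Set ℂ} (hX : ∀ x ∈ X, x - 1 ∈ X) (M : ℕ) :
    Asymp X ≤ bdiffRange X M := by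
  refine asymp_le_bdiffRange_of_logPow fun α hα l => ?_
  obtain ⟨K, hK⟩ := exists_nat_gt (α.re + M)
  exact logPow_mem_bdiffRange hX M K α hα hK l

theorem exists_bdiff_eq_of_isBigO {r : ℕ → ℂ} {M : ℕ}
    (h : r =O[atTop] fun N : ℕ => (N : ℝ) ^ (-((M + 2 : ℕ) : ℝ))) :
    ∃ t : ℕ → ℂ, bdiff t = r ∧ t =O[atTop] fun N : ℕ => (N : ℝ) ^ (-(M : ℝ)) := by
  obtain ⟨C, hC, h⟩ := h.exists_pos
  obtain ⟨n₀, hn₀⟩ := eventually_atTop.1 h.bound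
  have key : ∀ n, n₀ + 1 ≤ n → Summable (fun i => r (n + i)) ∧
      ‖∑' i, r (n + i)‖ ≤ 2 * C * (n : ℝ) ^ (1 - ((M + 2 : ℕ) : ℝ)) := by
    intro n hn
    refine summable_and_norm_tsum_le_of_norm_le_rpow (by omega) hC.le ?_ fun m hm => ?_
    · push_cast; linarith [(Nat.cast_nonneg M : (0 : ℝ) ≤ M)]
    · have := hn₀ m (by omega)
      rwa [Real.norm_of_nonneg (by positivity)] at this
  have hsum : ∀ n, Summable fun i => r (n + i) := by
    intro n
    have h1 := (key (n₀ + 1) le_rfl).1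
    have h2 : Summable r := by
      rw [← summable_nat_add_iff (n₀ + 1)]
      simpa only [add_comm] using h1
    simpa only [add_comm] using (summable_nat_add_iff n).2 h2
  refine ⟨fun n => ∑' i, r (n + i), ?_, ?_⟩
  · funext n
    exact tsum_sub_tsum_succ (hsum n)
  · refine IsBigO.of_bound (2 * C) ?_
    filter_upwards [eventually_ge_atTop (n₀ + 1)] with n hn
    rw [Real.norm_of_nonneg (by positivity)]
    refine (key n hn).2.trans ?_
    refine mul_le_mul_of_nonneg_left (Real.rpow_le_rpow_of_exponent_le ?_ ?_) (by positivity)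
    · exact_mod_cast (by omega : 1 ≤ n)
    · push_cast; linarith

/-- Each order `M` supplies its own solution. Two solutions differ by a constant, so a single `t`
serves for all orders: the constant is absorbed as `N ^ 0` when exponent `0` is permitted, and
vanishes otherwise, as the limit of a combination without exponent `0`. -/
theorem exists_bdiff_eq {X : Set ℂ} (hX : ∀ x ∈ X, x - 1 ∈ X) {f : ℕ → ℂ} (hf : f ∈ Asymp X) :
    ∃ t ∈ Asymp {y | y - 1 ∈ X}, bdiff t = f := by
  have key : ∀ M : ℕ, ∃ F ∈ logPowSpan {y | y - 1 ∈ X}, ∃ t : ℕ → ℂ, bdiff t = f ∧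
      (t - F) =O[atTop] fun N : ℕ => (N : ℝ) ^ (-(M : ℝ)) := by
    intro M
    obtain ⟨F, hF, h⟩ := asymp_le_bdiffRange hX (M + 2) hf
    obtain ⟨t, ht, ht'⟩ := exists_bdiff_eq_of_isBigO h
    exact ⟨F, hF, t + F, by rw [map_add, ht]; simp, by simpa using ht'⟩
  obtain ⟨F₁, hF₁, t, ht, htF⟩ := key 1
  refine ⟨t, fun M => ?_, ht⟩
  obtain ⟨F, hF, t', ht', htF'⟩ := key (M + 1)
  have hconst : ∀ n, (t - t') n = (t - t') 0 := by
    intro n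
    induction n with
    | zero => rfl
    | succ n ih =>
      have h1 := congrFun (ht.trans ht'.symm) n
      simp only [bdiff_apply] at h1
      rw [← ih]
      simp only [Pi.sub_apply]
      linear_combination -h1
  set κ := (t - t') 0
  have hκ : Tendsto (F₁ - F) atTop (𝓝 κ) := by
    have h1 := tendsto_zero_of_isBigO_rpow_neg le_rfl htF
    have h2 := tendsto_zero_of_isBigO_rpow_neg (by omega) htF'
    refine ((h2.sub h1).add_const κ |>.congr fun n => ?_).trans (by simp)
    rw [← hconst n]
    simp only [Pi.sub_apply]
    ring
  have htF'' : (t' - F) =O[atTop] fun N : ℕ => (N : ℝ) ^ (-(M : ℝ)) := by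
    refine htF'.trans (IsBigO.of_bound 1 ?_)
    filter_upwards [eventually_ge_atTop 1] with N hN
    rw [one_mul, Real.norm_of_nonneg (by positivity), Real.norm_of_nonneg (by positivity)]
    exact Real.rpow_le_rpow_of_exponent_le (by exact_mod_cast hN) (by push_cast; linarith)
  by_cases h0 : (0 : ℂ) ∈ {y | y - 1 ∈ X}
  · refine ⟨F + κ • logPow 0 0, Submodule.add_mem _ hF
      (Submodule.smul_mem _ _ (logPow_mem_logPowSpan h0 0)), ?_⟩
    refine htF''.congr_left fun n => ?_
    have := hconst n
    simp only [Pi.sub_apply, Pi.add_apply, Pi.smul_apply, smul_eq_mul, logPow_zero_zero,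
      Pi.one_apply] at this ⊢
    linear_combination -this
  · have hκ0 := eq_zero_of_tendsto_of_mem_logPowSpan h0 (Submodule.sub_mem _ hF₁ hF) hκ
    refine ⟨F, hF, htF''.congr_left fun n => ?_⟩
    have := hconst n
    rw [hκ0] at this
    simp only [Pi.sub_apply] at this ⊢
    linear_combination -this

end RegularizedTail

end NestedZeta

namespace NestedZeta

/-! ### Asymptotic expansion of nested sums at a fixed parameter. -/

section Nest

/-- The largest value that may follow `n` in a chain. -/
def Version.pred : Version → ℕ → ℕ
  | .strict, n => n - 1
  | .weak, n => n

/-- Nested sums, defined recursively from the outermost index. -/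
def nest (c : Version) : List (ℕ → ℂ) → ℕ → ℂ
  | [], _ => 1
  | f :: fs, N => ∑ n ∈ Finset.Icc 1 N, f n * nest c fs (c.pred n)

theorem nest_nil (c : Version) (N : ℕ) : nest c [] N = 1 := rfl

theorem nest_cons (c : Version) (f : ℕ → ℂ) (fs : List (ℕ → ℂ)) (N : ℕ) :
    nest c (f :: fs) N = ∑ n ∈ Finset.Icc 1 N, f n * nest c fs (c.pred n) := rfl

theorem nest_cons_zero (c : Version) (f : ℕ → ℂ) (fs : List (ℕ → ℂ)) :
    nest c (f :: fs) 0 = 0 := by simp [nest_cons]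

theorem nest_cons_succ (c : Version) (f : ℕ → ℂ) (fs : List (ℕ → ℂ)) (N : ℕ) :
    nest c (f :: fs) (N + 1) = nest c (f :: fs) N + f (N + 1) * nest c fs (c.pred (N + 1)) := by
  rw [nest_cons, Finset.sum_Icc_succ_top (by omega), ← nest_cons]

/-- The exponents of `N` in the asymptotic expansion of the nested sum of functions of orders
`-z₁, …, -z_k`. -/
def expo : List ℂ → Set ℂ
  | [] => ∅
  | z :: zs => down (1 - z) ∪ {x | x - (1 - z) ∈ expo zs}

theorem sub_one_mem_expo (zs : List ℂ) : ∀ x ∈ expo zs, x - 1 ∈ expo zs := by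
  induction zs with
  | nil => exact fun x hx => hx.elim
  | cons z zs ih =>
    rintro x (⟨m, rfl⟩ | hx)
    · exact Or.inl ⟨m + 1, by push_cast; ring⟩
    · refine Or.inr ?_
      have := ih _ hx
      rwa [sub_right_comm] at this

theorem sub_natCast_mem_expo {zs : List ℂ} {x : ℂ} (hx : x ∈ expo zs) (m : ℕ) :
    x - m ∈ expo zs := down_subset (sub_one_mem_expo zs) hx ⟨m, rfl⟩

/-- The bookkeeping of Abel summation: once the outermost letter is absorbed into its neighbour, the
first two exponents `z, w` are replaced by `z + w - 1`. -/
theorem expo_cons_cons (z w : ℂ) (zs : List ℂ) :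
    expo (z :: w :: zs) = down (1 - z) ∪ expo ((z + w - 1) :: zs) := by
  simp only [expo]
  congr 1
  ext x
  constructor
  · rintro (⟨m, h⟩ | h)
    · exact Or.inl ⟨m, by linear_combination h⟩
    · refine Or.inr ?_
      change _ ∈ expo zs at h
      change _ ∈ expo zs
      convert h using 1; ring
  · rintro (⟨m, h⟩ | h)
    · exact Or.inl ⟨m, by linear_combination h⟩
    · refine Or.inr ?_
      change _ ∈ expo zs at h
      change _ ∈ expo zs
      convert h using 1; ring

/-- Applied with `f` the tail of the outermost letter, this says that the boundary term of Abel
summation has only exponents that are already expected. -/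
theorem mul_nest_mem_asymp {z : ℂ} {zs : List ℂ} {f u : ℕ → ℂ} {a : ℂ}
    (hf : f ∈ Asymp (down (1 - z))) (hu : (u - fun _ => a) ∈ Asymp (expo zs)) :
    f * u ∈ Asymp (expo (z :: zs)) := by
  have h1 : f * (u - fun _ => a) ∈ Asymp (expo (z :: zs)) := by
    refine Asymp.mul ?_ hf hu
    rintro _ ⟨m, rfl⟩ y hy
    refine Or.inr ?_
    have := sub_natCast_mem_expo hy m
    change _ ∈ expo zs
    convert this using 1; ring
  have h2 : f ∈ Asymp (expo (z :: zs)) := asymp_mono Set.subset_union_left hf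
  have := Submodule.add_mem _ h1 (Submodule.smul_mem _ a h2)
  convert this using 1
  funext n
  simp only [Pi.mul_apply, Pi.add_apply, Pi.sub_apply, Pi.smul_apply, smul_eq_mul]
  ring

theorem sum_Icc_bdiff (t : ℕ → ℂ) (N : ℕ) :
    ∑ n ∈ Finset.Icc 1 N, bdiff t n = t 1 - t (N + 1) := by
  induction N with
  | zero => simp
  | succ N ih => rw [Finset.sum_Icc_succ_top (by omega), ih, bdiff_apply]; ring

/-- Nested sums of functions with asymptotic expansions have asymptotic expansions. -/
theorem exists_nest_sub_const_mem_asymp (c : Version) {zs : List ℂ} {fs : List (ℕ → ℂ)}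
    (h : List.Forall₂ (fun z f => f ∈ Asymp (down (-z))) zs fs) :
    ∃ a : ℂ, (nest c fs - fun _ => a) ∈ Asymp (expo zs) ∧
      ((fun n => nest c fs (c.pred n)) - fun _ => a) ∈ Asymp (expo zs) := by
  induction h with
  | nil =>
    refine ⟨1, ?_, ?_⟩
    · convert Submodule.zero_mem _ using 1
      funext n; simp [nest_nil]
    · convert Submodule.zero_mem _ using 1
      funext n; simp [nest_nil]
  | @cons z f zs fs hf _ ih =>
    obtain ⟨a, -, ha⟩ := ih
    set G : ℕ → ℂ := f * fun n => nest c fs (c.pred n) with hG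
    have hshift : ∀ x ∈ {x | x + 1 ∈ expo (z :: zs)}, x - 1 ∈ {x | x + 1 ∈ expo (z :: zs)} := by
      intro x hx
      have := sub_one_mem_expo _ _ hx
      change x - 1 + 1 ∈ expo (z :: zs)
      convert this using 1; ring
    have hGX : G ∈ Asymp {x | x + 1 ∈ expo (z :: zs)} := by
      have h1 : f * ((fun n => nest c fs (c.pred n)) - fun _ => a) ∈
          Asymp {x | x + 1 ∈ expo (z :: zs)} := by
        refine Asymp.mul ?_ hf ha
        rintro _ ⟨m, rfl⟩ y hy
        refine Or.inr ?_
        have := sub_natCast_mem_expo hy m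
        change _ ∈ expo zs
        convert this using 1; ring
      have h2 : f ∈ Asymp {x | x + 1 ∈ expo (z :: zs)} := by
        refine asymp_mono ?_ hf
        rintro _ ⟨m, rfl⟩
        exact Or.inl ⟨m, by ring⟩
      have := Submodule.add_mem _ h1 (Submodule.smul_mem _ a h2)
      convert this using 1
      funext n
      simp only [hG, Pi.mul_apply, Pi.add_apply, Pi.sub_apply, Pi.smul_apply, smul_eq_mul]
      ring
    -- The summand `G` is the difference of `t`, so the nested sum is `t 1 - t (N + 1)` and its
    -- constant is `t 1`.
    obtain ⟨t, ht, htG⟩ := exists_bdiff_eq hshift hGX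
    have ht' : t ∈ Asymp (expo (z :: zs)) := by
      refine asymp_mono ?_ ht
      intro y hy
      change y - 1 + 1 ∈ expo (z :: zs) at hy
      rwa [sub_add_cancel] at hy
    have hG' : G ∈ Asymp (expo (z :: zs)) := by
      refine asymp_mono ?_ hGX
      intro y hy
      have := sub_one_mem_expo _ _ hy
      rwa [add_sub_cancel_right] at this
    have hnest : ∀ N, nest c (f :: fs) N = t 1 - t (N + 1) := by
      intro N
      rw [nest_cons, ← sum_Icc_bdiff, htG]
      rfl
    have hGt : ∀ N, G N = t N - t (N + 1) := fun N => by rw [← htG]; rfl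
    -- Writing `t (N + 1) = t N - G N` avoids re-expanding a shifted sequence.
    have h1 : (nest c (f :: fs) - fun _ => t 1) ∈ Asymp (expo (z :: zs)) := by
      convert Submodule.sub_mem _ hG' ht' using 1
      funext N
      simp only [Pi.sub_apply, hnest, hGt]
      ring
    refine ⟨t 1, h1, ?_⟩
    cases c with
    | weak => exact h1
    | strict =>
      -- In the strict case the value at `N - 1` is `t 1 - t N`, for `N ≥ 1`.
      refine Asymp.congr (Submodule.neg_mem _ ht') ?_
      filter_upwards [eventually_ge_atTop 1] with N hN
      simp only [Pi.sub_apply, Pi.neg_apply, Version.pred, hnest, Nat.sub_add_cancel hN]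
      ring

end Nest

end NestedZeta

namespace NestedZeta

/-! ### Holomorphic families of sequences with uniform expansions. -/

section Families

variable {E : Type*} [NormedAddCommGroup E] [NormedSpace ℂ E]

/-- Bounded analytic functions on `U`. -/
structure BddAnalytic (U : Set E) (c : E → ℂ) : Prop where
  analytic : AnalyticOnNhd ℂ c U
  bounded : ∃ C, 0 ≤ C ∧ ∀ s ∈ U, ‖c s‖ ≤ C

namespace BddAnalytic

variable {U V : Set E} {c d : E → ℂ}

theorem mono (hc : BddAnalytic U c) (h : V ⊆ U) : BddAnalytic V c :=
  ⟨hc.analytic.mono h, let ⟨C, h0, hC⟩ := hc.bounded; ⟨C, h0, fun s hs => hC s (h hs)⟩⟩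

theorem const (a : ℂ) : BddAnalytic U fun _ => a :=
  ⟨analyticOnNhd_const, ‖a‖, norm_nonneg _, fun _ _ => le_rfl⟩

theorem add (hc : BddAnalytic U c) (hd : BddAnalytic U d) : BddAnalytic U fun s => c s + d s := by
  obtain ⟨C, h0, hC⟩ := hc.bounded
  obtain ⟨D, h0', hD⟩ := hd.bounded
  exact ⟨hc.analytic.add hd.analytic, C + D, by positivity, fun s hs =>
    (norm_add_le _ _).trans (add_le_add (hC s hs) (hD s hs))⟩

theorem neg (hc : BddAnalytic U c) : BddAnalytic U fun s => -c s := by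
  obtain ⟨C, h0, hC⟩ := hc.bounded
  exact ⟨hc.analytic.neg, C, h0, fun s hs => by simpa using hC s hs⟩

theorem sub (hc : BddAnalytic U c) (hd : BddAnalytic U d) : BddAnalytic U fun s => c s - d s := by
  simpa only [sub_eq_add_neg] using hc.add hd.neg

theorem mul (hc : BddAnalytic U c) (hd : BddAnalytic U d) : BddAnalytic U fun s => c s * d s := by
  obtain ⟨C, h0, hC⟩ := hc.bounded
  obtain ⟨D, h0', hD⟩ := hd.bounded
  refine ⟨hc.analytic.mul hd.analytic, C * D, by positivity, fun s hs => ?_⟩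
  rw [norm_mul]
  exact mul_le_mul (hC s hs) (hD s hs) (norm_nonneg _) h0

theorem pow (hc : BddAnalytic U c) (n : ℕ) : BddAnalytic U fun s => c s ^ n := by
  induction n with
  | zero => simpa using const 1
  | succ n ih => simpa only [pow_succ] using ih.mul hc

theorem inv {δ : ℝ} (hδ : 0 < δ) (hc : BddAnalytic U c) (h : ∀ s ∈ U, δ ≤ ‖c s‖) :
    BddAnalytic U fun s => (c s)⁻¹ := by
  refine ⟨hc.analytic.inv fun s hs h0 => ?_, δ⁻¹, by positivity, fun s hs => ?_⟩
  · have := h s hs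
    rw [h0, norm_zero] at this
    linarith
  · rw [norm_inv]
    exact inv_anti₀ hδ (h s hs)

theorem comp_differentiable {g : ℂ → ℂ} (hg : Differentiable ℂ g) (hc : BddAnalytic U c) :
    BddAnalytic U fun s => g (c s) := by
  refine ⟨fun s hs => (hg.analyticAt (c s)).comp (hc.analytic s hs), ?_⟩
  obtain ⟨C, h0, hC⟩ := hc.bounded
  obtain ⟨D, hD⟩ := (isCompact_closedBall (0 : ℂ) C).exists_bound_of_continuousOn
    hg.continuous.continuousOn
  exact ⟨max D 0, le_max_right _ _, fun s hs =>
    (hD (c s) (by simpa using hC s hs)).trans (le_max_left _ _)⟩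

end BddAnalytic

/-- Holomorphic families of sequences on `U` with an asymptotic expansion
`f n s ~ ∑ m < M, c m s * n ^ (-z s - m)` up to `O(n ^ (-z s - M))`, uniformly on `U`. -/
def Hol (U : Set E) : ℕ → (E → ℂ) → (ℕ → E → ℂ) → Prop
  | 0, z, f => (∀ n, 1 ≤ n → AnalyticOnNhd ℂ (f n) U) ∧
      ∃ C, 0 ≤ C ∧ ∀ n : ℕ, 1 ≤ n → ∀ s ∈ U, ‖f n s‖ ≤ C * (n : ℝ) ^ (-(z s).re)
  | M + 1, z, f => ∃ c, BddAnalytic U c ∧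
      Hol U M (fun s => z s + 1) (fun n s => f n s - c s * (n : ℂ) ^ (-z s))

variable {U V : Set E} {z w : E → ℂ} {f g : ℕ → E → ℂ} {M : ℕ}

theorem norm_natCast_cpow_neg {n : ℕ} (hn : 1 ≤ n) (a : ℂ) :
    ‖(n : ℂ) ^ (-a)‖ = (n : ℝ) ^ (-a.re) := by
  rw [Complex.norm_natCast_cpow_of_pos hn, Complex.neg_re]

theorem analyticOnNhd_natCast_cpow (hz : AnalyticOnNhd ℂ z U) {x : ℂ} (hx : x ≠ 0) :
    AnalyticOnNhd ℂ (fun s => x ^ (z s)) U := by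
  intro s hs
  simp only [Complex.cpow_def_of_ne_zero hx]
  exact (analyticAt_const.mul (hz s hs)).cexp

theorem analyticOnNhd_add_one (hz : AnalyticOnNhd ℂ z U) :
    AnalyticOnNhd ℂ (fun s => z s + 1) U := hz.add analyticOnNhd_const

namespace Hol

theorem mono (h : V ⊆ U) (hf : Hol U M z f) : Hol V M z f := by
  induction M generalizing z f with
  | zero =>
    obtain ⟨h1, C, h0, h2⟩ := hf
    exact ⟨fun n hn => (h1 n hn).mono h, C, h0, fun n hn s hs => h2 n hn s (h hs)⟩
  | succ M ih =>
    obtain ⟨c, hc, hf⟩ := hf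
    exact ⟨c, hc.mono h, ih hf⟩

theorem congr (hU : IsOpen U) (hf : Hol U M z f) (h : ∀ n, 1 ≤ n → ∀ s ∈ U, f n s = g n s) :
    Hol U M z g := by
  induction M generalizing z f g with
  | zero =>
    obtain ⟨h1, C, h0, h2⟩ := hf
    exact ⟨fun n hn => (h1 n hn).congr hU fun s hs => (h n hn s hs), C, h0, fun n hn s hs => by
      rw [← h n hn s hs]; exact h2 n hn s hs⟩
  | succ M ih =>
    obtain ⟨c, hc, hf⟩ := hf
    exact ⟨c, hc, ih hf fun n hn s hs => by rw [h n hn s hs]⟩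

theorem zero : Hol U M z fun _ _ => 0 := by
  induction M generalizing z with
  | zero => exact ⟨fun _ _ => analyticOnNhd_const, 0, le_rfl, fun n _ s _ => by simp⟩
  | succ M ih => exact ⟨fun _ => 0, .const 0, by simpa using ih⟩

theorem of_exponent_add_one (hf : Hol U M (fun s => z s + 1) f) : Hol U (M + 1) z f :=
  ⟨fun _ => 0, .const 0, by simpa using hf⟩

theorem of_succ (hz : AnalyticOnNhd ℂ z U) (hf : Hol U (M + 1) z f) : Hol U M z f := by
  induction M generalizing z f with
  | zero =>
    obtain ⟨c, hc, h1, C, h0, h2⟩ := hf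
    obtain ⟨D, h0', hD⟩ := hc.bounded
    refine ⟨fun n hn => ?_, C + D, by positivity, fun n hn s hs => ?_⟩
    · have := (h1 n hn).add (hc.analytic.mul (analyticOnNhd_natCast_cpow hz.neg
        (by exact_mod_cast (by omega : n ≠ 0) : (n : ℂ) ≠ 0)))
      convert this using 1
      funext s
      simp
    · have h3 := h2 n hn s hs
      have hn1 : (1 : ℝ) ≤ n := by exact_mod_cast hn
      calc ‖f n s‖ = ‖(f n s - c s * (n : ℂ) ^ (-z s)) + c s * (n : ℂ) ^ (-z s)‖ := by
            rw [sub_add_cancel]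
        _ ≤ C * (n : ℝ) ^ (-(z s + 1).re) + D * (n : ℝ) ^ (-(z s).re) := by
            refine (norm_add_le _ _).trans (add_le_add h3 ?_)
            rw [norm_mul, norm_natCast_cpow_neg hn]
            exact mul_le_mul_of_nonneg_right (hD s hs) (by positivity)
        _ ≤ C * (n : ℝ) ^ (-(z s).re) + D * (n : ℝ) ^ (-(z s).re) := by
            gcongr ?_ + _
            refine mul_le_mul_of_nonneg_left (Real.rpow_le_rpow_of_exponent_le hn1 ?_) h0
            simp
        _ = _ := by ring
  | succ M ih =>
    obtain ⟨c, hc, hf⟩ := hf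
    exact ⟨c, hc, ih (analyticOnNhd_add_one hz) hf⟩

theorem of_le (hz : AnalyticOnNhd ℂ z U) {M' : ℕ} (hM : M ≤ M') (hf : Hol U M' z f) :
    Hol U M z f := by
  induction M', hM using Nat.le_induction with
  | base => exact hf
  | succ M' _ ih => exact ih (hf.of_succ hz)

theorem analytic (hz : AnalyticOnNhd ℂ z U) (hf : Hol U M z f) {n : ℕ} (hn : 1 ≤ n) :
    AnalyticOnNhd ℂ (f n) U :=
  (hf.of_le hz (Nat.zero_le M)).1 n hn

theorem add (hf : Hol U M z f) (hg : Hol U M z g) : Hol U M z fun n s => f n s + g n s := by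
  induction M generalizing z f g with
  | zero =>
    obtain ⟨h1, C, h0, h2⟩ := hf
    obtain ⟨h1', C', h0', h2'⟩ := hg
    refine ⟨fun n hn => (h1 n hn).add (h1' n hn), C + C', by positivity, fun n hn s hs => ?_⟩
    rw [add_mul]
    exact (norm_add_le _ _).trans (add_le_add (h2 n hn s hs) (h2' n hn s hs))
  | succ M ih =>
    obtain ⟨c, hc, hf⟩ := hf
    obtain ⟨d, hd, hg⟩ := hg
    refine ⟨fun s => c s + d s, hc.add hd, ?_⟩
    convert ih hf hg using 3
    ring

theorem bdd_mul {d : E → ℂ} (hd : BddAnalytic U d) (hf : Hol U M z f) :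
    Hol U M z fun n s => d s * f n s := by
  induction M generalizing z f with
  | zero =>
    obtain ⟨h1, C, h0, h2⟩ := hf
    obtain ⟨D, h0', hD⟩ := hd.bounded
    refine ⟨fun n hn => hd.analytic.mul (h1 n hn), D * C, by positivity, fun n hn s hs => ?_⟩
    rw [norm_mul, mul_assoc]
    exact mul_le_mul (hD s hs) (h2 n hn s hs) (norm_nonneg _) h0'
  | succ M ih =>
    obtain ⟨c, hc, hf⟩ := hf
    refine ⟨fun s => d s * c s, hd.mul hc, ?_⟩
    convert ih hf using 3
    ring

theorem neg (hf : Hol U M z f) : Hol U M z fun n s => -f n s := by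
  simpa using hf.bdd_mul (.const (-1))

theorem sub (hf : Hol U M z f) (hg : Hol U M z g) : Hol U M z fun n s => f n s - g n s := by
  simpa only [sub_eq_add_neg] using hf.add hg.neg

theorem const_mul_cpow (hz : AnalyticOnNhd ℂ z U) {c : E → ℂ} (hc : BddAnalytic U c) :
    Hol U M z fun n s => c s * (n : ℂ) ^ (-z s) := by
  cases M with
  | zero =>
    obtain ⟨C, h0, hC⟩ := hc.bounded
    refine ⟨fun n hn => hc.analytic.mul (analyticOnNhd_natCast_cpow hz.neg
        (by exact_mod_cast (by omega : n ≠ 0) : (n : ℂ) ≠ 0)), C, h0, fun n hn s hs => ?_⟩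
    rw [norm_mul, norm_natCast_cpow_neg hn]
    exact mul_le_mul_of_nonneg_right (hC s hs) (by positivity)
  | succ M => exact ⟨c, hc, by simpa using zero⟩

/-- With leading coefficients `c, d`, the remainder is `c n ^ (-z) (g - d n ^ (-w)) + (f - c n ^
(-z)) g`; both summands have an exponent improved by one and order one less. -/
theorem mul (hz : AnalyticOnNhd ℂ z U) (hw : AnalyticOnNhd ℂ w U) (hU : IsOpen U)
    (hf : Hol U M z f) (hg : Hol U M w g) :
    Hol U M (fun s => z s + w s) fun n s => f n s * g n s := by
  induction M generalizing z w f g with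
  | zero =>
    obtain ⟨h1, C, h0, h2⟩ := hf
    obtain ⟨h1', C', h0', h2'⟩ := hg
    refine ⟨fun n hn => (h1 n hn).mul (h1' n hn), C * C', by positivity, fun n hn s hs => ?_⟩
    have hn0 : (0 : ℝ) < n := by exact_mod_cast hn
    rw [norm_mul, Complex.add_re, neg_add, Real.rpow_add hn0, mul_mul_mul_comm]
    exact mul_le_mul (h2 n hn s hs) (h2' n hn s hs) (norm_nonneg _) (by positivity)
  | succ M ih =>
    have hg' := hg.of_succ hw
    obtain ⟨c, hc, hf⟩ := hf
    obtain ⟨d, hd, hg⟩ := hg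
    refine ⟨fun s => c s * d s, hc.mul hd, ?_⟩
    have t1 := ih hz (analyticOnNhd_add_one hw) (const_mul_cpow hz hc) hg
    have t2 := ih (analyticOnNhd_add_one hz) hw hf hg'
    have e1 : (fun s => z s + (w s + 1)) = fun s => z s + w s + 1 := by funext s; ring
    have e2 : (fun s => (z s + 1) + w s) = fun s => z s + w s + 1 := by funext s; ring
    rw [e1] at t1
    rw [e2] at t2
    refine (t1.add t2).congr hU fun n hn s hs => ?_
    rw [neg_add, Complex.cpow_add _ _ (by exact_mod_cast (by omega : n ≠ 0))]
    ring

end Hol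

/-- Holomorphic families of sequences on `U` with an asymptotic expansion to all orders in the
powers `n ^ (-z s - m)`. -/
structure HolAll (U : Set E) (z : E → ℂ) (f : ℕ → E → ℂ) : Prop where
  exponent : BddAnalytic U z
  hol : ∀ M, Hol U M z f

namespace HolAll

theorem mono (h : V ⊆ U) (hf : HolAll U z f) : HolAll V z f :=
  ⟨hf.exponent.mono h, fun M => (hf.hol M).mono h⟩

theorem congr (hU : IsOpen U) (hf : HolAll U z f) (h : ∀ n, 1 ≤ n → ∀ s ∈ U, f n s = g n s) :
    HolAll U z g := ⟨hf.exponent, fun M => (hf.hol M).congr hU h⟩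

theorem add (hf : HolAll U z f) (hg : HolAll U z g) : HolAll U z fun n s => f n s + g n s :=
  ⟨hf.exponent, fun M => (hf.hol M).add (hg.hol M)⟩

theorem sub (hf : HolAll U z f) (hg : HolAll U z g) : HolAll U z fun n s => f n s - g n s :=
  ⟨hf.exponent, fun M => (hf.hol M).sub (hg.hol M)⟩

theorem bdd_mul {d : E → ℂ} (hd : BddAnalytic U d) (hf : HolAll U z f) :
    HolAll U z fun n s => d s * f n s :=
  ⟨hf.exponent, fun M => (hf.hol M).bdd_mul hd⟩

theorem mul (hU : IsOpen U) (hf : HolAll U z f) (hg : HolAll U w g) :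
    HolAll U (fun s => z s + w s) fun n s => f n s * g n s :=
  ⟨hf.exponent.add hg.exponent, fun M =>
    (hf.hol M).mul hf.exponent.analytic hg.exponent.analytic hU (hg.hol M)⟩

theorem const_mul_cpow (hz : BddAnalytic U z) {c : E → ℂ} (hc : BddAnalytic U c) :
    HolAll U z fun n s => c s * (n : ℂ) ^ (-z s) :=
  ⟨hz, fun _ => Hol.const_mul_cpow hz.analytic hc⟩

theorem of_exponent_add_one (hz : BddAnalytic U z) (hf : HolAll U (fun s => z s + 1) f) :
    HolAll U z f :=
  ⟨hz, fun M => (Hol.of_exponent_add_one (hf.hol M)).of_succ hz.analytic⟩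

theorem analytic (hf : HolAll U z f) {n : ℕ} (hn : 1 ≤ n) : AnalyticOnNhd ℂ (f n) U :=
  (hf.hol 0).1 n hn

/-- A priori the leading coefficient depends on the order of the expansion. Two choices `c, c'`
satisfy `|c' - c| * n ≤ const` for all `n`, so they agree, and a single remainder expands to all
orders. -/
theorem exists_leading (hU : IsOpen U) (hf : HolAll U z f) : ∃ c, BddAnalytic U c ∧
    HolAll U (fun s => z s + 1) fun n s => f n s - c s * (n : ℂ) ^ (-z s) := by
  obtain ⟨c, hc, -, C, h0, hC⟩ := hf.hol 1
  refine ⟨c, hc, hf.exponent.add (.const 1), fun M => ?_⟩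
  obtain ⟨c', hc', h'⟩ := hf.hol (M + 1)
  obtain ⟨-, C', h0', hC'⟩ := h'.of_le (analyticOnNhd_add_one hf.exponent.analytic) (Nat.zero_le M)
  refine h'.congr hU fun n _ s hs => ?_
  suffices h : c' s = c s by rw [h]
  have hb : ∀ n : ℕ, 1 ≤ n → ‖c' s - c s‖ * n ≤ C + C' := by
    intro n hn
    have hn0 : (0 : ℝ) < n := by exact_mod_cast hn
    have h3 := norm_sub_le (f n s - c s * (n : ℂ) ^ (-z s)) (f n s - c' s * (n : ℂ) ^ (-z s))
    have h4 := h3.trans (add_le_add (hC n hn s hs) (hC' n hn s hs))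
    simp only at h4
    rw [sub_sub_sub_cancel_left, ← sub_mul, norm_mul, norm_natCast_cpow_neg hn, ← add_mul,
      Complex.add_re, Complex.one_re, neg_add, Real.rpow_add hn0, Real.rpow_neg_one] at h4
    have hp : (0 : ℝ) < (n : ℝ) ^ (-(z s).re) := by positivity
    have h5 : (‖c' s - c s‖ * n) * ((n : ℝ) ^ (-(z s).re) * (n : ℝ)⁻¹)
        ≤ (C + C') * ((n : ℝ) ^ (-(z s).re) * (n : ℝ)⁻¹) := by
      refine (le_of_eq ?_).trans h4
      field_simp
    exact le_of_mul_le_mul_right h5 (by positivity)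
  by_contra hne
  have hpos : 0 < ‖c' s - c s‖ := norm_pos_iff.2 (sub_ne_zero.2 hne)
  obtain ⟨n, hn⟩ := exists_nat_gt ((C + C') / ‖c' s - c s‖)
  rw [div_lt_iff₀ hpos] at hn
  have h6 := hb (n + 1) (by omega)
  push_cast at h6
  nlinarith

end HolAll

theorem hol_of_expansion (hz : AnalyticOnNhd ℂ z U)
    {c : ℕ → E → ℂ} (hc : ∀ i, BddAnalytic U (c i))
    (hf : ∀ n, 1 ≤ n → AnalyticOnNhd ℂ (f n) U)
    (h : ∀ K : ℕ, ∃ C, 0 ≤ C ∧ ∀ n : ℕ, 1 ≤ n → ∀ s ∈ U,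
      ‖f n s - ∑ i ∈ Finset.range K, c i s * (n : ℂ) ^ (-z s - i)‖
        ≤ C * (n : ℝ) ^ (-(z s).re - K)) : Hol U M z f := by
  induction M generalizing z f c with
  | zero =>
    obtain ⟨C, h0, hC⟩ := h 0
    exact ⟨hf, C, h0, fun n hn s hs => by simpa using hC n hn s hs⟩
  | succ M ih =>
    refine ⟨c 0, hc 0, ih (c := fun i => c (i + 1)) (analyticOnNhd_add_one hz)
      (fun i => hc (i + 1)) (fun n hn => (hf n hn).sub ((hc 0).analytic.mul
        (analyticOnNhd_natCast_cpow hz.neg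
          (by exact_mod_cast (by omega : n ≠ 0) : (n : ℂ) ≠ 0)))) fun K => ?_⟩
    obtain ⟨C, h0, hC⟩ := h (K + 1)
    refine ⟨C, h0, fun n hn s hs => ?_⟩
    have h1 := hC n hn s hs
    rw [Finset.sum_range_succ'] at h1
    refine (le_of_eq ?_).trans (h1.trans (le_of_eq ?_))
    · congr 1
      have : ∀ i : ℕ, -z s - ((i + 1 : ℕ) : ℂ) = -(z s + 1) - i := fun i => by push_cast; ring
      simp only [this, Nat.cast_zero, sub_zero]
      ring
    · rw [Complex.add_re, Complex.one_re]
      push_cast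
      congr 2
      ring

theorem HolAll.of_expansion (hz : BddAnalytic U z) {c : ℕ → E → ℂ} (hc : ∀ i, BddAnalytic U (c i))
    (hf : ∀ n, 1 ≤ n → AnalyticOnNhd ℂ (f n) U)
    (h : ∀ K : ℕ, ∃ C, 0 ≤ C ∧ ∀ n : ℕ, 1 ≤ n → ∀ s ∈ U,
      ‖f n s - ∑ i ∈ Finset.range K, c i s * (n : ℂ) ^ (-z s - i)‖
        ≤ C * (n : ℝ) ^ (-(z s).re - K)) : HolAll U z f :=
  ⟨hz, fun _ => hol_of_expansion hz.analytic hc hf h⟩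

theorem holAll_natCast_add_cpow (hz : BddAnalytic U z) {V : ℝ} (hV : 0 ≤ V) :
    HolAll U z fun n s => (((n : ℝ) + V : ℝ) : ℂ) ^ (-z s) := by
  obtain ⟨R, hR, hRz⟩ := hz.bounded
  refine HolAll.of_expansion hz (c := fun i s => binomCoeff i (-z s) * (V : ℂ) ^ i)
    (fun i => ((hz.neg.comp_differentiable (differentiable_binomCoeff i)).mul (.const _)))
    (fun n hn => analyticOnNhd_natCast_cpow hz.analytic.neg ?_) fun K => ?_
  · have : (0 : ℝ) < n := by exact_mod_cast hn
    exact_mod_cast (by positivity : (n : ℝ) + V ≠ 0)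
  · obtain ⟨C, h0, hC⟩ := norm_natCast_add_cpow_sub_sum_le K hR hV
    exact ⟨C, h0, fun n hn s hs => by
      simpa using hC (-z s) (by simpa using hRz s hs) n hn⟩

theorem holAll_succ_cpow_sub (hz : BddAnalytic U z) :
    HolAll U (fun s => z s + 1) fun n s =>
      ((n + 1 : ℕ) : ℂ) ^ (1 - z s) - (n : ℂ) ^ (1 - z s) - (1 - z s) * (n : ℂ) ^ (-z s) := by
  have hw : BddAnalytic U fun s => 1 - z s := (BddAnalytic.const 1).sub hz
  obtain ⟨R, hR, hRz⟩ := hw.bounded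
  refine HolAll.of_expansion (hz.add (.const 1)) (c := fun i s => binomCoeff (i + 2) (1 - z s))
    (fun i => hw.comp_differentiable (differentiable_binomCoeff (i + 2)))
    (fun n hn => ?_) fun K => ?_
  · have hn0 : (n : ℂ) ≠ 0 := by exact_mod_cast (by omega : n ≠ 0)
    exact ((analyticOnNhd_natCast_cpow hw.analytic (Nat.cast_ne_zero.2 (Nat.succ_ne_zero n))).sub
      (analyticOnNhd_natCast_cpow hw.analytic hn0)).sub
      (hw.analytic.mul (analyticOnNhd_natCast_cpow hz.analytic.neg hn0))
  · obtain ⟨C, h0, hC⟩ := norm_natCast_add_cpow_sub_sum_le (K + 2) hR zero_le_one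
    refine ⟨C, h0, fun n hn s hs => ?_⟩
    have h1 := hC (1 - z s) (hRz s hs) n hn
    rw [Finset.sum_range_succ', Finset.sum_range_succ'] at h1
    refine (le_of_eq ?_).trans (h1.trans (le_of_eq ?_))
    · congr 1
      have : ∀ i : ℕ, 1 - z s - ((i + 1 + 1 : ℕ) : ℂ) = -(z s + 1) - i := fun i => by
        push_cast; ring
      have h3 : 1 - z s - ((0 + 1 : ℕ) : ℂ) = -z s := by push_cast; ring
      simp only [this, h3, Nat.cast_zero, sub_zero, Complex.ofReal_one, one_pow, mul_one,
        zero_add, binomCoeff_one]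
      simp only [binomCoeff]
      push_cast
      ring
    · congr 2
      simp only [Complex.sub_re, Complex.add_re, Complex.one_re]
      push_cast
      ring

end Families

end NestedZeta

namespace NestedZeta

/-! ### Regularized tails of holomorphic families. -/

section Families

variable {E : Type*} [NormedAddCommGroup E] [NormedSpace ℂ E]
variable {U V : Set E} {z w : E → ℂ} {f g : ℕ → E → ℂ} {M : ℕ}

/-- To leading order the difference of `n ^ (1 - z)` is `(z - 1) n ^ (-z)`, so `e = q * c` with `q *
(z - 1) = d` removes the leading term of `d * f`. The factor `d` replaces a division by `z - 1`,
which may vanish. -/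
theorem HolAll.exists_step (hU : IsOpen U) (hf : HolAll U z f) {d q : E → ℂ}
    (hd : BddAnalytic U d) (hq : BddAnalytic U q) (hdq : ∀ s ∈ U, q s * (z s - 1) = d s) :
    ∃ e, BddAnalytic U e ∧ HolAll U (fun s => z s + 1) fun n s =>
      d s * f n s - (e s * (n : ℂ) ^ (1 - z s) - e s * ((n + 1 : ℕ) : ℂ) ^ (1 - z s)) := by
  obtain ⟨c, hc, hf'⟩ := hf.exists_leading hU
  refine ⟨fun s => q s * c s, hq.mul hc, ?_⟩
  refine ((hf'.bdd_mul hd).add ((holAll_succ_cpow_sub hf.exponent).bdd_mul (hq.mul hc))).congr hU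
    fun n _ s hs => ?_
  rw [← hdq s hs]
  ring

/-- Uniform domination by `∑ 1 / m²` gives analyticity and the bound of order zero. For higher
orders the leading term is replaced by an explicit difference, whose tail telescopes to `e * n ^ (1
- z)`, and the tail of the remainder is handled by induction. -/
theorem Hol.tail (hU : IsOpen U) (hf : HolAll U z f) (hre : ∀ s ∈ U, 2 ≤ (z s).re) :
    Hol U M (fun s => z s - 1) fun n s => ∑' i, f (n + i) s := by
  have hbound : ∀ {z : E → ℂ} {f : ℕ → E → ℂ}, HolAll U z f → (∀ s ∈ U, 2 ≤ (z s).re) →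
      ∃ C, 0 ≤ C ∧ ∀ n : ℕ, 1 ≤ n → ∀ s ∈ U, Summable (fun i => f (n + i) s) ∧
        ‖∑' i, f (n + i) s‖ ≤ 2 * C * (n : ℝ) ^ (1 - (z s).re) ∧
        ∀ i, ‖f (n + i) s‖ ≤ C * (1 / ((n + i : ℕ) : ℝ) ^ 2) := by
    intro z f hf hre
    obtain ⟨-, C, h0, hC⟩ := hf.hol 0
    refine ⟨C, h0, fun n hn s hs => ?_⟩
    obtain ⟨h1, h2⟩ := summable_and_norm_tsum_le_of_norm_le_rpow (r := fun m => f m s) hn h0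
      (hre s hs) fun m hm => hC m (hn.trans hm) s hs
    refine ⟨h1, h2, fun i => (hC (n + i) (by omega) s hs).trans ?_⟩
    refine mul_le_mul_of_nonneg_left ?_ h0
    have h3 : (1 : ℝ) ≤ ((n + i : ℕ) : ℝ) := by exact_mod_cast (by omega : 1 ≤ n + i)
    calc _ ≤ ((n + i : ℕ) : ℝ) ^ (-2 : ℝ) :=
          Real.rpow_le_rpow_of_exponent_le h3 (by linarith [hre s hs])
      _ = _ := by rw [Real.rpow_neg (by positivity), one_div, Real.rpow_ofNat]
  induction M generalizing z f with
  | zero =>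
    obtain ⟨C, h0, hC⟩ := hbound hf hre
    refine ⟨fun n hn => ?_, 2 * C, by positivity, fun n hn s hs => ?_⟩
    · have hu : Summable fun i : ℕ => C * (1 / ((n + i : ℕ) : ℝ) ^ 2) := by
        have := (summable_nat_add_iff n).2 (Real.summable_one_div_nat_pow.2 (le_refl 2))
        simpa only [add_comm] using this.mul_left C
      exact analyticOnNhd_tsum hU hu (fun i => hf.analytic (by omega))
        fun i s hs => (hC n hn s hs).2.2 i
    · have := (hC n hn s hs).2.1
      rwa [Complex.sub_re, Complex.one_re, neg_sub]
  | succ M ih =>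
    have hz1 : BddAnalytic U fun s => (z s - 1)⁻¹ := by
      refine BddAnalytic.inv one_pos (hf.exponent.sub (.const 1)) fun s hs => ?_
      refine le_trans ?_ (Complex.re_le_norm _)
      rw [Complex.sub_re, Complex.one_re]
      linarith [hre s hs]
    obtain ⟨e, he, hr⟩ := hf.exists_step hU (.const 1) hz1 fun s hs => by
      refine inv_mul_cancel₀ fun h => ?_
      have h2 := hre s hs
      rw [sub_eq_zero.1 h, Complex.one_re] at h2
      norm_num at h2
    have hre' : ∀ s ∈ U, 2 ≤ (z s + 1).re := fun s hs => by
      rw [Complex.add_re, Complex.one_re]; linarith [hre s hs]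
    have hr' := ih hr hre'
    obtain ⟨_, -, hCf⟩ := hbound hf hre
    obtain ⟨_, -, hCr⟩ := hbound hr hre'
    refine ⟨e, he, ?_⟩
    have hexp : (fun s => z s - 1 + 1) = fun s => z s + 1 - 1 := by funext s; ring
    rw [hexp]
    refine hr'.congr hU fun n hn s hs => ?_
    have h1 := (hCf n hn s hs).1
    have h2 := (hCr n hn s hs).1
    set F : ℕ → ℂ := fun m => e s * (m : ℂ) ^ (1 - z s) with hF
    have h3 := (h1.hasSum.sub h2.hasSum).tendsto_sum_nat
    have h4 : ∀ K : ℕ, ∑ i ∈ Finset.range K, (f (n + i) s - (1 * f (n + i) s - (F (n + i)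
        - F (n + i + 1)))) = F n - F (n + K) := by
      intro K
      induction K with
      | zero => simp
      | succ K ihK => rw [Finset.sum_range_succ, ihK, ← add_assoc]; ring
    -- The far end of the telescoping sum disappears because `Re (1 - z) < 0`.
    have hF0 : Tendsto (fun K : ℕ => F (n + K)) atTop (𝓝 0) := by
      have h5 : Tendsto F atTop (𝓝 0) := by
        rw [hF, ← mul_zero (e s)]
        refine Tendsto.const_mul _ ?_
        rw [tendsto_zero_iff_norm_tendsto_zero]
        have h6 : 0 < (z s).re - 1 := by linarith [hre s hs]
        refine ((tendsto_rpow_neg_atTop h6).comp tendsto_natCast_atTop_atTop).congr' ?_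
        filter_upwards [eventually_ge_atTop 1] with m hm
        rw [Complex.norm_natCast_cpow_of_pos hm, Function.comp_apply, Complex.sub_re,
          Complex.one_re, neg_sub]
      have := h5.comp (tendsto_add_atTop_nat n)
      exact this.congr fun K => by simp [add_comm]
    have h7 := tendsto_nhds_unique h3 ((tendsto_const_nhds (x := F n)).sub hF0 |>.congr
      fun K => (h4 K).symm)
    rw [neg_sub]
    simp only [hF] at h7
    linear_combination -h7

theorem HolAll.tail (hU : IsOpen U) (hf : HolAll U z f) (hre : ∀ s ∈ U, 2 ≤ (z s).re) :
    HolAll U (fun s => z s - 1) fun n s => ∑' i, f (n + i) s :=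
  ⟨hf.exponent.sub (.const 1), fun _ => Hol.tail hU hf hre⟩

/-- Removing the leading term `N₀` times, at the cost of a factor `d` each time, raises the exponent
to real part at least 2, where the convergent tail is available. -/
theorem HolAll.exists_telescoping (hU : IsOpen U) {d : E → ℂ} (hd : BddAnalytic U d) (N₀ : ℕ)
    (hf : HolAll U z f)
    (hq : ∀ i < N₀, ∃ q, BddAnalytic U q ∧ ∀ s ∈ U, q s * (z s + i - 1) = d s)
    (hre : ∀ s ∈ U, 2 ≤ (z s).re + N₀) :
    ∃ t, HolAll U (fun s => z s - 1) t ∧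
      ∀ n, 1 ≤ n → ∀ s ∈ U, t n s - t (n + 1) s = d s ^ N₀ * f n s := by
  induction N₀ generalizing z f with
  | zero =>
    have hre' : ∀ s ∈ U, 2 ≤ (z s).re := fun s hs => by simpa using hre s hs
    refine ⟨_, hf.tail hU hre', fun n hn s hs => ?_⟩
    obtain ⟨-, C, h0, hC⟩ := hf.hol 0
    rw [pow_zero, one_mul]
    exact tsum_sub_tsum_succ (r := fun m => f m s)
      (summable_and_norm_tsum_le_of_norm_le_rpow (r := fun m => f m s) hn h0
        (hre' s hs) fun m hm => hC m (hn.trans hm) s hs).1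
  | succ N₀ ih =>
    obtain ⟨q, hq0, hqz⟩ := hq 0 (Nat.succ_pos _)
    obtain ⟨e, he, hg⟩ := hf.exists_step hU hd hq0 fun s hs => by
      rw [← hqz s hs, Nat.cast_zero, add_zero]
    obtain ⟨t, ht, htel⟩ := ih hg
      (fun i hi => by
        obtain ⟨q, hq1, hq2⟩ := hq (i + 1) (by omega)
        refine ⟨q, hq1, fun s hs => ?_⟩
        rw [← hq2 s hs]
        push_cast
        ring)
      (fun s hs => by
        have := hre s hs
        push_cast at this
        rw [Complex.add_re, Complex.one_re]
        linarith)
    have hz' : BddAnalytic U fun s => z s - 1 := hf.exponent.sub (.const 1)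
    have ht' : HolAll U (fun s => z s - 1) t := by
      refine HolAll.of_exponent_add_one hz' ?_
      convert ht using 2
      ring
    refine ⟨_, ht'.add ((HolAll.const_mul_cpow hz' he).bdd_mul (hd.pow N₀)), fun n hn s hs => ?_⟩
    have h1 := htel n hn s hs
    simp only [neg_sub]
    linear_combination h1

/-- The possible denominators are `z + i - 1` for `i < N₀`. If one of them vanishes at `s₀`, it
equals `z - z s₀`, and `δ` is a power of it; otherwise `δ = 1`. All other denominators stay away
from zero on a small neighbourhood. -/
theorem HolAll.exists_local_telescoping (hU : IsOpen U) {s₀ : E} (hs₀ : s₀ ∈ U)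
    (hf : HolAll U z f) : ∃ V ⊆ U, IsOpen V ∧ s₀ ∈ V ∧ ∃ δ, BddAnalytic V δ ∧
      (∀ s ∈ V, δ s ≠ 0 ↔ 0 ∉ down (1 - z s)) ∧ ∃ t, HolAll V (fun s => z s - 1) t ∧
      ∀ n, 1 ≤ n → ∀ s ∈ V, t n s - t (n + 1) s = δ s * f n s := by
  classical
  -- Comparing with `3` instead of `2` leaves room for the variation of `z` near `s₀`; the maximum
  -- with `0` gives `N₀ > 0`, so that `d ^ N₀` vanishes where `d` does.
  obtain ⟨N₀, hN₀⟩ := exists_nat_gt (max 0 (3 - (z s₀).re))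
  have hN1 : 0 < N₀ := by exact_mod_cast (le_max_left _ _).trans_lt hN₀
  have hN2 : 3 - (z s₀).re < N₀ := (le_max_right _ _).trans_lt hN₀
  have hcont : ContinuousAt z s₀ := (hf.exponent.analytic s₀ hs₀).continuousAt
  have hev1 : ∀ᶠ s in 𝓝 s₀, ‖z s - z s₀‖ < 1 / 2 := by
    have : Tendsto (fun s => ‖z s - z s₀‖) (𝓝 s₀) (𝓝 0) := by
      simpa using (hcont.sub_const (z s₀)).norm
    exact this.eventually_lt_const (by norm_num)
  have hev2 : ∀ᶠ s in 𝓝 s₀, ∀ i ∈ Finset.range N₀,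
      z s₀ + i - 1 ≠ 0 → ‖z s₀ + i - 1‖ / 2 ≤ ‖z s + i - 1‖ := by
    rw [Finset.eventually_all]
    intro i _
    by_cases hi : z s₀ + i - 1 = 0
    · exact Eventually.of_forall fun s h => absurd hi h
    · have hp : 0 < ‖z s₀ + i - 1‖ := norm_pos_iff.2 hi
      have : Tendsto (fun s => ‖z s + i - 1‖) (𝓝 s₀) (𝓝 ‖z s₀ + i - 1‖) :=
        ((hcont.add_const (i : ℂ)).sub_const 1).norm
      filter_upwards [this.eventually_const_lt (half_lt_self hp)] with s hs _ using hs.le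
  obtain ⟨V, hV, hVo, hsV⟩ := eventually_nhds_iff.1 (hev1.and (hev2.and (hU.mem_nhds hs₀)))
  have hVU : V ⊆ U := fun s hs => (hV s hs).2.2
  have hfV := hf.mono hVU
  have hre : ∀ s ∈ V, 2 < (z s).re + N₀ := by
    intro s hs
    have h1 := (hV s hs).1
    have h2 := Complex.abs_re_le_norm (z s - z s₀)
    rw [Complex.sub_re] at h2
    have h3 := (abs_le.1 (h2.trans h1.le)).1
    linarith
  have hinv : ∀ i < N₀, z s₀ + i - 1 ≠ 0 → BddAnalytic V fun s => (z s + i - 1)⁻¹ :=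
    fun i hi h => BddAnalytic.inv (half_pos (norm_pos_iff.2 h))
      ((hfV.exponent.add (.const _)).sub (.const 1))
      fun s hs => (hV s hs).2.1 i (Finset.mem_range.2 hi) h
  have hne : ∀ i < N₀, z s₀ + i - 1 ≠ 0 → ∀ s ∈ V, z s + i - 1 ≠ 0 := by
    intro i hi h s hs h0
    have h1 := (hV s hs).2.1 i (Finset.mem_range.2 hi) h
    rw [h0, norm_zero] at h1
    linarith [norm_pos_iff.2 h]
  have hq : ∀ d, BddAnalytic V d → (∀ i < N₀, z s₀ + i - 1 = 0 → ∀ s ∈ V, d s = z s - z s₀) →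
      ∀ i < N₀, ∃ q, BddAnalytic V q ∧ ∀ s ∈ V, q s * (z s + i - 1) = d s := by
    intro d hd hd' i hi
    by_cases h : z s₀ + i - 1 = 0
    · refine ⟨_, .const 1, fun s hs => ?_⟩
      rw [hd' i hi h s hs]
      linear_combination h
    · refine ⟨_, hd.mul (hinv i hi h), fun s hs => ?_⟩
      rw [mul_assoc, inv_mul_cancel₀ (hne i hi h s hs), mul_one]
  refine ⟨V, hVU, hVo, hsV, ?_⟩
  by_cases hpol : (0 : ℂ) ∈ down (1 - z s₀)
  · have hd : BddAnalytic V fun s => z s - z s₀ := hfV.exponent.sub (.const _)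
    obtain ⟨t, ht, htel⟩ := hfV.exists_telescoping hVo hd N₀ (hq _ hd fun _ _ _ _ _ => rfl)
      fun s hs => (hre s hs).le
    refine ⟨_, hd.pow N₀, fun s hs => ?_, t, ht, htel⟩
    rw [not_iff_not.symm]
    simp only [ne_eq, not_not]
    rw [pow_eq_zero_iff hN1.ne']
    obtain ⟨m₀, hm₀⟩ := hpol
    constructor
    · intro h
      exact ⟨m₀, by linear_combination hm₀ + h⟩
    · rintro ⟨m, hm⟩
      -- Two resonant values of `z` differ by an integer; being less than `1 / 2` apart, they
      -- coincide.
      have h1 : z s - z s₀ = ((m₀ - m : ℤ) : ℂ) := by push_cast; linear_combination hm - hm₀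
      have h2 := (hV s hs).1
      rw [h1, Complex.norm_intCast] at h2
      have h3 : |(m₀ - m : ℤ)| < 1 := by
        have : ((|(m₀ - m : ℤ)| : ℤ) : ℝ) < 1 := by push_cast at h2 ⊢; linarith
        exact_mod_cast this
      rw [h1, Int.abs_lt_one_iff.1 h3, Int.cast_zero]
  · obtain ⟨t, ht, htel⟩ := hfV.exists_telescoping hVo (.const 1) N₀
      (hq _ (.const 1) fun i _ h => absurd ⟨i, by linear_combination h⟩ hpol)
      fun s hs => (hre s hs).le
    refine ⟨_, (BddAnalytic.const 1).pow N₀, fun s hs => ?_, t, ht, htel⟩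
    simp only [one_pow, ne_eq, one_ne_zero, not_false_eq_true, true_iff]
    rintro ⟨m, hm⟩
    -- Resonances with `m < N₀` are excluded by the choice of neighbourhood, those with `m ≥ N₀` by
    -- the real part of `z`.
    rcases lt_or_ge m N₀ with h | h
    · refine hne m h (fun h0 => hpol ⟨m, by linear_combination h0⟩) s hs (by linear_combination hm)
    · have h1 := congrArg Complex.re hm
      simp only [Complex.zero_re, Complex.sub_re, Complex.one_re, Complex.natCast_re] at h1
      have h2 : (N₀ : ℝ) ≤ m := by exact_mod_cast h
      linarith [hre s hs]

open Asymptotics in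
theorem Hol.exists_logPowSpan (hf : Hol U M z f) {s : E} (hs : s ∈ U) :
    ∃ g ∈ logPowSpan (down (-z s)),
      ((fun n => f n s) - g) =O[atTop] fun n : ℕ => (n : ℝ) ^ (-(z s).re - M) := by
  induction M generalizing z f with
  | zero =>
    obtain ⟨-, C, -, hC⟩ := hf
    refine ⟨0, Submodule.zero_mem _, IsBigO.of_bound C ?_⟩
    filter_upwards [eventually_ge_atTop 1] with n hn
    rw [Real.norm_of_nonneg (by positivity)]
    simpa using hC n hn s hs
  | succ M ih =>
    obtain ⟨c, -, hf⟩ := hf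
    obtain ⟨g, hg, h⟩ := ih hf
    refine ⟨c s • logPow (-z s) 0 + g, Submodule.add_mem _ (Submodule.smul_mem _ _
      (logPow_mem_logPowSpan (self_mem_down _) 0)) (logPowSpan_mono ?_ hg), ?_⟩
    · exact down_subset_of_mem ⟨1, by push_cast; ring⟩
    · refine h.congr (fun n => ?_) fun n => ?_
      · simp only [Pi.sub_apply, Pi.add_apply, Pi.smul_apply, logPow, smul_eq_mul]
        ring
      · rw [Complex.add_re, Complex.one_re]
        push_cast
        congr 1
        ring

open Asymptotics in
theorem HolAll.mem_asymp (hf : HolAll U z f) {s : E} (hs : s ∈ U) :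
    (fun n => f n s) ∈ Asymp (down (-z s)) := by
  intro M
  obtain ⟨K, hK⟩ := exists_nat_gt ((M : ℝ) - (z s).re)
  obtain ⟨g, hg, h⟩ := (hf.hol K).exists_logPowSpan hs
  refine ⟨g, hg, h.trans (IsBigO.of_bound 1 ?_)⟩
  filter_upwards [eventually_ge_atTop 1] with n hn
  rw [one_mul, Real.norm_of_nonneg (by positivity), Real.norm_of_nonneg (by positivity)]
  exact Real.rpow_le_rpow_of_exponent_le (by exact_mod_cast hn) (by linarith)

end Families

end NestedZeta

namespace NestedZeta

/-! ### Abel summation and the local structure of nested sums. -/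

section LocalExpansion

theorem nest_smul_head (c : Version) (δ : ℂ) (f : ℕ → ℂ) (fs : List (ℕ → ℂ)) (N : ℕ) :
    nest c ((fun n => δ * f n) :: fs) N = δ * nest c (f :: fs) N := by
  simp only [nest_cons, Finset.mul_sum, mul_assoc]

/-- The position at which a tail of the outermost sum is evaluated. -/
def Version.tailIndex : Version → ℕ → ℕ
  | .strict, n => n + 1
  | .weak, n => n

/-- Abel summation: for a fixed second index `n`, the outermost index runs from `c.tailIndex n` to
`N`, and `f` telescopes over that range to `t (c.tailIndex n) - t (N + 1)`. -/
theorem nest_cons_cons_of_telescoping (c : Version) {t f : ℕ → ℂ}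
    (h : ∀ n, 1 ≤ n → t n - t (n + 1) = f n) (g : ℕ → ℂ) (fs : List (ℕ → ℂ)) (N : ℕ) :
    nest c (f :: g :: fs) N =
      nest c ((fun n => g n * t (c.tailIndex n)) :: fs) N - t (N + 1) * nest c (g :: fs) N := by
  induction N with
  | zero => simp [nest_cons_zero]
  | succ N ih =>
    rw [nest_cons_succ, ih, nest_cons_succ c _ fs, ← h (N + 1) (by omega)]
    have e := nest_cons_succ c g fs N
    cases c with
    | strict =>
      simp only [Version.pred, Version.tailIndex, Nat.add_sub_cancel] at e ⊢
      rw [e]; ring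
    | weak =>
      simp only [Version.pred, Version.tailIndex] at e ⊢
      rw [e]; ring

variable {E : Type*} [NormedAddCommGroup E] [NormedSpace ℂ E]

theorem HolAll.forall₂_mono {U V : Set E} (h : V ⊆ U) {zs : List (E → ℂ)} {fs : List (ℕ → E → ℂ)}
    (hf : List.Forall₂ (HolAll U) zs fs) : List.Forall₂ (HolAll V) zs fs :=
  hf.imp fun _ _ h' => h'.mono h

theorem HolAll.forall₂_mem_asymp {U : Set E} {zs : List (E → ℂ)} {fs : List (ℕ → E → ℂ)}
    (hf : List.Forall₂ (HolAll U) zs fs) {s : E} (hs : s ∈ U) :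
    List.Forall₂ (fun z f => f ∈ Asymp (down (-z))) (zs.map (· s))
      (fs.map fun f n => f n s) := by
  induction hf with
  | nil => exact .nil
  | cons h _ ih => exact .cons (h.mem_asymp hs) ih

/-- Induction on the depth by Abel summation. Each step contributes a factor `δ` detecting the
resonance of one partial sum of the exponents, and for a single remaining letter the constant is `t
1`. -/
theorem exists_local_nest_cons (c : Version) {s₀ : E} {zs : List (E → ℂ)}
    {fs : List (ℕ → E → ℂ)} {U : Set E} (hU : IsOpen U) (hs₀ : s₀ ∈ U) {z : E → ℂ}
    {f : ℕ → E → ℂ} (hf : HolAll U z f) (hfs : List.Forall₂ (HolAll U) zs fs) :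
    ∃ V ⊆ U, IsOpen V ∧ s₀ ∈ V ∧ ∃ D Z : E → ℂ, AnalyticOnNhd ℂ D V ∧ AnalyticOnNhd ℂ Z V ∧
      ∀ s ∈ V, (D s ≠ 0 ↔ 0 ∉ expo ((z :: zs).map (· s))) ∧
        (fun N => D s * nest c ((f :: fs).map fun f n => f n s) N - Z s) ∈
          Asymp (expo ((z :: zs).map (· s))) := by
  induction zs generalizing z f fs U with
  | nil =>
    cases hfs
    obtain ⟨V, hVU, hVo, hsV, δ, hδ, hδ0, t, ht, htel⟩ := hf.exists_local_telescoping hU hs₀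
    refine ⟨V, hVU, hVo, hsV, δ, t 1, hδ.analytic, ht.analytic le_rfl, fun s hs => ⟨?_, ?_⟩⟩
    · rw [hδ0 s hs]
      simp [expo]
    · have h1 := ht.mem_asymp hs
      have h2 := (hf.mono hVU).mem_asymp hs
      rw [neg_sub] at h1
      have hsub : down (-z s) ⊆ down (1 - z s) := down_subset_of_mem ⟨1, by push_cast; ring⟩
      have h3 := Submodule.sub_mem _ (Submodule.smul_mem _ (δ s) (asymp_mono hsub h2)) h1
      have hX : down (1 - z s) ⊆ expo (([z]).map (· s)) := fun x hx => Or.inl hx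
      refine Asymp.congr (asymp_mono hX h3) ?_
      filter_upwards [eventually_ge_atTop 1] with N hN
      have h4 : δ s * nest c (([f]).map fun f n => f n s) N = t 1 s - t (N + 1) s := by
        rw [← sum_Icc_bdiff (fun n => t n s), List.map_cons, List.map_nil, nest_cons,
          Finset.mul_sum]
        refine Finset.sum_congr rfl fun n hn => ?_
        rw [nest_nil, mul_one, ← htel n (Finset.mem_Icc.1 hn).1 s hs]
        rfl
      rw [h4]
      simp only [Pi.sub_apply, Pi.smul_apply, smul_eq_mul]
      rw [← htel N hN s hs]
      ring
  | cons w zs ih =>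
    rcases hfs with _ | ⟨hg, hgs⟩
    rename_i g gs
    obtain ⟨V, hVU, hVo, hsV, δ, hδ, hδ0, t, ht, htel⟩ := hf.exists_local_telescoping hU hs₀
    have hfV := hf.mono hVU
    have hgV := hg.mono hVU
    have ht1 : HolAll V (fun s => z s - 1) fun n s => t (n + 1) s := by
      have h1 : HolAll V (fun s => z s - 1) f := by
        refine HolAll.of_exponent_add_one ht.exponent ?_
        simpa only [sub_add_cancel] using hfV
      -- The shifted family is `t (n + 1) = t n - δ f n`, so its expansion comes for free.
      refine (ht.sub (h1.bdd_mul hδ)).congr hVo fun n hn s hs => ?_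
      rw [← htel n hn s hs]; ring
    have htc : HolAll V (fun s => z s - 1) fun n s => t (c.tailIndex n) s := by
      cases c with
      | strict => exact ht1
      | weak => exact ht
    have hg' : HolAll V (fun s => z s + w s - 1) fun n s => g n s * t (c.tailIndex n) s := by
      have := hgV.mul hVo htc
      convert this using 2
      ring
    obtain ⟨W, hWV, hWo, hsW, D, Z, hD, hZ, h⟩ := ih hVo hsV hg' (HolAll.forall₂_mono hVU hgs)
    refine ⟨W, hWV.trans hVU, hWo, hsW, fun s => δ s * D s, Z, (hδ.mono hWV).analytic.mul hD, hZ,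
      fun s hs => ?_⟩
    obtain ⟨hs1, hs2⟩ := h s hs
    simp only [List.map_cons] at hs1 hs2 ⊢
    rw [expo_cons_cons]
    constructor
    · rw [mul_ne_zero_iff, hδ0 s (hWV hs), hs1, Set.mem_union, not_or]
    · have hall : List.Forall₂ (HolAll V) (w :: zs) (g :: gs) :=
        .cons hgV (HolAll.forall₂_mono hVU hgs)
      -- The boundary term `t (N + 1) * nest c (g :: gs) N` needs only the expansion at this fixed
      -- `s`; it adds no constant outside the exponents in `expo`, so `Z` is unaffected.
      obtain ⟨a, ha, -⟩ := exists_nest_sub_const_mem_asymp c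
        (HolAll.forall₂_mem_asymp hall (hWV hs))
      have h1 := ht1.mem_asymp (hWV hs)
      rw [neg_sub] at h1
      have h2 := mul_nest_mem_asymp h1 ha
      simp only [List.map_cons] at h2
      rw [expo_cons_cons] at h2
      have h3 := Submodule.sub_mem _ (asymp_mono Set.subset_union_right hs2)
        (Submodule.smul_mem _ (D s) h2)
      convert h3 using 1
      funext N
      have h4 := nest_cons_cons_of_telescoping c (t := fun n => t n s)
        (f := fun n => δ s * f n s) (fun n hn => htel n hn s (hWV hs)) (fun n => g n s)
        (gs.map fun f n => f n s) N
      rw [nest_smul_head] at h4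
      simp only [Pi.sub_apply, Pi.mul_apply, Pi.smul_apply, smul_eq_mul]
      linear_combination D s * h4

/-- Near every point, the nested sum of a holomorphic family, multiplied by an analytic function
`D` that vanishes exactly at the points with a resonance, is a constant term `Z` depending
analytically on the parameters plus terms of the expected exponents. -/
theorem exists_local_nest (c : Version) {s₀ : E} {zs : List (E → ℂ)}
    {fs : List (ℕ → E → ℂ)} {U : Set E} (hU : IsOpen U) (hs₀ : s₀ ∈ U)
    (hfs : List.Forall₂ (HolAll U) zs fs) :
    ∃ V ⊆ U, IsOpen V ∧ s₀ ∈ V ∧ ∃ D Z : E → ℂ, AnalyticOnNhd ℂ D V ∧ AnalyticOnNhd ℂ Z V ∧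
      ∀ s ∈ V, (D s ≠ 0 ↔ 0 ∉ expo (zs.map (· s))) ∧
        (fun N => D s * nest c (fs.map fun f n => f n s) N - Z s) ∈ Asymp (expo (zs.map (· s))) := by
  cases hfs with
  | nil =>
    refine ⟨U, subset_rfl, hU, hs₀, fun _ => 1, fun _ => 1, analyticOnNhd_const,
      analyticOnNhd_const, fun s _ => ⟨by simp [expo], ?_⟩⟩
    convert Submodule.zero_mem _ using 1
    funext N
    simp [nest_nil]
  | cons hf hfs => exact exists_local_nest_cons c hU hs₀ hf hfs

theorem finitePart_nest_eq_div {c : Version} {zs : List ℂ} {fs : List (ℕ → ℂ)} {D Z : ℂ}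
    (hD : D ≠ 0) (h0 : 0 ∉ expo zs)
    (h : (fun N => D * nest c fs N - Z) ∈ Asymp (expo zs)) :
    finitePart (nest c fs) = Z / D := by
  have h1 : (nest c fs - fun _ => Z / D) ∈ Asymp (expo zs) := by
    convert Submodule.smul_mem _ D⁻¹ h using 1
    funext N
    simp only [Pi.sub_apply, Pi.smul_apply, smul_eq_mul]
    field_simp
  obtain ⟨a, ha, ha'⟩ := hasFinitePart_of_sub_mem_asymp h1
  rw [ha.finitePart_eq, ha' h0]

end LocalExpansion

end NestedZeta

namespace NestedZeta

/-! ### Truncated sums as recursive nested sums. -/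

section TruncatedSums

theorem isChain_cons (c : Version) {k : ℕ} (a : ℕ) (m : Fin k → ℕ) :
    IsChain c (Fin.cons a m : Fin (k + 1) → ℕ) ↔
      1 ≤ a ∧ IsChain c m ∧ ∀ i, m i ≤ c.pred a := by
  cases c with
  | strict =>
    simp only [IsChain, Fin.forall_fin_succ, Fin.cons_zero, Fin.cons_succ, Version.pred]
    constructor
    · rintro ⟨⟨ha, hm⟩, h⟩
      refine ⟨ha, ⟨hm, fun i j hij => ?_⟩, fun i => ?_⟩
      · simpa using h (Fin.succ_lt_succ_iff.2 hij)
      · have := h (Fin.succ_pos i)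
        simp only [Fin.cons_zero, Fin.cons_succ] at this
        omega
    · rintro ⟨ha, ⟨hm, h⟩, h'⟩
      refine ⟨⟨ha, hm⟩, fun i j hij => ?_⟩
      induction j using Fin.cases with
      | zero => exact absurd hij (Fin.not_lt_zero i)
      | succ j =>
        induction i using Fin.cases with
        | zero =>
          have := h' j
          simp only [Fin.cons_zero, Fin.cons_succ]
          omega
        | succ i => simpa using h (Fin.succ_lt_succ_iff.1 hij)
  | weak =>
    simp only [IsChain, Fin.forall_fin_succ, Fin.cons_zero, Fin.cons_succ, Version.pred]
    constructor
    · rintro ⟨⟨ha, hm⟩, h⟩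
      refine ⟨ha, ⟨hm, fun i j hij => ?_⟩, fun i => ?_⟩
      · simpa using h (Fin.succ_le_succ_iff.2 hij)
      · simpa using h (Fin.zero_le i.succ)
    · rintro ⟨ha, ⟨hm, h⟩, h'⟩
      refine ⟨⟨ha, hm⟩, fun i j hij => ?_⟩
      induction j using Fin.cases with
      | zero => rw [Fin.le_zero_iff.1 hij]
      | succ j =>
        induction i using Fin.cases with
        | zero => simpa using h' j
        | succ i => simpa using h (Fin.succ_le_succ_iff.1 hij)

theorem Version.pred_le (c : Version) (n : ℕ) : c.pred n ≤ n := by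
  cases c <;> simp [Version.pred]

theorem truncSum_eq_nest (c : Version) {k : ℕ} (f : Fin k → ℝ → ℂ) (N : ℕ) :
    truncSum c f N = nest c (List.ofFn fun i (n : ℕ) => f i (n : ℝ)) N := by
  classical
  induction k generalizing N with
  | zero =>
    rw [List.ofFn_zero, nest_nil, truncSum, Finset.filter_true_of_mem]
    · simp
    · intro n _
      cases c
      · exact ⟨fun i => i.elim0, fun i => i.elim0⟩
      · exact ⟨fun i => i.elim0, fun i => i.elim0⟩
  | succ k ih =>
    rw [List.ofFn_succ, nest_cons]
    simp only [← ih]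
    simp only [truncSum, Finset.mul_sum]
    rw [Finset.sum_sigma']
    refine Finset.sum_nbij' (fun n => ⟨n 0, Fin.tail n⟩) (fun q => Fin.cons q.1 q.2) ?_ ?_ ?_ ?_ ?_
    · intro n hn
      simp only [Finset.mem_filter, Fintype.mem_piFinset, Finset.mem_Icc, Finset.mem_sigma] at hn ⊢
      obtain ⟨h1, h2⟩ := hn
      rw [← Fin.cons_self_tail n, isChain_cons] at h2
      exact ⟨h1 0, fun i => ⟨(h1 i.succ).1, h2.2.2 i⟩, h2.2.1⟩
    · rintro ⟨a, m⟩ hq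
      simp only [Finset.mem_filter, Fintype.mem_piFinset, Finset.mem_Icc, Finset.mem_sigma] at hq ⊢
      obtain ⟨h1, h2, h3⟩ := hq
      refine ⟨fun i => ?_, (isChain_cons c a m).2 ⟨h1.1, h3, fun i => (h2 i).2⟩⟩
      induction i using Fin.cases with
      | zero => simpa using h1
      | succ i =>
        simp only [Fin.cons_succ]
        exact ⟨(h2 i).1, (h2 i).2.trans ((c.pred_le a).trans h1.2)⟩
    · intro n _
      exact Fin.cons_self_tail n
    · rintro ⟨a, m⟩ _
      simp
    · intro n _
      rw [Fin.prod_univ_succ]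
      rfl

end TruncatedSums

/-! ### The quasi-shuffle product of truncated nested sums. -/

section QuasiShuffle

variable {M : Type*}

/-- The sum of `Φ` over the quasi-shuffle product of two words, where merging two letters is
weighted by `ε`. -/
def quasiShuffleSum [Mul M] (ε : ℂ) : List M → List M → (List M → ℂ) → ℂ
  | [], v, Φ => Φ v
  | a :: u, [], Φ => Φ (a :: u)
  | a :: u, b :: v, Φ =>
    quasiShuffleSum ε u (b :: v) (fun w => Φ (a :: w)) +
      quasiShuffleSum ε (a :: u) v (fun w => Φ (b :: w)) +
      ε * quasiShuffleSum ε u v (fun w => Φ (a * b :: w))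
termination_by u v => u.length + v.length

theorem quasiShuffleSum_nil_left [Mul M] (ε : ℂ) (v : List M) (Φ : List M → ℂ) :
    quasiShuffleSum ε [] v Φ = Φ v := by rw [quasiShuffleSum]

theorem quasiShuffleSum_nil_right [Mul M] (ε : ℂ) (u : List M) (Φ : List M → ℂ) :
    quasiShuffleSum ε u [] Φ = Φ u := by cases u <;> rw [quasiShuffleSum]

theorem quasiShuffleSum_cons_cons [Mul M] (ε : ℂ) (a b : M) (u v : List M) (Φ : List M → ℂ) :
    quasiShuffleSum ε (a :: u) (b :: v) Φ =
      quasiShuffleSum ε u (b :: v) (fun w => Φ (a :: w)) +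
        quasiShuffleSum ε (a :: u) v (fun w => Φ (b :: w)) +
        ε * quasiShuffleSum ε u v (fun w => Φ (a * b :: w)) := by rw [quasiShuffleSum]

theorem quasiShuffleSum_add_mul [Mul M] (ε x : ℂ) (u v : List M) (Φ Ψ : List M → ℂ) :
    quasiShuffleSum ε u v (fun w => Φ w + x * Ψ w) =
      quasiShuffleSum ε u v Φ + x * quasiShuffleSum ε u v Ψ := by
  induction u generalizing v Φ Ψ with
  | nil => simp only [quasiShuffleSum_nil_left]
  | cons a u ihu =>
    induction v generalizing Φ Ψ with
    | nil => simp only [quasiShuffleSum_nil_right]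
    | cons b v ihv =>
      simp only [quasiShuffleSum_cons_cons]
      rw [ihu, ihu, ihv]
      ring

/-- Going from `N` to `N + 1` adds to each factor the terms whose outermost index is `N + 1`. In the
strict case the three new products all live at level `N`, and the diagonal enters with sign `+1`. In
the weak case they are expressed at level `N + 1` with shorter words; the diagonal is then counted
twice, whence the sign `-1` and the inner inductions on the words. -/
theorem nest_mul_nest (c : Version) (u v : List (ℕ → ℂ)) (N : ℕ) :
    nest c u N * nest c v N = quasiShuffleSum (stuffleSign c) u v fun w => nest c w N := by
  have hzero : ∀ u v : List (ℕ → ℂ), nest c u 0 * nest c v 0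
      = quasiShuffleSum (stuffleSign c) u v fun w => nest c w 0 := by
    intro u v
    rcases u with _ | ⟨a, u⟩
    · rw [quasiShuffleSum_nil_left, nest_nil, one_mul]
    rcases v with _ | ⟨b, v⟩
    · rw [quasiShuffleSum_nil_right, nest_nil, mul_one]
    have hz : ∀ u v : List (ℕ → ℂ), quasiShuffleSum (stuffleSign c) u v (fun _ => (0 : ℂ)) = 0 := by
      intro u v
      have := quasiShuffleSum_add_mul (stuffleSign c) (-1) u v (fun _ => (0 : ℂ)) fun _ => 0
      simp only [mul_zero, add_zero] at this
      linear_combination this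
    rw [quasiShuffleSum_cons_cons]
    simp only [nest_cons_zero, hz]
    ring
  induction N generalizing u v with
  | zero => exact hzero u v
  | succ N ihN =>
    induction u generalizing v with
    | nil => rw [quasiShuffleSum_nil_left, nest_nil, one_mul]
    | cons a u ihu =>
      induction v with
      | nil => rw [quasiShuffleSum_nil_right, nest_nil, mul_one]
      | cons b v ihv =>
        have key := ihN (a :: u) (b :: v)
        rw [quasiShuffleSum_cons_cons] at key ⊢
        simp only [nest_cons_succ c _ _ N, quasiShuffleSum_add_mul]
        have ea := nest_cons_succ c a u N
        have eb := nest_cons_succ c b v N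
        cases c with
        | strict =>
          have h1 := ihN u (b :: v)
          have h2 := ihN (a :: u) v
          have h3 := ihN u v
          simp only [Version.pred, Nat.add_sub_cancel, stuffleSign, Pi.mul_apply] at *
          rw [← h1, ← h2, ← h3]
          linear_combination key
        | weak =>
          have h1 := ihu (b :: v)
          have h2 := ihv
          have h3 := ihu v
          simp only [Version.pred, stuffleSign, Pi.mul_apply] at *
          rw [← h1, ← h2, ← h3, ea, eb]
          linear_combination key

variable [CommMonoid M]

/-- Two words merged along maps from their positions. -/
def mergeWords {k l p : ℕ} (α : Fin k → Fin p) (β : Fin l → Fin p) (f : Fin k → M)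
    (g : Fin l → M) : Fin p → M :=
  fun j => (∏ i, if α i = j then f i else 1) * ∏ i, if β i = j then g i else 1

open Classical in
/-- Pairs of strictly increasing maps that are jointly surjective. -/
noncomputable def quasiShuffles (k l p : ℕ) : Finset ((Fin k → Fin p) × (Fin l → Fin p)) :=
  {x | StrictMono x.1 ∧ StrictMono x.2 ∧ ∀ j, (∃ i, x.1 i = j) ∨ ∃ i, x.2 i = j}

theorem mem_quasiShuffles {k l p : ℕ} {x : (Fin k → Fin p) × (Fin l → Fin p)} :
    x ∈ quasiShuffles k l p ↔
      StrictMono x.1 ∧ StrictMono x.2 ∧ ∀ j, (∃ i, x.1 i = j) ∨ ∃ i, x.2 i = j := by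
  simp [quasiShuffles]

/-- Shift the values of a map by one. -/
def shiftUp {k p : ℕ} (α : Fin k → Fin p) : Fin k → Fin (p + 1) := fun i => (α i).succ

/-- Shift the values of a map by one and prepend the value `0`. -/
def consUp {k p : ℕ} (α : Fin k → Fin p) : Fin (k + 1) → Fin (p + 1) := Fin.cons 0 (shiftUp α)

theorem shiftUp_injective {k p : ℕ} : Function.Injective (shiftUp (k := k) (p := p)) := by
  intro α β h
  funext i
  exact Fin.succ_injective _ (congrFun h i)

theorem consUp_injective {k p : ℕ} : Function.Injective (consUp (k := k) (p := p)) := by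
  intro α β h
  exact shiftUp_injective (Fin.cons_right_injective _ h)

theorem strictMono_shiftUp_iff {k p : ℕ} {α : Fin k → Fin p} :
    StrictMono (shiftUp α) ↔ StrictMono α := by
  simp [StrictMono, shiftUp]

theorem strictMono_consUp_iff {k p : ℕ} {α : Fin k → Fin p} :
    StrictMono (consUp α) ↔ StrictMono α := by
  constructor
  · intro h i j hij
    have := h (Fin.succ_lt_succ_iff.2 hij)
    simpa [consUp, shiftUp] using this
  · intro h i j hij
    induction j using Fin.cases with
    | zero => exact absurd hij (Fin.not_lt_zero i)
    | succ j =>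
      induction i using Fin.cases with
      | zero => simp [consUp, shiftUp]
      | succ i => simpa [consUp, shiftUp] using h (Fin.succ_lt_succ_iff.1 hij)

theorem exists_eq_shiftUp {k p : ℕ} {α : Fin k → Fin (p + 1)} (h : ∀ i, α i ≠ 0) :
    ∃ α', α = shiftUp α' := by
  choose α' h' using fun i => Fin.exists_succ_eq.2 (h i)
  exact ⟨α', funext fun i => (h' i).symm⟩

theorem exists_eq_consUp {k p : ℕ} {α : Fin (k + 1) → Fin (p + 1)} (hα : StrictMono α)
    (h : α 0 = 0) : ∃ α', α = consUp α' := by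
  obtain ⟨α', h'⟩ := exists_eq_shiftUp (α := Fin.tail α) fun i => by
    have := hα (Fin.succ_pos i)
    rw [h] at this
    exact this.ne'
  refine ⟨α', ?_⟩
  rw [consUp, ← h', ← h, Fin.cons_self_tail]

theorem consUp_zero {k p : ℕ} (α : Fin k → Fin p) : consUp α 0 = 0 := rfl

theorem consUp_succ {k p : ℕ} (α : Fin k → Fin p) (i : Fin k) : consUp α i.succ = (α i).succ := rfl

theorem shiftUp_ne_zero {k p : ℕ} (α : Fin k → Fin p) (i : Fin k) : shiftUp α i ≠ 0 :=
  Fin.succ_ne_zero _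

theorem mergeWords_cons_shift {k l p : ℕ} (α : Fin k → Fin p) (β : Fin l → Fin p)
    (f : Fin (k + 1) → M) (g : Fin l → M) :
    List.ofFn (mergeWords (consUp α) (shiftUp β) f g) =
      f 0 :: List.ofFn (mergeWords α β (Fin.tail f) g) := by
  rw [List.ofFn_succ]
  congr 1
  · simp [mergeWords, Fin.prod_univ_succ, consUp_zero, consUp_succ, shiftUp_ne_zero]
  · congr 1
    funext j
    simp [mergeWords, Fin.prod_univ_succ, consUp_zero, consUp_succ, shiftUp, Fin.tail,
      (Fin.succ_ne_zero j).symm]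

theorem mergeWords_shift_cons {k l p : ℕ} (α : Fin k → Fin p) (β : Fin l → Fin p)
    (f : Fin k → M) (g : Fin (l + 1) → M) :
    List.ofFn (mergeWords (shiftUp α) (consUp β) f g) =
      g 0 :: List.ofFn (mergeWords α β f (Fin.tail g)) := by
  rw [List.ofFn_succ]
  congr 1
  · simp [mergeWords, Fin.prod_univ_succ, consUp_zero, consUp_succ, shiftUp_ne_zero]
  · congr 1
    funext j
    simp [mergeWords, Fin.prod_univ_succ, consUp_zero, consUp_succ, shiftUp, Fin.tail,
      (Fin.succ_ne_zero j).symm]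

theorem mergeWords_cons_cons {k l p : ℕ} (α : Fin k → Fin p) (β : Fin l → Fin p)
    (f : Fin (k + 1) → M) (g : Fin (l + 1) → M) :
    List.ofFn (mergeWords (consUp α) (consUp β) f g) =
      f 0 * g 0 :: List.ofFn (mergeWords α β (Fin.tail f) (Fin.tail g)) := by
  rw [List.ofFn_succ]
  congr 1
  · simp [mergeWords, Fin.prod_univ_succ, consUp_zero, consUp_succ]
  · congr 1
    funext j
    simp [mergeWords, Fin.prod_univ_succ, consUp_zero, consUp_succ, Fin.tail,
      (Fin.succ_ne_zero j).symm]

theorem cons_shift_mem_quasiShuffles {k l p : ℕ} {α : Fin k → Fin p} {β : Fin l → Fin p} :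
    (consUp α, shiftUp β) ∈ quasiShuffles (k + 1) l (p + 1) ↔ (α, β) ∈ quasiShuffles k l p := by
  simp [mem_quasiShuffles, strictMono_consUp_iff, strictMono_shiftUp_iff, Fin.forall_fin_succ,
    Fin.exists_fin_succ, consUp_zero, consUp_succ, shiftUp, (Fin.succ_ne_zero _).symm]

theorem shift_cons_mem_quasiShuffles {k l p : ℕ} {α : Fin k → Fin p} {β : Fin l → Fin p} :
    (shiftUp α, consUp β) ∈ quasiShuffles k (l + 1) (p + 1) ↔ (α, β) ∈ quasiShuffles k l p := by
  simp [mem_quasiShuffles, strictMono_consUp_iff, strictMono_shiftUp_iff, Fin.forall_fin_succ,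
    Fin.exists_fin_succ, consUp_zero, consUp_succ, shiftUp, (Fin.succ_ne_zero _).symm]

theorem cons_cons_mem_quasiShuffles {k l p : ℕ} {α : Fin k → Fin p} {β : Fin l → Fin p} :
    (consUp α, consUp β) ∈ quasiShuffles (k + 1) (l + 1) (p + 1) ↔
      (α, β) ∈ quasiShuffles k l p := by
  simp [mem_quasiShuffles, strictMono_consUp_iff, Fin.forall_fin_succ,
    Fin.exists_fin_succ, consUp_zero, consUp_succ, (Fin.succ_ne_zero _).symm]

/-- The sum of `Φ` over the words merged along the quasi-shuffles with `p` letters. -/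
noncomputable def mergeSum {k l : ℕ} (p : ℕ) (f : Fin k → M) (g : Fin l → M)
    (Φ : List M → ℂ) : ℂ :=
  ∑ x ∈ quasiShuffles k l p, Φ (List.ofFn (mergeWords x.1 x.2 f g))

/-- The fibre over the first merged position contains the first letter of one word, of the other, or
of both: three disjoint classes, joint surjectivity excluding an empty fibre. -/
theorem mergeSum_succ {k l p : ℕ} (f : Fin (k + 1) → M) (g : Fin (l + 1) → M)
    (Φ : List M → ℂ) : mergeSum (p + 1) f g Φ =
      mergeSum p (Fin.tail f) g (fun w => Φ (f 0 :: w)) +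
        mergeSum p f (Fin.tail g) (fun w => Φ (g 0 :: w)) +
        mergeSum p (Fin.tail f) (Fin.tail g) (fun w => Φ (f 0 * g 0 :: w)) := by
  classical
  set A : Finset ((Fin (k + 1) → Fin (p + 1)) × (Fin (l + 1) → Fin (p + 1))) :=
    (quasiShuffles k (l + 1) p).image fun x => (consUp x.1, shiftUp x.2) with hA
  set B : Finset ((Fin (k + 1) → Fin (p + 1)) × (Fin (l + 1) → Fin (p + 1))) :=
    (quasiShuffles (k + 1) l p).image fun x => (shiftUp x.1, consUp x.2) with hB
  set C : Finset ((Fin (k + 1) → Fin (p + 1)) × (Fin (l + 1) → Fin (p + 1))) :=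
    (quasiShuffles k l p).image fun x => (consUp x.1, consUp x.2) with hC
  have hX : quasiShuffles (k + 1) (l + 1) (p + 1) = (A ∪ B) ∪ C := by
    ext ⟨α, β⟩
    simp only [Finset.mem_union, hA, hB, hC, Finset.mem_image, Prod.exists, Prod.mk.injEq]
    constructor
    · intro hx
      obtain ⟨h1, h2, h3⟩ := mem_quasiShuffles.1 hx
      by_cases ha : α 0 = 0 <;> by_cases hb : β 0 = 0
      · obtain ⟨α', rfl⟩ := exists_eq_consUp h1 ha
        obtain ⟨β', rfl⟩ := exists_eq_consUp h2 hb
        exact Or.inr ⟨α', β', cons_cons_mem_quasiShuffles.1 hx, rfl, rfl⟩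
      · obtain ⟨α', rfl⟩ := exists_eq_consUp h1 ha
        obtain ⟨β', rfl⟩ := exists_eq_shiftUp (α := β) fun i h => hb
          (Fin.le_zero_iff.1 (h ▸ h2.monotone (Fin.zero_le i)))
        exact Or.inl (Or.inl ⟨α', β', cons_shift_mem_quasiShuffles.1 hx, rfl, rfl⟩)
      · obtain ⟨α', rfl⟩ := exists_eq_shiftUp (α := α) fun i h => ha
          (Fin.le_zero_iff.1 (h ▸ h1.monotone (Fin.zero_le i)))
        obtain ⟨β', rfl⟩ := exists_eq_consUp h2 hb
        exact Or.inl (Or.inr ⟨α', β', shift_cons_mem_quasiShuffles.1 hx, rfl, rfl⟩)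
      · exfalso
        rcases h3 0 with ⟨i, hi⟩ | ⟨i, hi⟩
        · exact ha (Fin.le_zero_iff.1 (hi ▸ h1.monotone (Fin.zero_le i)))
        · exact hb (Fin.le_zero_iff.1 (hi ▸ h2.monotone (Fin.zero_le i)))
    · rintro ((⟨α', β', h, rfl, rfl⟩ | ⟨α', β', h, rfl, rfl⟩) | ⟨α', β', h, rfl, rfl⟩)
      · exact cons_shift_mem_quasiShuffles.2 h
      · exact shift_cons_mem_quasiShuffles.2 h
      · exact cons_cons_mem_quasiShuffles.2 h
  have hAB : Disjoint A B := by
    rw [Finset.disjoint_left]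
    intro x hxA hxB
    obtain ⟨y, -, rfl⟩ := Finset.mem_image.1 hxA
    obtain ⟨z, -, hz⟩ := Finset.mem_image.1 hxB
    exact shiftUp_ne_zero z.1 0 (congrFun (congrArg Prod.fst hz) 0)
  have hABC : Disjoint (A ∪ B) C := by
    rw [Finset.disjoint_left]
    intro x hxAB hxC
    obtain ⟨y, -, rfl⟩ := Finset.mem_image.1 hxC
    rcases Finset.mem_union.1 hxAB with h | h
    · obtain ⟨z, -, hz⟩ := Finset.mem_image.1 h
      exact shiftUp_ne_zero z.2 0 (congrFun (congrArg Prod.snd hz) 0)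
    · obtain ⟨z, -, hz⟩ := Finset.mem_image.1 h
      exact shiftUp_ne_zero z.1 0 (congrFun (congrArg Prod.fst hz) 0)
  rw [mergeSum, hX, Finset.sum_union hABC, Finset.sum_union hAB, hA, hB, hC,
    Finset.sum_image, Finset.sum_image, Finset.sum_image]
  · simp only [mergeWords_cons_shift, mergeWords_shift_cons, mergeWords_cons_cons]
    rfl
  · intro x _ y _ h
    exact Prod.ext (consUp_injective (congrArg Prod.fst h)) (consUp_injective (congrArg Prod.snd h))
  · intro x _ y _ h
    exact Prod.ext (shiftUp_injective (congrArg Prod.fst h)) (consUp_injective (congrArg Prod.snd h))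
  · intro x _ y _ h
    exact Prod.ext (consUp_injective (congrArg Prod.fst h)) (shiftUp_injective (congrArg Prod.snd h))

theorem quasiShuffles_eq_empty {k l p : ℕ} (h : p < k ∨ p < l ∨ k + l < p) :
    quasiShuffles k l p = ∅ := by
  classical
  refine Finset.eq_empty_of_forall_notMem fun x hx => ?_
  obtain ⟨h1, h2, h3⟩ := mem_quasiShuffles.1 hx
  have e1 := Fintype.card_le_of_injective _ h1.injective
  have e2 := Fintype.card_le_of_injective _ h2.injective
  have e3 := Fintype.card_le_of_surjective (Sum.elim x.1 x.2) fun j => by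
    rcases h3 j with ⟨i, hi⟩ | ⟨i, hi⟩
    · exact ⟨Sum.inl i, hi⟩
    · exact ⟨Sum.inr i, hi⟩
  simp only [Fintype.card_fin, Fintype.card_sum] at e1 e2 e3
  omega

theorem mergeSum_eq_zero {k l p : ℕ} (h : p < k ∨ p < l ∨ k + l < p) (f : Fin k → M)
    (g : Fin l → M) (Φ : List M → ℂ) : mergeSum p f g Φ = 0 := by
  rw [mergeSum, quasiShuffles_eq_empty h, Finset.sum_empty]

theorem mergeSum_nil_left {l : ℕ} (f : Fin 0 → M) (g : Fin l → M) (Φ : List M → ℂ) :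
    mergeSum l f g Φ = Φ (List.ofFn g) := by
  classical
  have h : quasiShuffles 0 l l = {(Fin.elim0, id)} := by
    ext ⟨α, β⟩
    rw [mem_quasiShuffles, Finset.mem_singleton]
    constructor
    · rintro ⟨-, h, h'⟩
      refine Prod.ext (Subsingleton.elim _ _) ((h.range_inj strictMono_id).1 ?_)
      rw [Set.range_id, Set.range_eq_univ]
      exact fun j => (h' j).resolve_left fun ⟨i, _⟩ => i.elim0
    · rintro h
      rw [Prod.mk.injEq] at h
      obtain ⟨rfl, rfl⟩ := h
      exact ⟨fun i => i.elim0, strictMono_id, fun j => Or.inr ⟨j, rfl⟩⟩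
  rw [mergeSum, h, Finset.sum_singleton]
  congr 2
  funext j
  simp [mergeWords]

theorem mergeSum_nil_right {k : ℕ} (f : Fin k → M) (g : Fin 0 → M) (Φ : List M → ℂ) :
    mergeSum k f g Φ = Φ (List.ofFn f) := by
  classical
  have h : quasiShuffles k 0 k = {(id, Fin.elim0)} := by
    ext ⟨α, β⟩
    rw [mem_quasiShuffles, Finset.mem_singleton]
    constructor
    · rintro ⟨h, -, h'⟩
      refine Prod.ext ((h.range_inj strictMono_id).1 ?_) (Subsingleton.elim _ _)
      rw [Set.range_id, Set.range_eq_univ]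
      exact fun j => (h' j).resolve_right fun ⟨i, _⟩ => i.elim0
    · rintro h
      rw [Prod.mk.injEq] at h
      obtain ⟨rfl, rfl⟩ := h
      exact ⟨strictMono_id, fun i => i.elim0, fun j => Or.inl ⟨j, rfl⟩⟩
  rw [mergeSum, h, Finset.sum_singleton]
  congr 2
  funext j
  simp [mergeWords]

/-- The exponent `k + l - p` of `ε` is the number of merged pairs. Summing over all `p ≤ k + l`
gives a uniform recursion, since impossible lengths contribute zero. -/
theorem sum_mergeSum_eq_quasiShuffleSum (ε : ℂ) {k l : ℕ} (f : Fin k → M) (g : Fin l → M)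
    (Φ : List M → ℂ) :
    ∑ p ∈ Finset.range (k + l + 1), ε ^ (k + l - p) * mergeSum p f g Φ =
      quasiShuffleSum ε (List.ofFn f) (List.ofFn g) Φ := by
  induction k generalizing l Φ with
  | zero =>
    rw [List.ofFn_zero, quasiShuffleSum_nil_left, Finset.sum_eq_single l]
    · rw [mergeSum_nil_left]; simp
    · intro p _ hp
      rw [mergeSum_eq_zero (by omega), mul_zero]
    · intro h
      exact absurd (Finset.mem_range.2 (by omega)) h
  | succ k ihk =>
    induction l generalizing Φ with
    | zero =>
      rw [List.ofFn_zero, quasiShuffleSum_nil_right, Finset.sum_eq_single (k + 1)]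
      · rw [mergeSum_nil_right]; simp
      · intro p _ hp
        rw [mergeSum_eq_zero (by omega), mul_zero]
      · intro h
        exact absurd (Finset.mem_range.2 (by omega)) h
    | succ l ihl =>
      rw [List.ofFn_succ, List.ofFn_succ, quasiShuffleSum_cons_cons]
      have e1 := ihk (Fin.tail f) g (fun w => Φ (f 0 :: w))
      have e2 := ihl (Fin.tail g) (fun w => Φ (g 0 :: w))
      have e3 := ihk (Fin.tail f) (Fin.tail g) (fun w => Φ (f 0 * g 0 :: w))
      rw [List.ofFn_succ] at e1 e2
      change _ = quasiShuffleSum ε (List.ofFn fun i : Fin k => f i.succ) _ _ at e1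
      change _ = quasiShuffleSum ε _ (List.ofFn fun i : Fin l => g i.succ) _ at e2
      change _ = quasiShuffleSum ε (List.ofFn fun i : Fin k => f i.succ)
        (List.ofFn fun i : Fin l => g i.succ) _ at e3
      rw [← e1, ← e2, ← e3, Finset.sum_range_succ', mergeSum_eq_zero (p := 0) (by omega), mul_zero,
        add_zero, show k + 1 + (l + 1) = (k + l + 1) + 1 by ring,
        show k + (l + 1) + 1 = (k + l + 1) + 1 by ring,
        show k + 1 + l + 1 = (k + l + 1) + 1 by ring, Finset.mul_sum]
      -- Merging the two first letters lowers the total length by two and the number of positions by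
      -- one; the extra `ε` restores the exponent, and the added term `p = k + l + 1` vanishes.
      have e4 : ∑ p ∈ Finset.range (k + l + 1), ε * (ε ^ (k + l - p) *
            mergeSum p (Fin.tail f) (Fin.tail g) fun w => Φ (f 0 * g 0 :: w))
          = ∑ p ∈ Finset.range (k + l + 1 + 1), ε ^ (k + l + 1 - p) *
            mergeSum p (Fin.tail f) (Fin.tail g) fun w => Φ (f 0 * g 0 :: w) := by
        rw [Finset.sum_range_succ _ (k + l + 1), mergeSum_eq_zero (p := k + l + 1) (by omega),
          mul_zero, add_zero]
        refine Finset.sum_congr rfl fun p hp => ?_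
        have hp' := Finset.mem_range.1 hp
        rw [← mul_assoc, ← pow_succ', show k + l - p + 1 = k + l + 1 - p by omega]
      rw [e4, ← Finset.sum_add_distrib, ← Finset.sum_add_distrib]
      refine Finset.sum_congr rfl fun p _ => ?_
      rw [mergeSum_succ, Nat.add_sub_add_right, show k + (l + 1) - p = k + l + 1 - p by omega,
        show k + 1 + l - p = k + l + 1 - p by omega]
      ring

open Classical in
theorem sum_mixSh_eq_mergeSum {k l r : ℕ} (f : Fin (k + l) → M) (Φ : List M → ℂ) :
    ∑ π ∈ mixSh k l r, Φ (List.ofFn fun j => ∏ i with π i = j, f i) =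
      mergeSum (k + l - r) (fun i => f (Fin.castAdd l i)) (fun i => f (Fin.natAdd k i)) Φ := by
  rw [mergeSum]
  refine Finset.sum_nbij' (fun π => (fun i => π (Fin.castAdd l i), fun i => π (Fin.natAdd k i)))
    (fun x => Fin.append x.1 x.2) ?_ ?_ ?_ ?_ ?_
  · intro π hπ
    simp only [mixSh, Finset.mem_filter, Finset.mem_univ, true_and] at hπ
    refine mem_quasiShuffles.2 ⟨hπ.2.1, hπ.2.2, fun j => ?_⟩
    obtain ⟨i, rfl⟩ := hπ.1 j
    induction i using Fin.addCases with
    | left i => exact Or.inl ⟨i, rfl⟩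
    | right i => exact Or.inr ⟨i, rfl⟩
  · intro x hx
    obtain ⟨h1, h2, h3⟩ := mem_quasiShuffles.1 hx
    simp only [mixSh, Finset.mem_filter, Finset.mem_univ, true_and, Fin.append_left,
      Fin.append_right]
    refine ⟨fun j => ?_, h1, h2⟩
    rcases h3 j with ⟨i, hi⟩ | ⟨i, hi⟩
    · exact ⟨Fin.castAdd l i, by rw [Fin.append_left, hi]⟩
    · exact ⟨Fin.natAdd k i, by rw [Fin.append_right, hi]⟩
  · intro π _
    exact Fin.append_castAdd_natAdd
  · intro x _
    simp
  · intro π _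
    congr 2
    funext j
    rw [Finset.prod_filter, Fin.prod_univ_add, mergeWords]

theorem sum_mixSh_eq_quasiShuffleSum (ε : ℂ) {k l : ℕ} (f : Fin (k + l) → M) (Φ : List M → ℂ) :
    ∑ r ∈ Finset.range (min k l + 1), ε ^ r *
        ∑ π ∈ mixSh k l r, Φ (List.ofFn fun j => ∏ i with π i = j, f i) =
      quasiShuffleSum ε (List.ofFn fun i => f (Fin.castAdd l i))
        (List.ofFn fun i => f (Fin.natAdd k i)) Φ := by
  rw [← sum_mergeSum_eq_quasiShuffleSum, ← Finset.sum_range_reflect fun p =>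
    ε ^ (k + l - p) * mergeSum p (fun i => f (Fin.castAdd l i)) (fun i => f (Fin.natAdd k i)) Φ]
  rw [← Finset.sum_subset (Finset.range_mono (by omega : min k l + 1 ≤ k + l + 1))]
  · refine Finset.sum_congr rfl fun r hr => ?_
    have hr' := Finset.mem_range.1 hr
    rw [show k + l + 1 - 1 - r = k + l - r by omega, show k + l - (k + l - r) = r by omega,
      ← sum_mixSh_eq_mergeSum]
  · intro r hr hr'
    rw [Finset.mem_range] at hr hr'
    rw [mergeSum_eq_zero (by omega), mul_zero]

end QuasiShuffle

end NestedZeta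

namespace NestedZeta

/-! ### Application to the merged symbols. -/

section Letters

theorem truncSum_congr (c : Version) {k : ℕ} {f g : Fin k → ℝ → ℂ}
    (h : ∀ i, ∀ n : ℕ, 1 ≤ n → f i n = g i n) : truncSum c f = truncSum c g := by
  classical
  funext N
  refine Finset.sum_congr rfl fun n hn => Finset.prod_congr rfl fun i _ => h i _ ?_
  exact (Finset.mem_Icc.1 (Fintype.mem_piFinset.1 (Finset.mem_filter.1 hn).1 i)).1

theorem cutoffSum_congr (c : Version) {k : ℕ} {f g : Fin k → ℝ → ℂ}
    (h : ∀ i, ∀ n : ℕ, 1 ≤ n → f i n = g i n) : cutoffSum c f = cutoffSum c g := by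
  rw [cutoffSum, truncSum_congr c h, cutoffSum]

/-- The functions `ξ ↦ (ξ + v_i) ^ (-s_i)`. -/
noncomputable def shiftedPow {m : ℕ} (v : Fin m → ℝ) (s : Fin m → ℂ) : Fin m → ℝ → ℂ :=
  fun i ξ => ((ξ + v i : ℝ) : ℂ) ^ (-(s i))

variable {m p : ℕ} {v : Fin m → ℝ}

theorem symbTensor_natCast {χ : ℝ → ℝ} (hχ : IsCutoff χ) (s : Fin m → ℂ) (i : Fin m) {n : ℕ}
    (hn : 1 ≤ n) : symbTensor χ v s i n = shiftedPow v s i n := by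
  rw [symbTensor, symb, hχ.eq_one _ (by exact_mod_cast hn), Complex.ofReal_one, one_mul, shiftedPow]

theorem mergeTensor_symbTensor_natCast {χ : ℝ → ℝ} (hχ : IsCutoff χ) (π : Fin m → Fin p)
    (s : Fin m → ℂ) (j : Fin p) {n : ℕ} (hn : 1 ≤ n) :
    mergeTensor π (symbTensor χ v s) j n = mergeTensor π (shiftedPow v s) j n :=
  Finset.prod_congr rfl fun i _ => symbTensor_natCast hχ s i hn

theorem mergeTensor_id (f : Fin m → ℝ → ℂ) : mergeTensor id f = f := by
  funext j ξ
  simp [mergeTensor, Finset.prod_filter]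

theorem mergeArgs_id (s : Fin m → ℂ) : mergeArgs id s = s := by
  funext j
  simp [mergeArgs, Finset.sum_filter]

theorem sum_Iic_mergeArgs (π : Fin m → Fin p) (s : Fin m → ℂ) (j : Fin p) :
    ∑ i ∈ Finset.Iic j, mergeArgs π s i = ∑ i with π i ≤ j, s i := by
  simp only [mergeArgs, Finset.sum_filter]
  rw [Finset.sum_comm]
  refine Finset.sum_congr rfl fun i _ => ?_
  rw [Finset.sum_ite_eq]
  simp

theorem sum_Iic_succ {k : ℕ} (z : Fin (k + 1) → ℂ) (j : Fin k) :
    ∑ i ∈ Finset.Iic j.succ, z i = z 0 + ∑ i ∈ Finset.Iic j, z i.succ := by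
  have h : ∀ {n : ℕ} (j : Fin n) (z : Fin n → ℂ),
      ∑ i ∈ Finset.Iic j, z i = ∑ i, if i ≤ j then z i else 0 := by
    intro n j z
    rw [← Finset.sum_filter]
    congr 1
    ext; simp
  rw [h, h, Fin.sum_univ_succ]
  simp

theorem mem_expo_ofFn {k : ℕ} (z : Fin k → ℂ) (x : ℂ) :
    x ∈ expo (List.ofFn z) ↔
      ∃ (j : Fin k) (m : ℕ), x = ((j : ℕ) + 1 : ℂ) - ∑ i ∈ Finset.Iic j, z i - m := by
  induction k generalizing x with
  | zero =>
    rw [List.ofFn_zero]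
    exact ⟨fun h => h.elim, fun ⟨j, _⟩ => j.elim0⟩
  | succ k ih =>
    rw [List.ofFn_succ, expo, Set.mem_union, Set.mem_ofPred_eq, ih, Fin.exists_fin_succ]
    have h0 : ∑ i ∈ Finset.Iic (0 : Fin (k + 1)), z i = z 0 := by
      rw [show Finset.Iic (0 : Fin (k + 1)) = {0} by ext; simp, Finset.sum_singleton]
    refine or_congr ?_ ?_
    · simp [down, h0]
    · refine exists_congr fun j => exists_congr fun m => ?_
      rw [sum_Iic_succ, Fin.val_succ]
      push_cast
      constructor <;> intro h <;> linear_combination h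

/-- The link between asymptotics and poles: the hyperplanes are exactly the parameters where a power
term degenerates to a constant or a pure power of the logarithm. -/
theorem zero_mem_expo_ofFn_iff {k : ℕ} (z : Fin k → ℂ) :
    0 ∈ expo (List.ofFn z) ↔ z ∈ polarSet k := by
  rw [mem_expo_ofFn]
  refine exists_congr fun j => ?_
  constructor
  · rintro ⟨m, hm⟩
    refine ⟨(j : ℕ) + 1 - m, by omega, ?_⟩
    push_cast
    linear_combination hm
  · rintro ⟨m, hm, h⟩
    obtain ⟨n, hn⟩ := Int.eq_ofNat_of_zero_le (show 0 ≤ ((j : ℕ) : ℤ) + 1 - m by omega)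
    refine ⟨n, ?_⟩
    have : ((n : ℤ) : ℂ) = ((j : ℕ) : ℂ) + 1 - m := by
      rw [← hn]; push_cast; ring
    rw [Int.cast_natCast] at this
    rw [h, this]
    ring

theorem forall₂_ofFn {α β : Type*} {R : α → β → Prop} {k : ℕ} {f : Fin k → α} {g : Fin k → β}
    (h : ∀ i, R (f i) (g i)) : List.Forall₂ R (List.ofFn f) (List.ofFn g) := by
  induction k with
  | zero => simp
  | succ k ih =>
    rw [List.ofFn_succ, List.ofFn_succ]
    exact .cons (h 0) (ih fun i => h i.succ)

theorem HolAll.finset_prod {E ι : Type*} [NormedAddCommGroup E] [NormedSpace ℂ E] {U : Set E}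
    (hU : IsOpen U) (S : Finset ι) {z : ι → E → ℂ} {f : ι → ℕ → E → ℂ}
    (h : ∀ i ∈ S, HolAll U (z i) (f i)) :
    HolAll U (fun s => ∑ i ∈ S, z i s) fun n s => ∏ i ∈ S, f i n s := by
  classical
  induction S using Finset.induction_on with
  | empty =>
    have := HolAll.const_mul_cpow (U := U) (.const 0) (.const 1)
    simpa using this
  | insert i S hi ih =>
    simp only [Finset.sum_insert hi, Finset.prod_insert hi]
    exact (h i (Finset.mem_insert_self i S)).mul hU
      (ih fun j hj => h j (Finset.mem_insert_of_mem hj))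

theorem bddAnalytic_apply (s₀ : Fin m → ℂ) (i : Fin m) :
    BddAnalytic (Metric.ball s₀ 1) fun s : Fin m → ℂ => s i := by
  refine ⟨(ContinuousLinearMap.proj (R := ℂ) (φ := fun _ : Fin m => ℂ) i).analyticOnNhd _,
    ‖s₀‖ + 1, by positivity, fun s hs => (norm_le_pi_norm s i).trans ?_⟩
  rw [mem_ball_iff_norm] at hs
  linarith [norm_le_norm_add_norm_sub' s s₀]

theorem holAll_mergeTensor (hv : ∀ i, 0 ≤ v i) (π : Fin m → Fin p) (s₀ : Fin m → ℂ) (j : Fin p) :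
    HolAll (Metric.ball s₀ 1) (fun s => mergeArgs π s j)
      fun n s => mergeTensor π (shiftedPow v s) j n :=
  HolAll.finset_prod Metric.isOpen_ball _ fun i _ =>
    holAll_natCast_add_cpow (bddAnalytic_apply s₀ i) (hv i)

theorem truncSum_mergeTensor_eq_nest (c : Version) {χ : ℝ → ℝ} (hχ : IsCutoff χ)
    (π : Fin m → Fin p) (s : Fin m → ℂ) :
    truncSum c (mergeTensor π (symbTensor χ v s)) = nest c
      ((List.ofFn fun (j : Fin p) (n : ℕ) (s : Fin m → ℂ) =>
        mergeTensor π (shiftedPow v s) j n).map fun f n => f n s) := by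
  rw [truncSum_congr c fun j n hn => mergeTensor_symbTensor_natCast hχ π s j hn]
  funext N
  rw [truncSum_eq_nest, List.map_ofFn]
  rfl

theorem map_ofFn_mergeArgs (π : Fin m → Fin p) (s : Fin m → ℂ) :
    (List.ofFn fun (j : Fin p) (s : Fin m → ℂ) => mergeArgs π s j).map (· s) =
      List.ofFn (mergeArgs π s) := by
  rw [List.map_ofFn]
  rfl

theorem exists_truncSum_sub_const_mem_asymp (c : Version) {χ : ℝ → ℝ} (hχ : IsCutoff χ)
    (hv : ∀ i, 0 ≤ v i) (π : Fin m → Fin p) (s : Fin m → ℂ) :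
    ∃ a : ℂ, (truncSum c (mergeTensor π (symbTensor χ v s)) - fun _ => a) ∈
      Asymp (expo (List.ofFn (mergeArgs π s))) := by
  obtain ⟨a, ha, -⟩ := exists_nest_sub_const_mem_asymp c (HolAll.forall₂_mem_asymp
    (forall₂_ofFn (holAll_mergeTensor hv π s)) (Metric.mem_ball_self one_pos))
  rw [map_ofFn_mergeArgs] at ha
  exact ⟨a, by rwa [truncSum_mergeTensor_eq_nest c hχ]⟩

theorem existsUnique_hasFinitePart (c : Version) {χ : ℝ → ℝ} (hχ : IsCutoff χ)
    (hv : ∀ i, 0 ≤ v i) (π : Fin m → Fin p) (s : Fin m → ℂ) :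
    ∃! a : ℂ, HasFinitePart (truncSum c (mergeTensor π (symbTensor χ v s))) a := by
  obtain ⟨a, ha⟩ := exists_truncSum_sub_const_mem_asymp c hχ hv π s
  obtain ⟨a', ha', -⟩ := hasFinitePart_of_sub_mem_asymp ha
  exact ⟨a', ha', fun b hb => hb.unique ha'⟩

theorem truncSum_sub_cutoffSum_mem_asymp (c : Version) {χ : ℝ → ℝ} (hχ : IsCutoff χ)
    (hv : ∀ i, 0 ≤ v i) (π : Fin m → Fin p) {s : Fin m → ℂ} (hs : mergeArgs π s ∉ polarSet p) :
    (truncSum c (mergeTensor π (symbTensor χ v s)) -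
      fun _ => cutoffSum c (mergeTensor π (symbTensor χ v s))) ∈
        Asymp (expo (List.ofFn (mergeArgs π s))) := by
  obtain ⟨a, ha⟩ := exists_truncSum_sub_const_mem_asymp c hχ hv π s
  obtain ⟨a', ha', h⟩ := hasFinitePart_of_sub_mem_asymp ha
  rw [cutoffSum, ha'.finitePart_eq, h (by rwa [zero_mem_expo_ofFn_iff])]
  exact ha

theorem exists_local_cutoffSum (c : Version) {χ : ℝ → ℝ} (hχ : IsCutoff χ)
    (hv : ∀ i, 0 ≤ v i) (π : Fin m → Fin p) (s₀ : Fin m → ℂ) :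
    ∃ D Z : (Fin m → ℂ) → ℂ, AnalyticAt ℂ D s₀ ∧ AnalyticAt ℂ Z s₀ ∧
      ∀ᶠ s in 𝓝 s₀, (D s ≠ 0 ↔ mergeArgs π s ∉ polarSet p) ∧
        (D s ≠ 0 → cutoffSum c (mergeTensor π (symbTensor χ v s)) = Z s / D s) := by
  obtain ⟨V, -, hVo, hsV, D, Z, hD, hZ, h⟩ := exists_local_nest c Metric.isOpen_ball
    (Metric.mem_ball_self one_pos) (forall₂_ofFn (holAll_mergeTensor hv π s₀))
  refine ⟨D, Z, hD s₀ hsV, hZ s₀ hsV, ?_⟩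
  filter_upwards [hVo.mem_nhds hsV] with s hs
  obtain ⟨h1, h2⟩ := h s hs
  rw [map_ofFn_mergeArgs] at h1 h2
  refine ⟨by rw [h1, zero_mem_expo_ofFn_iff], fun h3 => ?_⟩
  rw [cutoffSum, truncSum_mergeTensor_eq_nest c hχ]
  exact finitePart_nest_eq_div h3 (h1.1 h3) h2

theorem analyticOnNhd_cutoffSum (c : Version) {χ : ℝ → ℝ} (hχ : IsCutoff χ)
    (hv : ∀ i, 0 ≤ v i) (π : Fin m → Fin p) :
    AnalyticOnNhd ℂ (fun s : Fin m → ℂ => cutoffSum c (mergeTensor π (symbTensor χ v s)))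
      {s | mergeArgs π s ∉ polarSet p} := by
  intro s₀ hs₀
  obtain ⟨D, Z, hD, hZ, h⟩ := exists_local_cutoffSum c hχ hv π s₀
  have hD0 : D s₀ ≠ 0 := h.self_of_nhds.1.2 hs₀
  refine (hZ.div hD hD0).congr ?_
  filter_upwards [h, hD.continuousAt.eventually_ne hD0] with s hs hs'
  exact (hs.2 hs').symm

/-- Moving all coordinates in the direction `i` shifts the imaginary part of each partial sum with
positive speed `κ j`, positive because `π` is surjective. For small `t > 0` none of them is real, so
no hyperplane is met. -/
theorem frequently_mergeArgs_notMem_polarSet {π : Fin m → Fin p} (hπ : Function.Surjective π)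
    (s₀ : Fin m → ℂ) : ∃ᶠ s in 𝓝 s₀, mergeArgs π s ∉ polarSet p := by
  have hcurve : Tendsto (fun t : ℝ => s₀ + fun _ => (t : ℂ) * Complex.I) (𝓝[>] 0) (𝓝 s₀) := by
    have h1 : Continuous fun t : ℝ => s₀ + fun _ : Fin m => (t : ℂ) * Complex.I := by fun_prop
    have h2 := (h1.tendsto 0).mono_left (nhdsWithin_le_nhds (s := Set.Ioi 0))
    convert h2 using 2
    funext i
    simp
  refine hcurve.frequently (Eventually.frequently ?_)
  set κ : Fin p → ℝ := fun j => ((Finset.univ.filter fun i => π i ≤ j).card : ℝ)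
  set y : Fin p → ℝ := fun j => (∑ i with π i ≤ j, s₀ i).im
  have hκ : ∀ j, 0 < κ j := fun j => by
    obtain ⟨i, hi⟩ := hπ j
    exact Nat.cast_pos.2 (Finset.card_pos.2
      ⟨i, Finset.mem_filter.2 ⟨Finset.mem_univ _, hi.le⟩⟩)
  have hev : ∀ j, ∀ᶠ t : ℝ in 𝓝[>] 0, y j + t * κ j ≠ 0 := by
    intro j
    rcases lt_or_ge (y j) 0 with h | h
    · have h1 : Tendsto (fun t : ℝ => y j + t * κ j) (𝓝[>] 0) (𝓝 (y j)) := by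
        have h2 : Continuous fun t : ℝ => y j + t * κ j := by fun_prop
        have h3 := (h2.tendsto 0).mono_left (nhdsWithin_le_nhds (s := Set.Ioi 0))
        simpa using h3
      filter_upwards [h1.eventually_lt_const h] with t ht using ht.ne
    · filter_upwards [self_mem_nhdsWithin] with t ht
      have := mul_pos (Set.mem_Ioi.1 ht) (hκ j)
      linarith
  filter_upwards [eventually_all.2 hev] with t ht
  rintro ⟨j, n, -, h⟩
  rw [sum_Iic_mergeArgs] at h
  refine ht j ?_
  have := congrArg Complex.im h
  simpa [Finset.sum_add_distrib, y, κ, mul_comm] using this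

theorem isMeromorphic_cutoffSum (c : Version) {χ : ℝ → ℝ} (hχ : IsCutoff χ)
    (hv : ∀ i, 0 ≤ v i) {π : Fin m → Fin p} (hπ : Function.Surjective π) :
    IsMeromorphic fun s : Fin m → ℂ => cutoffSum c (mergeTensor π (symbTensor χ v s)) := by
  intro s₀
  obtain ⟨D, Z, hD, hZ, h⟩ := exists_local_cutoffSum c hχ hv π s₀
  refine ⟨Z, D, hZ, hD, fun h0 => ?_, h.mono fun s hs => hs.2⟩
  obtain ⟨s, hs, hs1, hs2⟩ :=
    ((frequently_mergeArgs_notMem_polarSet hπ s₀).and_eventually (h.and h0)).exists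
  exact hs1.1.2 hs hs2

theorem tendsto_truncSum (c : Version) {χ : ℝ → ℝ} (hχ : IsCutoff χ)
    (hv : ∀ i, 0 ≤ v i) (π : Fin m → Fin p) {s : Fin m → ℂ}
    (hs : mergeArgs π s ∈ convergenceDomain p) :
    Tendsto (truncSum c (mergeTensor π (symbTensor χ v s))) atTop
      (𝓝 (cutoffSum c (mergeTensor π (symbTensor χ v s)))) := by
  obtain ⟨a, ha⟩ := exists_truncSum_sub_const_mem_asymp c hχ hv π s
  have h0 := tendsto_zero_of_mem_asymp (fun x hx => by
    obtain ⟨j, n, rfl⟩ := (mem_expo_ofFn _ _).1 hx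
    have h1 := hs j
    simp only [Complex.sub_re, Complex.add_re, Complex.natCast_re, Complex.one_re]
    have : (0 : ℝ) ≤ n := Nat.cast_nonneg n
    linarith) ha
  have h1 : Tendsto (truncSum c (mergeTensor π (symbTensor χ v s))) atTop (𝓝 a) := by
    refine (h0.add_const a).congr (fun N => by simp) |>.trans (by rw [zero_add])
  have h2 : HasFinitePart (truncSum c (mergeTensor π (symbTensor χ v s))) a :=
    ⟨∅, 0, by simp, by simpa using h1⟩
  rwa [cutoffSum, h2.finitePart_eq]

open Classical in
theorem truncSum_mergeTensor_eq_sum (c : Version) {χ : ℝ → ℝ} (hχ : IsCutoff χ)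
    (π : Fin m → Fin p) (s : Fin m → ℂ) (N : ℕ) :
    truncSum c (mergeTensor π (symbTensor χ v s)) N =
      ∑ n ∈ ((Fintype.piFinset fun _ : Fin p => Finset.Icc 1 N).subtype (IsChain c)),
        ∏ i, ((n.1 (π i) : ℂ) + (v i : ℂ)) ^ (-(s i)) := by
  rw [truncSum_congr c fun j n hn => mergeTensor_symbTensor_natCast hχ π s j hn, truncSum]
  rw [← Finset.sum_subtype_eq_sum_filter]
  refine Finset.sum_congr rfl fun n _ => ?_
  rw [← Finset.prod_fiberwise_of_maps_to (s := Finset.univ) (t := Finset.univ) (g := π)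
    fun _ _ => Finset.mem_univ _]
  refine Finset.prod_congr rfl fun j _ => Finset.prod_congr rfl fun i hi => ?_
  rw [shiftedPow, (Finset.mem_filter.1 hi).2]
  push_cast
  rfl

/-- Replacing `s` by its real parts turns the terms into their absolute values and preserves the
domain, so convergence of the truncated sums bounds the finite sums of norms. Summability then
identifies the sum with the limit along the truncations. -/
theorem hasSum_cutoffSum (c : Version) {χ : ℝ → ℝ} (hχ : IsCutoff χ)
    (hv : ∀ i, 0 ≤ v i) (π : Fin m → Fin p) {s : Fin m → ℂ}
    (hs : mergeArgs π s ∈ convergenceDomain p) :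
    HasSum (fun n : {n : Fin p → ℕ // IsChain c n} =>
      ∏ i, ((n.1 (π i) : ℂ) + (v i : ℂ)) ^ (-(s i)))
      (cutoffSum c (mergeTensor π (symbTensor χ v s))) := by
  classical
  set S : ℕ → Finset {n : Fin p → ℕ // IsChain c n} := fun N =>
    (Fintype.piFinset fun _ : Fin p => Finset.Icc 1 N).subtype (IsChain c) with hS
  have hSt : Tendsto S atTop atTop := by
    refine tendsto_atTop_finset_of_monotone (fun N N' hN n hn => ?_) fun n => ?_
    · simp only [hS, Finset.mem_subtype, Fintype.mem_piFinset, Finset.mem_Icc] at hn ⊢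
      exact fun i => ⟨(hn i).1, (hn i).2.trans hN⟩
    · refine ⟨∑ i, n.1 i, ?_⟩
      simp only [hS, Finset.mem_subtype, Fintype.mem_piFinset, Finset.mem_Icc]
      exact fun i => ⟨n.2.1 i, Finset.single_le_sum (f := n.1) (fun _ _ => Nat.zero_le _)
        (Finset.mem_univ i)⟩
  have hsummable : Summable fun n : {n : Fin p → ℕ // IsChain c n} =>
      ∏ i, ((n.1 (π i) : ℂ) + (v i : ℂ)) ^ (-(s i)) := by
    have hs' : mergeArgs π (fun i => ((s i).re : ℂ)) ∈ convergenceDomain p := by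
      intro j
      have := hs j
      rw [sum_Iic_mergeArgs, Complex.re_sum] at this ⊢
      simpa using this
    have hterm : ∀ n : {n : Fin p → ℕ // IsChain c n},
        ∏ i, ((n.1 (π i) : ℂ) + (v i : ℂ)) ^ (-((s i).re : ℂ)) =
          ((‖∏ i, ((n.1 (π i) : ℂ) + (v i : ℂ)) ^ (-(s i))‖ : ℝ) : ℂ) := by
      intro n
      rw [norm_prod]
      push_cast
      refine Finset.prod_congr rfl fun i _ => ?_
      have hpos : (0 : ℝ) < n.1 (π i) + v i :=
        add_pos_of_pos_of_nonneg (by exact_mod_cast n.2.1 (π i)) (hv i)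
      have e : (n.1 (π i) : ℂ) + (v i : ℂ) = ((n.1 (π i) + v i : ℝ) : ℂ) := by push_cast; rfl
      rw [e, Complex.norm_cpow_eq_rpow_re_of_pos hpos, Complex.neg_re,
        Complex.ofReal_cpow hpos.le, Complex.ofReal_neg]
    have hbdd := (tendsto_truncSum c hχ hv π hs').norm.bddAbove_range
    obtain ⟨C, hC⟩ := hbdd
    refine Summable.of_norm (summable_of_sum_le (c := C) (fun _ => norm_nonneg _) fun u => ?_)
    obtain ⟨N, hN⟩ := (hSt.eventually (eventually_ge_atTop u)).exists
    refine (Finset.sum_le_sum_of_subset_of_nonneg hN fun _ _ _ => norm_nonneg _).trans ?_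
    have h1 := hC ⟨N, rfl⟩
    simp only [truncSum_mergeTensor_eq_sum c hχ, hterm] at h1
    rw [← Complex.ofReal_sum, Complex.norm_real] at h1
    exact (Real.le_norm_self _).trans h1
  have h1 := hsummable.hasSum.comp hSt
  have h2 := (tendsto_truncSum c hχ hv π hs).congr fun N => truncSum_mergeTensor_eq_sum c hχ π s N
  rw [tendsto_nhds_unique h2 h1]
  exact hsummable.hasSum

end Letters

/-! ### Finite parts of products and the stuffle relation. -/

section Stuffle

theorem truncSum_mul_truncSum (c : Version) {k l : ℕ} (f : Fin (k + l) → ℝ → ℂ) (N : ℕ) :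
    truncSum c (fun i => f (Fin.castAdd l i)) N * truncSum c (fun i => f (Fin.natAdd k i)) N =
      ∑ r ∈ Finset.range (min k l + 1), stuffleSign c ^ r *
        ∑ π ∈ mixSh k l r, truncSum c (mergeTensor π f) N := by
  have h := sum_mixSh_eq_quasiShuffleSum (stuffleSign c)
    (fun (i : Fin (k + l)) (n : ℕ) => f i (n : ℝ)) fun w => nest c w N
  rw [truncSum_eq_nest, truncSum_eq_nest, nest_mul_nest, ← h]
  refine Finset.sum_congr rfl fun r _ => ?_
  congr 1
  refine Finset.sum_congr rfl fun π _ => ?_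
  rw [truncSum_eq_nest]
  congr 2
  funext j n
  rw [Finset.prod_apply, mergeTensor]

/-- The shuffle that puts the first `j + 1` letters of the first word and the first `j' + 1`
letters of the second word in front. -/
def frontShuffle {k l : ℕ} (j : Fin k) (j' : Fin l) : Fin (k + l) → Fin (k + l - 0) :=
  Fin.addCases
    (fun a => if h : a ≤ j then ⟨a, by omega⟩ else ⟨a + j' + 1, by omega⟩)
    (fun b => if h : b ≤ j' then ⟨b + j + 1, by omega⟩ else ⟨b + k, by omega⟩)

theorem frontShuffle_castAdd {k l : ℕ} (j : Fin k) (j' : Fin l) (a : Fin k) :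
    (frontShuffle j j' (Fin.castAdd l a) : ℕ) = if a ≤ j then (a : ℕ) else a + j' + 1 := by
  rw [frontShuffle, Fin.addCases_left]
  split_ifs <;> rfl

theorem frontShuffle_natAdd {k l : ℕ} (j : Fin k) (j' : Fin l) (b : Fin l) :
    (frontShuffle j j' (Fin.natAdd k b) : ℕ) = if b ≤ j' then (b + j + 1 : ℕ) else b + k := by
  rw [frontShuffle, Fin.addCases_right]
  split_ifs <;> rfl

theorem frontShuffle_mem_mixSh {k l : ℕ} (j : Fin k) (j' : Fin l) :
    frontShuffle j j' ∈ mixSh k l 0 := by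
  simp only [mixSh, Finset.mem_filter, Finset.mem_univ, true_and]
  refine ⟨?_, fun a b hab => ?_, fun a b hab => ?_⟩
  · have hinj : Function.Injective (frontShuffle j j') := by
      intro x y hxy
      have h := congrArg Fin.val hxy
      induction x using Fin.addCases with
      | left a =>
        induction y using Fin.addCases with
        | left b =>
          rw [frontShuffle_castAdd, frontShuffle_castAdd] at h
          congr 1
          ext
          split_ifs at h <;> simp only [Fin.le_def] at * <;> omega
        | right b =>
          rw [frontShuffle_castAdd, frontShuffle_natAdd] at h
          exfalso
          split_ifs at h <;> simp only [Fin.le_def] at * <;> omega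
      | right a =>
        induction y using Fin.addCases with
        | left b =>
          rw [frontShuffle_castAdd, frontShuffle_natAdd] at h
          exfalso
          split_ifs at h <;> simp only [Fin.le_def] at * <;> omega
        | right b =>
          rw [frontShuffle_natAdd, frontShuffle_natAdd] at h
          congr 1
          ext
          split_ifs at h <;> simp only [Fin.le_def] at * <;> omega
    exact ((Fintype.bijective_iff_injective_and_card _).2 ⟨hinj, by simp⟩).2
  · rw [Fin.lt_def] at hab ⊢
    simp only [frontShuffle_castAdd, Fin.le_def]
    split_ifs <;> omega
  · rw [Fin.lt_def] at hab ⊢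
    simp only [frontShuffle_natAdd, Fin.le_def]
    split_ifs <;> omega

/-- If exponents from prefixes of lengths `j + 1` and `j' + 1` cancel, the sum of `s` over both
prefixes is the integer `j + j' + 2 - n - n'`. It is the partial sum of length `j + j' + 2` along
`frontShuffle j j'`, hence a resonance. -/
theorem mergeArgs_frontShuffle_mem_polarSet {k l : ℕ} {s : Fin (k + l) → ℂ} {x y : ℂ}
    (hx : x ∈ expo (List.ofFn fun i => s (Fin.castAdd l i)))
    (hy : y ∈ expo (List.ofFn fun i => s (Fin.natAdd k i))) (hxy : x + y = 0) :
    ∃ π ∈ mixSh k l 0, mergeArgs π s ∈ polarSet (k + l - 0) := by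
  obtain ⟨j, n, rfl⟩ := (mem_expo_ofFn _ _).1 hx
  obtain ⟨j', n', rfl⟩ := (mem_expo_ofFn _ _).1 hy
  refine ⟨frontShuffle j j', frontShuffle_mem_mixSh j j', ⟨j + j' + 1, by omega⟩,
    (j : ℕ) + (j' : ℕ) + 2 - n - n', ?_, ?_⟩
  · push_cast; omega
  · rw [sum_Iic_mergeArgs, Finset.sum_filter, Fin.sum_univ_add]
    have e1 : ∀ a : Fin k, (frontShuffle j j' (Fin.castAdd l a) ≤
        (⟨j + j' + 1, by omega⟩ : Fin (k + l - 0))) ↔ a ∈ Finset.Iic j := by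
      intro a
      simp only [Fin.le_def, frontShuffle_castAdd, Finset.mem_Iic]
      split_ifs <;> omega
    have e2 : ∀ b : Fin l, (frontShuffle j j' (Fin.natAdd k b) ≤
        (⟨j + j' + 1, by omega⟩ : Fin (k + l - 0))) ↔ b ∈ Finset.Iic j' := by
      intro b
      simp only [Fin.le_def, frontShuffle_natAdd, Finset.mem_Iic]
      split_ifs <;> omega
    simp only [e1, e2]
    rw [← Finset.sum_filter, ← Finset.sum_filter, Finset.filter_mem_eq_inter,
      Finset.filter_mem_eq_inter, Finset.univ_inter, Finset.univ_inter]
    push_cast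
    linear_combination -hxy

theorem truncSum_sub_cutoffSum_mem_asymp_compl (c : Version) {χ : ℝ → ℝ} (hχ : IsCutoff χ)
    {m p : ℕ} {v : Fin m → ℝ} (hv : ∀ i, 0 ≤ v i) (π : Fin m → Fin p) {s : Fin m → ℂ}
    (hs : mergeArgs π s ∉ polarSet p) :
    (truncSum c (mergeTensor π (symbTensor χ v s)) -
      fun _ => cutoffSum c (mergeTensor π (symbTensor χ v s))) ∈ Asymp {0}ᶜ :=
  have h : expo (List.ofFn (mergeArgs π s)) ⊆ {0}ᶜ :=
    Set.subset_compl_singleton_iff.2 (by rwa [zero_mem_expo_ofFn_iff])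
  asymp_mono h (truncSum_sub_cutoffSum_mem_asymp c hχ hv π hs)

theorem truncSum_mul_sub_mem_asymp_compl (c : Version) {χ : ℝ → ℝ} (hχ : IsCutoff χ) {k l : ℕ}
    {v : Fin (k + l) → ℝ} (hv : ∀ i, 0 ≤ v i) {s : Fin (k + l) → ℂ}
    (hs : ∀ r ≤ min k l, ∀ π ∈ mixSh k l r, mergeArgs π s ∉ polarSet (k + l - r)) :
    (truncSum c (symbTensor χ (fun i => v (Fin.castAdd l i)) (fun i => s (Fin.castAdd l i))) *
        truncSum c (symbTensor χ (fun i => v (Fin.natAdd k i)) (fun i => s (Fin.natAdd k i))) -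
      fun _ => ∑ r ∈ Finset.range (min k l + 1), stuffleSign c ^ r *
        ∑ π ∈ mixSh k l r, cutoffSum c (mergeTensor π (symbTensor χ v s))) ∈ Asymp {0}ᶜ := by
  have hsum : ∑ r ∈ Finset.range (min k l + 1), stuffleSign c ^ r • ∑ π ∈ mixSh k l r,
      (truncSum c (mergeTensor π (symbTensor χ v s)) -
        fun _ => cutoffSum c (mergeTensor π (symbTensor χ v s))) ∈ Asymp {0}ᶜ :=
    Submodule.sum_mem _ fun r hr => Submodule.smul_mem _ _ (Submodule.sum_mem _ fun π hπ =>
      truncSum_sub_cutoffSum_mem_asymp_compl c hχ hv π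
        (hs r (Nat.lt_succ_iff.1 (Finset.mem_range.1 hr)) π hπ))
  refine (congrArg (· ∈ Asymp {0}ᶜ) (funext fun N => ?_)).mp hsum
  have hmul := truncSum_mul_truncSum c (symbTensor χ v s) N
  simp only [Finset.sum_apply, Pi.smul_apply, Pi.sub_apply, smul_eq_mul,
    Finset.sum_sub_distrib, mul_sub]
  rw [← hmul]
  rfl

theorem truncSum_mul_truncSum_sub_mem_asymp_compl (c : Version) {χ : ℝ → ℝ} (hχ : IsCutoff χ)
    {k l : ℕ} {v : Fin (k + l) → ℝ} (hv : ∀ i, 0 ≤ v i) {s : Fin (k + l) → ℂ}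
    (hs : s ∉ stufflePolarSet k l) :
    (truncSum c (symbTensor χ (fun i => v (Fin.castAdd l i)) (fun i => s (Fin.castAdd l i))) *
        truncSum c (symbTensor χ (fun i => v (Fin.natAdd k i)) (fun i => s (Fin.natAdd k i))) -
      fun _ => multiZeta c χ (fun i => v (Fin.castAdd l i)) (fun i => s (Fin.castAdd l i)) *
        multiZeta c χ (fun i => v (Fin.natAdd k i)) (fun i => s (Fin.natAdd k i))) ∈
      Asymp {0}ᶜ := by
  simp only [stufflePolarSet, Set.mem_ofPred_eq, not_or, not_exists, not_and] at hs
  obtain ⟨hs1, hs2, hs3⟩ := hs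
  rw [← mergeArgs_id (fun i => s (Fin.castAdd l i))] at hs1
  rw [← mergeArgs_id (fun i => s (Fin.natAdd k i))] at hs2
  have h1 := truncSum_sub_cutoffSum_mem_asymp c hχ (fun i => hv (Fin.castAdd l i)) id hs1
  have h2 := truncSum_sub_cutoffSum_mem_asymp c hχ (fun i => hv (Fin.natAdd k i)) id hs2
  have h1' := truncSum_sub_cutoffSum_mem_asymp_compl c hχ (fun i => hv (Fin.castAdd l i)) id hs1
  have h2' := truncSum_sub_cutoffSum_mem_asymp_compl c hχ (fun i => hv (Fin.natAdd k i)) id hs2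
  rw [mergeTensor_id] at h1 h2 h1' h2'
  rw [mergeArgs_id] at h1 h2
  -- The product of the two non-constant parts has no exponent `0`, by the front shuffle argument.
  -- The product minus `a₁ a₂` is then `(u₁ - a₁)(u₂ - a₂) + a₂ (u₁ - a₁) + a₁ (u₂ - a₂)`.
  have h12 := Asymp.mul (Z := {0}ᶜ) (fun x hx y hy hxy => by
    obtain ⟨π, hπ, hpol⟩ := mergeArgs_frontShuffle_mem_polarSet hx hy hxy
    exact hs3 0 (Nat.zero_le _) π hπ hpol) h1 h2
  unfold multiZeta
  generalize truncSum c (symbTensor χ (fun i => v (Fin.castAdd l i))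
    fun i => s (Fin.castAdd l i)) = u₁ at *
  generalize truncSum c (symbTensor χ (fun i => v (Fin.natAdd k i))
    fun i => s (Fin.natAdd k i)) = u₂ at *
  generalize cutoffSum c (symbTensor χ (fun i => v (Fin.castAdd l i))
    fun i => s (Fin.castAdd l i)) = a₁ at *
  generalize cutoffSum c (symbTensor χ (fun i => v (Fin.natAdd k i))
    fun i => s (Fin.natAdd k i)) = a₂ at *
  have := Submodule.add_mem _ (Submodule.add_mem _ h12
    (Submodule.smul_mem _ a₂ h1')) (Submodule.smul_mem _ a₁ h2')
  refine (congrArg (· ∈ Asymp {0}ᶜ) (funext fun N => ?_)).mp this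
  simp only [Pi.sub_apply, Pi.add_apply, Pi.mul_apply, Pi.smul_apply, smul_eq_mul]
  ring

/-- Both sides are the finite part of one sequence, the product of the truncated sums: once by
multiplicativity, once by the exact quasi-shuffle identity. -/
theorem stuffle (c : Version) {χ : ℝ → ℝ} (hχ : IsCutoff χ) {k l : ℕ} {v : Fin (k + l) → ℝ}
    (hv : ∀ i, 0 ≤ v i) {s : Fin (k + l) → ℂ} (hs : s ∉ stufflePolarSet k l) :
    multiZeta c χ (fun i => v (Fin.castAdd l i)) (fun i => s (Fin.castAdd l i)) *
        multiZeta c χ (fun i => v (Fin.natAdd k i)) (fun i => s (Fin.natAdd k i)) =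
      ∑ r ∈ Finset.range (min k l + 1), stuffleSign c ^ r *
        ∑ π ∈ mixSh k l r, cutoffSum c (mergeTensor π (symbTensor χ v s)) := by
  obtain ⟨b, hb, hb'⟩ := hasFinitePart_of_sub_mem_asymp
    (truncSum_mul_truncSum_sub_mem_asymp_compl c hχ hv hs)
  obtain ⟨b', hb₁, hb₁'⟩ := hasFinitePart_of_sub_mem_asymp
    (truncSum_mul_sub_mem_asymp_compl c hχ hv fun r hr π hπ hpol =>
      hs (Or.inr (Or.inr ⟨r, hr, π, hπ, hpol⟩)))
  rw [← hb' (by simp), ← hb₁' (by simp)]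
  exact hb.unique hb₁

/-- Merged symbols carry a power of the cut-off and so need not be symbols of the same form, but
they agree with them at positive integers, where powers of the nonzero base `n + w` multiply. -/
theorem cutoffSum_mergeTensor_of_const (c : Version) {χ : ℝ → ℝ} (hχ : IsCutoff χ) {m p : ℕ}
    (π : Fin m → Fin p) {w : ℝ} (hw : 0 ≤ w) (s : Fin m → ℂ) :
    cutoffSum c (mergeTensor π (symbTensor χ (fun _ => w) s)) =
      multiZeta c χ (fun _ => w) (mergeArgs π s) := by
  refine cutoffSum_congr c fun j n hn => ?_
  rw [mergeTensor_symbTensor_natCast hχ π s j hn, symbTensor_natCast hχ _ j hn]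
  have hne : (((n : ℝ) + w : ℝ) : ℂ) ≠ 0 := by
    have : (0 : ℝ) < n := by exact_mod_cast hn
    exact_mod_cast (by positivity : (n : ℝ) + w ≠ 0)
  simp only [mergeTensor, shiftedPow, mergeArgs, Complex.cpow_def_of_ne_zero hne,
    ← Complex.exp_sum, ← Finset.mul_sum, Finset.sum_neg_distrib]

end Stuffle

end NestedZeta

/-! ### Assembly; the unmerged zeta functions are the case `π = id`. -/

open NestedZeta in
theorem mainTheorem6 (c : Version) (χ : ℝ → ℝ) (hχ : IsCutoff χ) :
    -- convergence and meromorphic extension by the cut-off nested sum, location of the poles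
    (∀ (k : ℕ) (v : Fin k → ℝ), (∀ i, 0 ≤ v i) →
      (∀ s : Fin k → ℂ, ∃! a : ℂ, HasFinitePart (truncSum c (symbTensor χ v s)) a) ∧
      (∀ s ∈ convergenceDomain k,
        HasSum (fun n : {n : Fin k → ℕ // IsChain c n} =>
          ∏ i, ((n.1 i : ℂ) + (v i : ℂ)) ^ (-(s i))) (multiZeta c χ v s)) ∧
      IsMeromorphic (fun s : Fin k → ℂ => multiZeta c χ v s) ∧
      AnalyticOnNhd ℂ (fun s : Fin k → ℂ => multiZeta c χ v s) (polarSet k)ᶜ) ∧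
    -- stuffle relations, for arbitrary parameters
    (∀ (k l : ℕ) (v : Fin (k + l) → ℝ), (∀ i, 0 ≤ v i) →
      (∀ r ≤ min k l, ∀ π ∈ mixSh k l r,
        (∀ s : Fin (k + l) → ℂ,
          ∃! a : ℂ, HasFinitePart (truncSum c (mergeTensor π (symbTensor χ v s))) a) ∧
        (∀ s : Fin (k + l) → ℂ, mergeArgs π s ∈ convergenceDomain (k + l - r) →
          HasSum (fun n : {n : Fin (k + l - r) → ℕ // IsChain c n} =>
            ∏ i, ((n.1 (π i) : ℂ) + (v i : ℂ)) ^ (-(s i)))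
            (cutoffSum c (mergeTensor π (symbTensor χ v s)))) ∧
        IsMeromorphic (fun s : Fin (k + l) → ℂ =>
          cutoffSum c (mergeTensor π (symbTensor χ v s))) ∧
        AnalyticOnNhd ℂ (fun s : Fin (k + l) → ℂ =>
          cutoffSum c (mergeTensor π (symbTensor χ v s)))
          {s | mergeArgs π s ∉ polarSet (k + l - r)}) ∧
      (∀ s : Fin (k + l) → ℂ, s ∉ stufflePolarSet k l →
        multiZeta c χ (fun i => v (Fin.castAdd l i)) (fun i => s (Fin.castAdd l i)) *
            multiZeta c χ (fun i => v (Fin.natAdd k i)) (fun i => s (Fin.natAdd k i)) =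
          ∑ r ∈ Finset.range (min k l + 1), stuffleSign c ^ r *
            ∑ π ∈ mixSh k l r, cutoffSum c (mergeTensor π (symbTensor χ v s)))) ∧
    -- stuffle relations, for equal parameters
    (∀ (k l : ℕ) (w : ℝ), 0 ≤ w → ∀ s : Fin (k + l) → ℂ, s ∉ stufflePolarSet k l →
      multiZeta c χ (fun _ => w) (fun i => s (Fin.castAdd l i)) *
          multiZeta c χ (fun _ => w) (fun i => s (Fin.natAdd k i)) =
        ∑ r ∈ Finset.range (min k l + 1), stuffleSign c ^ r *
          ∑ π ∈ mixSh k l r, multiZeta c χ (fun _ => w) (mergeArgs π s)) := by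
  refine ⟨fun k v hv => ⟨fun s => ?_, fun s hs => ?_, ?_, ?_⟩, fun k l v hv =>
    ⟨fun r _ π hπ => ⟨existsUnique_hasFinitePart c hχ hv π, fun s => hasSum_cutoffSum c hχ hv π,
      isMeromorphic_cutoffSum c hχ hv (Finset.mem_filter.1 hπ).2.1,
      analyticOnNhd_cutoffSum c hχ hv π⟩, fun s hs => stuffle c hχ hv hs⟩,
    fun k l w hw s hs => ?_⟩
  · simpa only [mergeTensor_id] using existsUnique_hasFinitePart c hχ hv id s
  · have h := hasSum_cutoffSum c hχ hv id (s := s) (by rwa [mergeArgs_id])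
    rwa [mergeTensor_id] at h
  · have h := isMeromorphic_cutoffSum c hχ hv Function.surjective_id
    simp only [mergeTensor_id] at h
    exact h
  · have h := analyticOnNhd_cutoffSum c hχ hv id
    simp only [mergeTensor_id, mergeArgs_id] at h
    exact h
  · have h := stuffle c hχ (v := fun _ => w) (fun _ => hw) hs
    simp only [cutoffSum_mergeTensor_of_const c hχ _ hw] at h
    exact h
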